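/- Let $\alpha>1$ and $\nu>0$, let $f:\mathbb R\to\mathbb R$ be $C^\infty$, and let $u_0$ be a real-valued $C^\infty$ function on the circle $S^1=\mathbb R/\mathbb Z$. Consider the fractional Burgers equation $$\partial_t u+\partial_x(f(u))+\nu\Lambda^{\alpha}u=0,\qquad u(0)=u_0,$$ on $S^1$, where $\Lambda=\sqrt{-\partial_x^2}$. For $v\in L^2(S^1)$ with Fourier coefficients $\hat v_k$ and $t\ge 0$ put $S_L(t)v=e^{-t\Lambda^\alpha}v=\sum_{k\in\mathbb Z}e^{-(2\pi|k|)^{\alpha}t}\,\hat v_k\,e^{2\pi i k x}$. For $s\ge 0$ let $H^s$ be the space of real-valued $v\in L^2(S^1)$ with $\sum_k|k|^{2s}|\hat v_k|^2<\infty$, with norm $\|v\|_{L^2}+(2\pi)^s\big(\sum_k|k|^{2s}|\hat v_k|^2\big)^{1/2}$, and for a time interval $I$ let $C(I,H^s)$ be the set of continuous functions from $I$ to $H^s$. For $0<T\le\infty$, a mild $H^1$ solution on $[0,T)$ is a $Y\in C([0,T),H^1)$ such that for all $t\in[0,T)$ $$Y(t)=S_L(\nu t)u_0-\int_0^t S_L(\nu(t-\tau))\,\big(f(Y(\tau))\big)_x\,d\tau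 ,$$ where $(\cdot)_x$ is the weak derivative in space and the integral is a Bochner integral in $L^2(S^1)$. Then: 1. If $0<T\le\infty$, $Y$ is a mild $H^1$ solution on $[0,T)$ and $Y\in C([0,T),H^s)$ for some real $s\ge 1$, then $Y\in C([0,T),H^{s+(\alpha-1)/2})$. 2. There are $T>0$ and a mild $H^1$ solution on $[0,T)$. 3. Two mild $H^1$ solutions on the same interval $[0,T)$, $0<T\le\infty$, coincide. 4. Every mild $H^1$ solution $Y$ on $[0,T)$, $0<T\le\infty$, belongs to $C([0,T),H^m)$ for every integer $m\ge 0$, and $Y(t)$ is a $C^\infty$ function of $x$ for every $t\in[0,T)$. 5. If moreover $\alpha<2$ and $f$ is strongly convex, i.e. $f''\ge\sigma$ on $\mathbb R$ for some $\sigma>0$, then there is a mild $H^1$ solution on $[0,\infty)$, and every mild $H^1$ solution on an interval $[0,T)$, $0<T\le\infty$, is the restriction of it. -/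

import Mathlib

open MeasureTheory Set Filter Topology
open scoped ContDiff

noncomputable section

namespace FracBurgers

/-- Real-valued square integrable functions on the circle `S¹ = ℝ/ℤ` (of total measure `1`). -/
abbrev RealL2 : Type := Lp ℝ 2 (AddCircle.haarAddCircle : Measure UnitAddCircle)

/-- Complex-valued square integrable functions on the circle `S¹ = ℝ/ℤ`. -/
abbrev ComplexL2 : Type := Lp ℂ 2 (AddCircle.haarAddCircle : Measure UnitAddCircle)

/-- A real-valued `L²` function, regarded as a complex-valued one. -/
def toComplex : RealL2 →L[ℝ] ComplexL2 :=
  Complex.ofRealCLM.compLpL 2 AddCircle.haarAddCircle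

/-- The `k`-th complex Fourier coefficient `∫_{S¹} v(x) e^{-2πikx} dx` of a real-valued function
on the circle. -/
def coeff (v : UnitAddCircle → ℝ) (k : ℤ) : ℂ :=
  fourierCoeff (fun x => (v x : ℂ)) k

/-- The fractional heat semigroup `S_L(t) = e^{-tΛ^α}`, `t ≥ 0`, on `L²(S¹)`:
`S_L(t) v = ∑_{k ∈ ℤ} e^{-(2π|k|)^α t} v̂_k e^{2πikx}`, the series converging in `L²`. -/
def heat (α t : ℝ) (v : ComplexL2) : ComplexL2 :=
  ∑' k : ℤ, ((Real.exp (-((2 * Real.pi * |(k : ℝ)|) ^ α * t)) : ℂ) * fourierCoeff v k) •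
    fourierLp 2 k

/-- Membership in the Sobolev space `H^s(S¹)`, `s ≥ 0` (the mean value is arbitrary). -/
def MemH (s : ℝ) (v : RealL2) : Prop :=
  Summable fun k : ℤ => |(k : ℝ)| ^ (2 * s) * ‖coeff v k‖ ^ 2

/-- The norm of `H^s(S¹)`:
`‖v‖_{L²} + (2π)^s (∑_{k ∈ ℤ} |k|^{2s} |v̂_k|²)^{1/2}`. -/
def normH (s : ℝ) (v : RealL2) : ℝ :=
  ‖v‖ + (2 * Real.pi) ^ s * Real.sqrt (∑' k : ℤ, |(k : ℝ)| ^ (2 * s) * ‖coeff v k‖ ^ 2)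

/-- `Y ∈ C(I, H^s)`: on the time set `I`, `Y` takes values in `H^s` and is continuous for the norm
of `H^s`. -/
def ContH (s : ℝ) (I : Set ℝ) (Y : ℝ → RealL2) : Prop :=
  (∀ t ∈ I, MemH s (Y t)) ∧
    ∀ t₀ ∈ I, Tendsto (fun t => normH s (Y t - Y t₀)) (𝓝[I] t₀) (𝓝 0)

/-- `v` is (almost everywhere equal to) a `C^∞` function on the circle. -/
def IsSmooth (v : RealL2) : Prop :=
  ∃ g : UnitAddCircle → ℝ, ContDiff ℝ ∞ (fun x : ℝ => g (x : UnitAddCircle)) ∧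
    v =ᵐ[AddCircle.haarAddCircle] g

/-- `w ∈ L²(S¹)` is the weak derivative of the integrable function `g` on the circle: one has
`ŵ_k = 2πik ĝ_k` for all `k ∈ ℤ`, i.e. `∫ w φ = -∫ g φ'` for the test functions
`φ(x) = e^{-2πikx}`. -/
def IsWeakDeriv (g : UnitAddCircle → ℝ) (w : RealL2) : Prop :=
  Integrable g AddCircle.haarAddCircle ∧
    ∀ k : ℤ, coeff w k = 2 * Real.pi * Complex.I * k * coeff g k

/-- The time interval `[0, T)`, where `T = ⊤` is allowed. -/
def timeInterval (T : EReal) : Set ℝ := {t : ℝ | 0 ≤ t ∧ (t : EReal) < T}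

/-- `Y` is a mild `H¹` solution on `[0, T)` of `∂ₜu + ∂ₓ(f(u)) + ν Λ^α u = 0` with initial
condition `u₀`: `Y ∈ C([0, T), H¹)` and, for all `t ∈ [0, T)`,
`Y(t) = S_L(νt) u₀ - ∫₀ᵗ S_L(ν(t-τ)) (f(Y(τ)))ₓ dτ`, as a Bochner integral in `L²(S¹)`.
The function `G τ` is the weak derivative `(f(Y(τ)))ₓ`. -/
def IsMildSolution (α ν : ℝ) (f : ℝ → ℝ) (u₀ : RealL2) (T : EReal) (Y : ℝ → RealL2) : Prop :=
  ContH 1 (timeInterval T) Y ∧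
    ∃ G : ℝ → RealL2,
      (∀ τ ∈ timeInterval T, IsWeakDeriv (fun x => f (Y τ x)) (G τ)) ∧
      ∀ t ∈ timeInterval T,
        IntervalIntegrable (fun τ => heat α (ν * (t - τ)) (toComplex (G τ))) volume 0 t ∧
        toComplex (Y t) = heat α (ν * t) (toComplex u₀) -
          ∫ τ in (0 : ℝ)..t, heat α (ν * (t - τ)) (toComplex (G τ))

end FracBurgers

end

noncomputable section

namespace FracBurgers

open AddCircle Complex

/-! ### Fourier coefficients of square integrable functions -/

theorem coeff_congr {v w : UnitAddCircle → ℝ} (h : v =ᵐ[haarAddCircle] w) (k : ℤ) :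
    coeff v k = coeff w k := by
  refine congrFun (fourierCoeff_congr_ae ?_) k
  filter_upwards [h] with x hx
  rw [hx]

theorem coeFn_toComplex (v : RealL2) :
    toComplex v =ᵐ[haarAddCircle] fun x => ((v x : ℝ) : ℂ) :=
  Complex.ofRealCLM.coeFn_compLpL v

theorem fourierCoeff_toComplex (v : RealL2) (k : ℤ) :
    fourierCoeff (toComplex v) k = coeff v k :=
  congrFun (fourierCoeff_congr_ae (coeFn_toComplex v)) k

theorem norm_toComplex (v : RealL2) : ‖toComplex v‖ = ‖v‖ := by
  have h : ∀ᵐ x ∂haarAddCircle, ‖toComplex v x‖ = ‖v x‖ := by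
    filter_upwards [coeFn_toComplex v] with x hx
    rw [hx, Complex.norm_real]
  apply le_antisymm
  · exact Lp.norm_le_norm_of_ae_le (h.mono fun x hx => hx.le)
  · exact Lp.norm_le_norm_of_ae_le (h.mono fun x hx => hx.ge)

/-- The `k`-th Fourier coefficient as a continuous linear functional. -/
def coeffL (k : ℤ) : ComplexL2 →L[ℂ] ℂ := innerSL ℂ (fourierLp 2 k)

theorem coeffL_apply (k : ℤ) (z : ComplexL2) : coeffL k z = fourierCoeff z k := by
  rw [← fourierBasis_repr, HilbertBasis.repr_apply_apply, coe_fourierBasis]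
  rfl

/-- The `k`-th Fourier coefficient as a continuous real-linear functional on real functions. -/
def coeffR (k : ℤ) : RealL2 →L[ℝ] ℂ := ((coeffL k).restrictScalars ℝ).comp toComplex

theorem coeffR_apply (k : ℤ) (v : RealL2) : coeffR k v = coeff v k := by
  rw [← fourierCoeff_toComplex, ← coeffL_apply]
  rfl

theorem coeff_sub (v w : RealL2) (k : ℤ) : coeff (v - w : RealL2) k = coeff v k - coeff w k := by
  simp only [← coeffR_apply, map_sub]

theorem coeff_add (v w : RealL2) (k : ℤ) : coeff (v + w : RealL2) k = coeff v k + coeff w k := by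
  simp only [← coeffR_apply, map_add]

theorem coeff_smul (c : ℝ) (v : RealL2) (k : ℤ) : coeff (c • v : RealL2) k = c * coeff v k := by
  simp only [← coeffR_apply, map_smul, Complex.real_smul]

theorem continuous_coeff (k : ℤ) : Continuous fun v : RealL2 => coeff v k := by
  simp only [← coeffR_apply]
  exact (coeffR k).continuous

theorem hasSum_sq_fourierCoeff_norm (z : ComplexL2) :
    HasSum (fun k => ‖fourierCoeff z k‖ ^ 2) (‖z‖ ^ 2) := by
  convert hasSum_sq_fourierCoeff z using 1
  rw [@norm_sq_eq_re_inner ℂ, L2.inner_def, ← integral_re (L2.integrable_inner z z)]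
  refine integral_congr_ae (Eventually.of_forall fun x => ?_)
  exact (@norm_sq_eq_re_inner ℂ _ _ _ _ (z x)).symm

theorem hasSum_sq_coeff (v : RealL2) : HasSum (fun k => ‖coeff v k‖ ^ 2) (‖v‖ ^ 2) := by
  have := hasSum_sq_fourierCoeff_norm (toComplex v)
  simpa only [fourierCoeff_toComplex, norm_toComplex] using this

theorem norm_coeff_le (v : RealL2) (k : ℤ) : ‖coeff v k‖ ≤ ‖v‖ := by
  refine le_of_sq_le_sq ?_ (norm_nonneg v)
  exact le_hasSum (hasSum_sq_coeff v) k fun _ _ => sq_nonneg _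

theorem complexL2_ext {z w : ComplexL2} (h : ∀ k, fourierCoeff z k = fourierCoeff w k) :
    z = w := by
  have h1 := hasSum_fourier_series_L2 z
  simp only [h] at h1
  exact h1.unique (hasSum_fourier_series_L2 w)

theorem toComplex_injective : Function.Injective toComplex := by
  refine (injective_iff_map_eq_zero toComplex).2 fun v hv => ?_
  rw [← norm_eq_zero, ← norm_toComplex, hv, norm_zero]

theorem realL2_ext {v w : RealL2} (h : ∀ k, coeff v k = coeff w k) : v = w := by
  apply toComplex_injective
  apply complexL2_ext
  simpa only [fourierCoeff_toComplex] using h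

theorem norm_le_of_coeff_le {z : ComplexL2} {w : RealL2} {C : ℝ} (hC : 0 ≤ C)
    (h : ∀ k, ‖fourierCoeff z k‖ ≤ C * ‖coeff w k‖) : ‖z‖ ≤ C * ‖w‖ := by
  refine le_of_sq_le_sq ?_ (by positivity)
  rw [mul_pow]
  refine hasSum_le (fun k => ?_) (hasSum_sq_fourierCoeff_norm z)
    ((hasSum_sq_coeff w).mul_left (C ^ 2))
  rw [← mul_pow]
  exact pow_le_pow_left₀ (norm_nonneg _) (h k) 2

theorem norm_real_le_of_coeff_le {v w : RealL2} {C : ℝ} (hC : 0 ≤ C)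
    (h : ∀ k, ‖coeff v k‖ ≤ C * ‖coeff w k‖) : ‖v‖ ≤ C * ‖w‖ := by
  rw [← norm_toComplex v]
  exact norm_le_of_coeff_le hC (by simpa only [fourierCoeff_toComplex] using h)

theorem coeff_neg_index (v : UnitAddCircle → ℝ) (k : ℤ) :
    coeff v (-k) = starRingEnd ℂ (coeff v k) := by
  unfold coeff fourierCoeff
  rw [← integral_conj]
  congr 1
  ext x
  simp [smul_eq_mul]

/-- The real part of a complex-valued function. -/
def realPart : ComplexL2 →L[ℝ] RealL2 := Complex.reCLM.compLpL 2 haarAddCircle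

theorem coeFn_realPart (z : ComplexL2) : realPart z =ᵐ[haarAddCircle] fun x => (z x).re :=
  Complex.reCLM.coeFn_compLpL z

theorem integrable_coe (z : ComplexL2) : Integrable z haarAddCircle :=
  (Lp.memLp z).integrable (by norm_num)

theorem integrable_coe_real (v : RealL2) : Integrable v haarAddCircle :=
  (Lp.memLp v).integrable (by norm_num)

theorem fourierCoeff_conj (z : UnitAddCircle → ℂ) (k : ℤ) :
    fourierCoeff (fun x => starRingEnd ℂ (z x)) k = starRingEnd ℂ (fourierCoeff z (-k)) := by
  unfold fourierCoeff
  rw [← integral_conj]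
  congr 1
  ext x
  simp [smul_eq_mul]

theorem coeff_realPart (z : ComplexL2) (k : ℤ) :
    coeff (realPart z) k
      = (fourierCoeff z k + starRingEnd ℂ (fourierCoeff z (-k))) / 2 := by
  rw [coeff_congr (coeFn_realPart z)]
  have h1 : (fun x => (((z x).re : ℝ) : ℂ))
      = fun x => (1 / 2 : ℂ) * ((z + fun x => starRingEnd ℂ (z x)) x) := by
    ext x
    rw [Pi.add_apply, Complex.add_conj]
    push_cast
    ring
  have hz := integrable_coe z
  have hz' : Integrable (fun x => starRingEnd ℂ (z x)) haarAddCircle := by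
    have := Complex.conjCLE.toContinuousLinearMap.integrable_comp hz
    exact this
  unfold coeff
  rw [h1, fourierCoeff.const_mul, fourierCoeff.add hz hz', Pi.add_apply, fourierCoeff_conj]
  ring

theorem exists_complexL2_of_coeff {c : ℤ → ℂ} (hc : Summable fun k => ‖c k‖ ^ 2) :
    ∃ z : ComplexL2, ∀ k, fourierCoeff z k = c k := by
  have hm : Memℓp c 2 := by
    rw [memℓp_gen_iff (by norm_num)]
    simpa using hc
  refine ⟨fourierBasis.repr.symm ⟨c, hm⟩, fun k => ?_⟩
  rw [← fourierBasis_repr, LinearIsometryEquiv.apply_symm_apply]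

theorem exists_realL2_of_coeff {c : ℤ → ℂ} (hc : Summable fun k => ‖c k‖ ^ 2)
    (hs : ∀ k, c (-k) = starRingEnd ℂ (c k)) : ∃ v : RealL2, ∀ k, coeff v k = c k := by
  obtain ⟨z, hz⟩ := exists_complexL2_of_coeff hc
  refine ⟨realPart z, fun k => ?_⟩
  rw [coeff_realPart, hz, hz, hs, Complex.conj_conj]
  ring

theorem realPart_toComplex (v : RealL2) : realPart (toComplex v) = v := by
  apply realL2_ext
  intro k
  rw [coeff_realPart, fourierCoeff_toComplex, fourierCoeff_toComplex, coeff_neg_index,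
    Complex.conj_conj]
  ring

/-! ### Continuous representatives -/

/-- The sum of the Fourier series, as a continuous function. -/
def fourierSum (c : ℤ → ℂ) : C(UnitAddCircle, ℂ) := ∑' k, c k • fourier k

theorem hasSum_fourierSum {c : ℤ → ℂ} (hc : Summable fun k => ‖c k‖) :
    HasSum (fun k => c k • fourier k) (fourierSum c) := by
  refine Summable.hasSum (Summable.of_norm ?_)
  have : Fact ((0 : ℝ) < 1) := ⟨one_pos⟩
  simpa only [norm_smul, fourier_norm, mul_one] using hc

theorem hasSum_fourierSum_apply {c : ℤ → ℂ} (hc : Summable fun k => ‖c k‖) (x : UnitAddCircle) :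
    HasSum (fun k => c k * fourier k x) (fourierSum c x) := by
  have := (ContinuousMap.evalCLM ℂ x).hasSum (hasSum_fourierSum hc)
  simpa [ContinuousMap.evalCLM] using this

theorem norm_fourierSum_apply_le {c : ℤ → ℂ} (hc : Summable fun k => ‖c k‖) (x : UnitAddCircle) :
    ‖fourierSum c x‖ ≤ ∑' k, ‖c k‖ := by
  rw [← (hasSum_fourierSum_apply hc x).tsum_eq]
  have hn : ∀ k, ‖c k * fourier k x‖ = ‖c k‖ := fun k => by
    rw [norm_mul, fourier_apply, Circle.norm_coe, mul_one]
  refine (norm_tsum_le_tsum_norm ?_).trans_eq ?_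
  · simpa only [hn] using hc
  · simp only [hn]

theorem toLp_fourierSum {c : ℤ → ℂ} (hc : Summable fun k => ‖c k‖) :
    HasSum (fun k => c k • fourierLp 2 k)
      (ContinuousMap.toLp 2 haarAddCircle ℂ (fourierSum c)) := by
  have := (ContinuousMap.toLp 2 haarAddCircle ℂ
    (α := UnitAddCircle) (E := ℂ)).hasSum (hasSum_fourierSum hc)
  simpa [fourierLp] using this

theorem coe_ae_eq_fourierSum (z : ComplexL2) (hc : Summable fun k => ‖fourierCoeff z k‖) :
    z =ᵐ[haarAddCircle] fourierSum (fourierCoeff z) := by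
  have h := (toLp_fourierSum hc).unique (hasSum_fourier_series_L2 z)
  have h2 := ContinuousMap.coeFn_toLp (p := 2) (𝕜 := ℂ) haarAddCircle
    (fourierSum (fourierCoeff z))
  rw [h] at h2
  exact h2

theorem fourierSum_eq_of_continuous (g : C(UnitAddCircle, ℂ))
    (hc : Summable fun k => ‖fourierCoeff g k‖) : fourierSum (fourierCoeff g) = g :=
  (hasSum_fourierSum hc).unique (hasSum_fourier_series_of_summable (Summable.of_norm hc))

/-- The continuous representative of a real function with summable Fourier coefficients. -/
def contRep (v : UnitAddCircle → ℝ) : C(UnitAddCircle, ℝ) :=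
  (⟨Complex.re, Complex.continuous_re⟩ : C(ℂ, ℝ)).comp (fourierSum (coeff v))

theorem contRep_apply (v : UnitAddCircle → ℝ) (x : UnitAddCircle) :
    contRep v x = (fourierSum (coeff v) x).re := rfl

theorem coe_ae_eq_contRep (v : RealL2) (hc : Summable fun k => ‖coeff v k‖) :
    v =ᵐ[haarAddCircle] contRep v := by
  have h := coe_ae_eq_fourierSum (toComplex v) (by simpa only [fourierCoeff_toComplex] using hc)
  have h3 : fourierCoeff (toComplex v) = coeff v := funext (fourierCoeff_toComplex v)
  rw [h3] at h
  filter_upwards [h, coeFn_toComplex v] with x h1 h2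
  rw [contRep_apply, ← h1, h2, Complex.ofReal_re]

theorem abs_contRep_le (v : UnitAddCircle → ℝ) (hc : Summable fun k => ‖coeff v k‖)
    (x : UnitAddCircle) : |contRep v x| ≤ ∑' k, ‖coeff v k‖ :=
  (Complex.abs_re_le_norm _).trans (norm_fourierSum_apply_le hc x)

/-- A continuous real function on the circle as an element of `L²`. -/
def contL2 (g : C(UnitAddCircle, ℝ)) : RealL2 := ContinuousMap.toLp 2 haarAddCircle ℝ g

theorem coeFn_contL2 (g : C(UnitAddCircle, ℝ)) : contL2 g =ᵐ[haarAddCircle] g :=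
  ContinuousMap.coeFn_toLp haarAddCircle g

theorem coeff_contL2 (g : C(UnitAddCircle, ℝ)) (k : ℤ) : coeff (contL2 g) k = coeff g k :=
  coeff_congr (coeFn_contL2 g) k

theorem norm_fourierCoeff_le {g : UnitAddCircle → ℂ} {R : ℝ}
    (h : ∀ᵐ x ∂haarAddCircle, ‖g x‖ ≤ R) (k : ℤ) : ‖fourierCoeff g k‖ ≤ R := by
  unfold fourierCoeff
  have := norm_integral_le_of_norm_le_const (μ := (haarAddCircle : Measure UnitAddCircle))
    (f := fun t => fourier (-k) t • g t) (C := R) ?_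
  · simpa using this
  · filter_upwards [h] with x hx
    rw [norm_smul, fourier_apply, Circle.norm_coe, one_mul]
    exact hx

/-! ### Products and derivatives -/

theorem hasSum_coeff_mul (a b : RealL2) (k : ℤ) :
    HasSum (fun l => coeff a (k - l) * coeff b l) (coeff (fun x => a x * b x) k) := by
  obtain ⟨e, he⟩ : ∃ e : ComplexL2, e =ᵐ[haarAddCircle]
      fun x => fourier k x * ((a x : ℝ) : ℂ) := by
    have h1 : MemLp (fun x => fourier k x * ((a x : ℝ) : ℂ)) 2 haarAddCircle := by
      have h2 : MemLp (fun x => ((a x : ℝ) : ℂ)) 2 (haarAddCircle : Measure UnitAddCircle) :=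
        (Lp.memLp a).ofReal
      refine h2.of_le ((fourier k).continuous.aestronglyMeasurable.mul h2.1) ?_
      refine Eventually.of_forall fun x => ?_
      rw [norm_mul, fourier_apply, Circle.norm_coe, one_mul]
    exact ⟨h1.toLp _, h1.coeFn_toLp⟩
  have h := fourierBasis.hasSum_inner_mul_inner e (toComplex b)
  rw [coe_fourierBasis] at h
  have h1 : ∀ l, inner ℂ e (fourierLp 2 l) = coeff a (k - l) := fun l => by
    rw [L2.inner_def]
    unfold coeff fourierCoeff
    refine integral_congr_ae ?_
    filter_upwards [he, coeFn_fourierLp 2 l] with x h1 h2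
    rw [h1, h2, RCLike.inner_apply, map_mul, Complex.conj_ofReal, ← fourier_neg, neg_sub,
      sub_eq_add_neg, fourier_add, smul_eq_mul]
    ring
  have h2 : ∀ l, inner ℂ (fourierLp 2 l) (toComplex b) = coeff b l := fun l => by
    rw [← fourierCoeff_toComplex, ← coeffL_apply]
    rfl
  have h3 : inner ℂ e (toComplex b) = coeff (fun x => a x * b x) k := by
    rw [L2.inner_def]
    unfold coeff fourierCoeff
    refine integral_congr_ae ?_
    filter_upwards [he, coeFn_toComplex b] with x h1 h2
    rw [h1, h2, RCLike.inner_apply, map_mul, Complex.conj_ofReal, ← fourier_neg, smul_eq_mul]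
    push_cast
    ring
  simpa only [h1, h2, h3] using h

theorem fourierCoeff_of_hasDerivAt {g g' : UnitAddCircle → ℂ} (hg' : Continuous g')
    (h : ∀ x : ℝ, HasDerivAt (fun y : ℝ => g (y : UnitAddCircle)) (g' x) x) (k : ℤ) :
    fourierCoeff g' k = 2 * Real.pi * Complex.I * k * fourierCoeff g k := by
  have hp : ∀ x : ℝ, HasDerivAt (fun y : ℝ => fourier (-k) (y : UnitAddCircle) * g y)
      (-2 * Real.pi * Complex.I * k / (1 : ℝ) * fourier (-k) (x : UnitAddCircle) * g x
        + fourier (-k) (x : UnitAddCircle) * g' x) x := fun x =>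
    (hasDerivAt_fourier_neg 1 k x).mul (h x)
  have hgc : Continuous fun y : ℝ => g (y : UnitAddCircle) :=
    continuous_iff_continuousAt.2 fun x => (h x).continuousAt
  have hfc : Continuous fun y : ℝ => fourier (-k) (y : UnitAddCircle) :=
    (fourier (-k)).continuous.comp (AddCircle.continuous_mk' 1)
  have hgc' : Continuous fun y : ℝ => g' (y : UnitAddCircle) :=
    hg'.comp (AddCircle.continuous_mk' 1)
  have h1 : Continuous fun x : ℝ => -2 * Real.pi * Complex.I * k / (1 : ℝ) *
      fourier (-k) (x : UnitAddCircle) * g x :=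
    (continuous_const.mul hfc).mul hgc
  have h2 : Continuous fun x : ℝ => fourier (-k) (x : UnitAddCircle) * g' x := hfc.mul hgc'
  have hi := intervalIntegral.integral_eq_sub_of_hasDerivAt (a := 0) (b := 0 + 1)
    (fun x _ => hp x) ((h1.add h2).intervalIntegrable _ _)
  have hper : ((0 + 1 : ℝ) : UnitAddCircle) = ((0 : ℝ) : UnitAddCircle) := by
    rw [zero_add, AddCircle.coe_period]
    rfl
  rw [hper, sub_self, intervalIntegral.integral_add (h1.intervalIntegrable _ _)
    (h2.intervalIntegrable _ _)] at hi
  rw [fourierCoeff_eq_intervalIntegral g' k 0, fourierCoeff_eq_intervalIntegral g k 0]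
  simp only [smul_eq_mul]
  have h3 : (∫ x in (0 : ℝ)..0 + 1, -2 * Real.pi * Complex.I * k / (1 : ℝ) *
      fourier (-k) (x : UnitAddCircle) * g x) = -2 * Real.pi * Complex.I * k *
      ∫ x in (0 : ℝ)..0 + 1, fourier (-k) (x : UnitAddCircle) * g x := by
    rw [← intervalIntegral.integral_const_mul]
    congr 1
    ext x
    simp
    ring
  rw [h3] at hi
  simp only [one_div, inv_one, one_smul]
  linear_combination hi

/-! ### Weak derivatives and the chain rule -/

theorem norm_two_pi_I_mul (k : ℤ) : ‖2 * Real.pi * Complex.I * k‖ = 2 * Real.pi * |(k : ℝ)| := by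
  simp [abs_of_pos Real.pi_pos]

theorem conj_two_pi_I_mul (k : ℤ) :
    2 * Real.pi * Complex.I * ((-k : ℤ) : ℂ)
      = starRingEnd ℂ (2 * Real.pi * Complex.I * k) := by
  have : starRingEnd ℂ 2 = 2 := map_ofNat _ 2
  simp [this]

theorem isWeakDeriv_iff (v w : RealL2) :
    IsWeakDeriv v w ↔ ∀ k, coeff w k = 2 * Real.pi * Complex.I * k * coeff v k :=
  ⟨fun h => h.2, fun h => ⟨integrable_coe_real v, h⟩⟩

theorem MemH.exists_isWeakDeriv {v : RealL2} (h : MemH 1 v) : ∃ w : RealL2, IsWeakDeriv v w := by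
  have h1 : Summable fun k : ℤ => ‖2 * Real.pi * Complex.I * k * coeff v k‖ ^ 2 := by
    refine (h.mul_left ((2 * Real.pi) ^ 2)).congr fun k => ?_
    rw [norm_mul, norm_two_pi_I_mul, mul_one, Real.rpow_two]
    ring
  obtain ⟨w, hw⟩ := exists_realL2_of_coeff h1 fun k => by
    rw [conj_two_pi_I_mul, coeff_neg_index, ← map_mul]
  exact ⟨w, (isWeakDeriv_iff v w).2 hw⟩

theorem IsWeakDeriv.hasSum {v w : RealL2} (h : IsWeakDeriv v w) :
    HasSum (fun k : ℤ => (2 * Real.pi) ^ 2 * (|(k : ℝ)| ^ (2 * (1 : ℝ)) * ‖coeff v k‖ ^ 2))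
      (‖w‖ ^ 2) := by
  refine (hasSum_sq_coeff w).congr_fun fun k => ?_
  rw [h.2 k, norm_mul, norm_two_pi_I_mul, mul_one, Real.rpow_two]
  ring

theorem summable_weight {r : ℝ} (hr : 1 < r) : Summable fun k : ℤ => (1 + |(k : ℝ)|) ^ (-r) := by
  have h1 : Summable fun k : ℤ => |(k : ℝ)| ^ (-r) := Real.summable_abs_int_rpow hr
  refine Summable.of_norm_bounded_eventually h1 ?_
  have : ({0}ᶜ : Set ℤ) ∈ cofinite := (Set.finite_singleton 0).compl_mem_cofinite
  filter_upwards [this] with k hk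
  have hk' : (0 : ℝ) < |(k : ℝ)| := abs_pos.2 (by exact_mod_cast hk)
  rw [Real.norm_of_nonneg (by positivity)]
  exact Real.rpow_le_rpow_of_nonpos hk' (by linarith) (by linarith)

/-- The sum `∑ₖ (1 + |k|)⁻ʳ`. -/
def weightSum (r : ℝ) : ℝ := ∑' k : ℤ, (1 + |(k : ℝ)|) ^ (-r)

theorem IsWeakDeriv.summable_coeff {v w : RealL2} (h : IsWeakDeriv v w) :
    Summable (fun k => ‖coeff v k‖) ∧
      ∑' k, ‖coeff v k‖ ≤ weightSum 2 + (2 * ‖v‖ ^ 2 + 2 * ‖w‖ ^ 2) := by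
  have hb := (summable_weight one_lt_two).hasSum.add
    (((hasSum_sq_coeff v).mul_left 2).add ((hasSum_sq_coeff w).mul_left 2))
  have hle : ∀ k : ℤ, ‖coeff v k‖ ≤ (1 + |(k : ℝ)|) ^ (-(2 : ℝ)) +
      (2 * ‖coeff v k‖ ^ 2 + 2 * ‖coeff w k‖ ^ 2) := fun k => by
    have h0 : (0 : ℝ) < 1 + |(k : ℝ)| := by positivity
    have h1 : ‖coeff w k‖ ^ 2 = (2 * Real.pi * |(k : ℝ)| * ‖coeff v k‖) ^ 2 := by
      rw [h.2 k, norm_mul, norm_two_pi_I_mul]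
    have h2 : (|(k : ℝ)| * ‖coeff v k‖) ^ 2 ≤ ‖coeff w k‖ ^ 2 := by
      rw [h1]
      refine pow_le_pow_left₀ (by positivity) ?_ 2
      have : 1 ≤ 2 * Real.pi := by linarith [Real.pi_gt_three]
      have h3 : 0 ≤ |(k : ℝ)| * ‖coeff v k‖ := by positivity
      nlinarith
    rw [Real.rpow_neg h0.le, Real.rpow_two]
    have h4 : 1 = ((1 + |(k : ℝ)|) ^ 2)⁻¹ * (1 + |(k : ℝ)|) ^ 2 := by field_simp
    set p := (1 + |(k : ℝ)|)⁻¹ with hp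
    have hp1 : p * (1 + |(k : ℝ)|) = 1 := inv_mul_cancel₀ h0.ne'
    rw [← inv_pow, ← hp]
    set c := ‖coeff v k‖
    have h5 : c ≤ p ^ 2 + ((1 + |(k : ℝ)|) * c) ^ 2 := by
      have : p * ((1 + |(k : ℝ)|) * c) = c := by rw [← mul_assoc, hp1, one_mul]
      nlinarith [sq_nonneg (p - (1 + |(k : ℝ)|) * c), sq_nonneg p,
        sq_nonneg ((1 + |(k : ℝ)|) * c)]
    nlinarith [sq_nonneg (c - |(k : ℝ)| * c)]
  have hs : Summable (fun k => ‖coeff v k‖) :=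
    Summable.of_nonneg_of_le (fun _ => norm_nonneg _) hle hb.summable
  exact ⟨hs, hasSum_le hle hs.hasSum hb⟩

theorem norm_coeff_mul_le (a b : RealL2) (k : ℤ) :
    ‖coeff (fun x => a x * b x) k‖ ≤ ‖a‖ * ‖b‖ := by
  have h1 : ‖coeff (fun x => a x * b x) k‖ ≤ ∫ x, |a x| * |b x| ∂haarAddCircle := by
    unfold coeff fourierCoeff
    refine (norm_integral_le_integral_norm _).trans_eq ?_
    congr 1
    ext x
    rw [norm_smul, fourier_apply, Circle.norm_coe, one_mul, Complex.norm_real, Real.norm_eq_abs,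
      abs_mul]
  have h2 : (∫ x, |a x| * |b x| ∂haarAddCircle) = inner ℝ |a| |b| := by
    rw [L2.inner_def]
    refine integral_congr_ae ?_
    filter_upwards [Lp.coeFn_abs a, Lp.coeFn_abs b] with x ha hb
    rw [ha, hb, real_inner_eq_re_inner, RCLike.inner_apply]
    simp [mul_comm]
  rw [h2] at h1
  refine h1.trans ((real_inner_le_norm _ _).trans_eq ?_)
  rw [norm_abs_eq_norm, norm_abs_eq_norm]

theorem tendsto_coeff_mul {ι : Type*} {l : Filter ι} {a b : ι → RealL2} {a₀ b₀ : RealL2}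
    (ha : Tendsto a l (𝓝 a₀)) (hb : Tendsto b l (𝓝 b₀)) (k : ℤ) :
    Tendsto (fun i => coeff (fun x => a i x * b i x) k) l
      (𝓝 (coeff (fun x => a₀ x * b₀ x) k)) := by
  have hsub : ∀ i, coeff (fun x => a i x * b i x) k - coeff (fun x => a₀ x * b₀ x) k
      = coeff (fun x => (a i - a₀ : RealL2) x * b i x) k
        + coeff (fun x => a₀ x * (b i - b₀ : RealL2) x) k := fun i => by
    refine ((hasSum_coeff_mul _ _ k).sub (hasSum_coeff_mul _ _ k)).unique ?_
    refine ((hasSum_coeff_mul (a i - a₀) (b i) k).add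
      (hasSum_coeff_mul a₀ (b i - b₀) k)).congr_fun fun l => ?_
    rw [coeff_sub, coeff_sub]
    ring
  rw [tendsto_iff_norm_sub_tendsto_zero]
  have ha' := tendsto_iff_norm_sub_tendsto_zero.1 ha
  have hb' := tendsto_iff_norm_sub_tendsto_zero.1 hb
  have hlim : Tendsto (fun i => ‖a i - a₀‖ * ‖b i‖ + ‖a₀‖ * ‖b i - b₀‖) l (𝓝 0) := by
    simpa using (ha'.mul hb.norm).add (hb'.const_mul ‖a₀‖)
  refine squeeze_zero (fun _ => norm_nonneg _) (fun i => ?_) hlim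
  rw [hsub]
  exact (norm_add_le _ _).trans (add_le_add (norm_coeff_mul_le _ _ k) (norm_coeff_mul_le _ _ k))

/-- A trigonometric polynomial. -/
def trigPoly (s : Finset ℤ) (c : ℤ → ℂ) : C(UnitAddCircle, ℂ) := ∑ k ∈ s, c k • fourier k

theorem trigPoly_apply (s : Finset ℤ) (c : ℤ → ℂ) (x : UnitAddCircle) :
    trigPoly s c x = ∑ k ∈ s, c k * fourier k x := by
  simp [trigPoly]

theorem hasDerivAt_trigPoly (s : Finset ℤ) (c : ℤ → ℂ) (x : ℝ) :
    HasDerivAt (fun y : ℝ => trigPoly s c (y : UnitAddCircle))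
      (trigPoly s (fun k => 2 * Real.pi * Complex.I * k * c k) (x : UnitAddCircle)) x := by
  simp only [trigPoly_apply]
  refine HasDerivAt.fun_sum fun k _ => ?_
  refine ((hasDerivAt_fourier 1 k x).const_mul (c k)).congr_deriv ?_
  push_cast
  ring

/-- The postcomposition of the real part with a real function. -/
def rePost (F : C(ℝ, ℝ)) : C(ℂ, ℝ) := F.comp ⟨Complex.re, Complex.continuous_re⟩

theorem coeff_comp_trigPoly {F F' : C(ℝ, ℝ)} (hF : ∀ y, HasDerivAt F (F' y) y) (s : Finset ℤ)
    (c : ℤ → ℂ) (k : ℤ) :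
    coeff (fun x => contL2 ((rePost F').comp (trigPoly s c)) x *
      realPart (ContinuousMap.toLp 2 haarAddCircle ℂ
        (trigPoly s fun l => 2 * Real.pi * Complex.I * l * c l)) x) k
      = 2 * Real.pi * Complex.I * k * coeff (contL2 ((rePost F).comp (trigPoly s c))) k := by
  set D := trigPoly s fun l => 2 * Real.pi * Complex.I * l * c l with hD
  have h1 : (fun x => contL2 ((rePost F').comp (trigPoly s c)) x *
      realPart (ContinuousMap.toLp 2 haarAddCircle ℂ D) x) =ᵐ[haarAddCircle]
      fun x => F' (trigPoly s c x).re * (D x).re := by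
    filter_upwards [coeFn_contL2 ((rePost F').comp (trigPoly s c)),
      coeFn_realPart (ContinuousMap.toLp 2 haarAddCircle ℂ D),
      ContinuousMap.coeFn_toLp (p := 2) (𝕜 := ℂ) haarAddCircle D] with x h1 h2 h3
    rw [h1, h2, h3]
    rfl
  rw [coeff_congr h1, coeff_contL2]
  refine fourierCoeff_of_hasDerivAt ?_ (fun x => ?_) k
  · have h2 : Continuous fun x => F' (trigPoly s c x).re :=
      F'.continuous.comp (Complex.continuous_re.comp (trigPoly s c).continuous)
    exact Complex.continuous_ofReal.comp (h2.mul (Complex.continuous_re.comp D.continuous))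
  · have h2 : HasDerivAt (fun y : ℝ => (trigPoly s c (y : UnitAddCircle)).re)
        (D (x : UnitAddCircle)).re x :=
      Complex.reCLM.hasFDerivAt.comp_hasDerivAt x (hasDerivAt_trigPoly s c x)
    exact ((hF _).comp x h2).ofReal_comp

theorem IsWeakDeriv.toComplex_hasSum {v w : RealL2} (h : IsWeakDeriv v w) :
    Tendsto (fun s : Finset ℤ => realPart (ContinuousMap.toLp 2 haarAddCircle ℂ
        (trigPoly s fun l => 2 * Real.pi * Complex.I * l * coeff v l))) atTop (𝓝 w) := by
  have h1 := (realPart.continuous.tendsto _).comp (hasSum_fourier_series_L2 (toComplex w))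
  rw [realPart_toComplex] at h1
  refine h1.congr fun s => ?_
  simp only [Function.comp_apply, fourierCoeff_toComplex, h.2, trigPoly, map_sum, map_smul]

/-- The chain rule for weak derivatives. -/
theorem IsWeakDeriv.comp {v w : RealL2} (h : IsWeakDeriv v w) {F F' : C(ℝ, ℝ)}
    (hF : ∀ y, HasDerivAt F (F' y) y) (k : ℤ) :
    coeff (fun x => contL2 (F'.comp (contRep v)) x * w x) k
      = 2 * Real.pi * Complex.I * k * coeff (contL2 (F.comp (contRep v))) k := by
  have hP : Tendsto (fun s => trigPoly s (coeff v)) atTop (𝓝 (fourierSum (coeff v))) :=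
    hasSum_fourierSum h.summable_coeff.1
  have hcont : ∀ G : C(ℝ, ℝ), Tendsto (fun s => contL2 ((rePost G).comp (trigPoly s (coeff v))))
      atTop (𝓝 (contL2 (G.comp (contRep v)))) := fun G => by
    have h1 : Continuous fun P : C(UnitAddCircle, ℂ) => contL2 ((rePost G).comp P) :=
      (ContinuousMap.toLp 2 haarAddCircle ℝ (α := UnitAddCircle) (E := ℝ)).continuous.comp
        (ContinuousMap.continuous_postcomp (rePost G))
    exact (h1.tendsto _).comp hP
  refine tendsto_nhds_unique (tendsto_coeff_mul (hcont F') h.toComplex_hasSum k) ?_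
  simp only [coeff_comp_trigPoly hF]
  exact (((continuous_coeff k).tendsto _).comp (hcont F)).const_mul _

theorem IsWeakDeriv.comp_ae {v w : RealL2} (h : IsWeakDeriv v w) (F : C(ℝ, ℝ)) :
    contL2 (F.comp (contRep v)) =ᵐ[haarAddCircle] fun x => F (v x) := by
  filter_upwards [coeFn_contL2 (F.comp (contRep v)),
    coe_ae_eq_contRep v h.summable_coeff.1] with x h1 h2
  rw [h1, h2]
  rfl

/-- The chain rule for weak derivatives, with a bound. -/
theorem IsWeakDeriv.exists_comp {v w : RealL2} (h : IsWeakDeriv v w) {F F' : C(ℝ, ℝ)}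
    (hF : ∀ y, HasDerivAt F (F' y) y) {L : ℝ} (hL : ∀ x, |F' (contRep v x)| ≤ L) :
    ∃ z : RealL2, IsWeakDeriv (fun x => F (v x)) z ∧ ‖z‖ ≤ L * ‖w‖ := by
  have hb : ∀ᵐ x ∂haarAddCircle, ‖contL2 (F'.comp (contRep v)) x * w x‖ ≤ L * ‖w x‖ := by
    filter_upwards [coeFn_contL2 (F'.comp (contRep v))] with x hx
    rw [hx, norm_mul]
    exact mul_le_mul_of_nonneg_right (hL x) (norm_nonneg _)
  have hm : MemLp (fun x => contL2 (F'.comp (contRep v)) x * w x) 2 haarAddCircle :=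
    (Lp.memLp w).of_le_mul ((Lp.aestronglyMeasurable _).mul (Lp.aestronglyMeasurable _)) hb
  refine ⟨hm.toLp _, ⟨?_, fun k => ?_⟩, ?_⟩
  · exact (integrable_coe_real _).congr (h.comp_ae F)
  · rw [coeff_congr hm.coeFn_toLp, h.comp hF, coeff_congr (h.comp_ae F)]
  · refine Lp.norm_le_mul_norm_of_ae_le_mul ?_
    filter_upwards [hb, hm.coeFn_toLp] with x h1 h2
    rw [h2]
    exact h1

/-! ### Pointwise decay of Fourier coefficients -/

/-- The coefficients `c k` are bounded by `C (1 + |k|)⁻ˢ`. -/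
def Decay (s C : ℝ) (c : ℤ → ℂ) : Prop := ∀ k : ℤ, (1 + |(k : ℝ)|) ^ s * ‖c k‖ ≤ C

theorem Decay.norm_le {s C : ℝ} {c : ℤ → ℂ} (h : Decay s C c) (k : ℤ) :
    ‖c k‖ ≤ C * (1 + |(k : ℝ)|) ^ (-s) := by
  have h0 : (0 : ℝ) < 1 + |(k : ℝ)| := by positivity
  rw [Real.rpow_neg h0.le, ← div_eq_mul_inv, le_div_iff₀ (by positivity), mul_comm]
  exact h k

theorem Decay.nonneg {s C : ℝ} {c : ℤ → ℂ} (h : Decay s C c) : 0 ≤ C :=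
  le_trans (by positivity) (h 0)

theorem Decay.mono {s s' C C' : ℝ} {c : ℤ → ℂ} (h : Decay s C c) (hs : s' ≤ s) (hC : C ≤ C') :
    Decay s' C' c := fun k => by
  refine le_trans ?_ ((h k).trans hC)
  gcongr
  linarith [abs_nonneg (k : ℝ)]

theorem Decay.summable {s C : ℝ} {c : ℤ → ℂ} (h : Decay s C c) (hs : 1 < s) :
    Summable fun k => ‖c k‖ :=
  Summable.of_nonneg_of_le (fun _ => norm_nonneg _) h.norm_le ((summable_weight hs).mul_left C)

theorem rpow_neg_mul_rpow_neg_le {X Y p q : ℝ} (hX : 1 ≤ X) (hY : 1 ≤ Y) (hp : 0 ≤ p)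
    (hq : 0 ≤ q) : X ^ (-p) * Y ^ (-q) ≤ X ^ (-(p + q)) + Y ^ (-(p + q)) := by
  have hX0 : 0 < X := by linarith
  have hY0 : 0 < Y := by linarith
  rcases le_total X Y with h | h
  · have h1 : Y ^ (-q) ≤ X ^ (-q) := Real.rpow_le_rpow_of_nonpos hX0 h (by linarith)
    have h2 : X ^ (-(p + q)) = X ^ (-p) * X ^ (-q) := by rw [← Real.rpow_add hX0]; ring_nf
    have h3 : X ^ (-p) * Y ^ (-q) ≤ X ^ (-p) * X ^ (-q) := by gcongr
    have : 0 ≤ Y ^ (-(p + q)) := by positivity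
    linarith
  · have h1 : X ^ (-p) ≤ Y ^ (-p) := Real.rpow_le_rpow_of_nonpos hY0 h (by linarith)
    have h2 : Y ^ (-(p + q)) = Y ^ (-p) * Y ^ (-q) := by rw [← Real.rpow_add hY0]; ring_nf
    have h3 : X ^ (-p) * Y ^ (-q) ≤ Y ^ (-p) * Y ^ (-q) := by gcongr
    have : 0 ≤ X ^ (-(p + q)) := by positivity
    linarith

theorem add_rpow_le_two_rpow_mul {X Y r : ℝ} (hX : 0 ≤ X) (hY : 0 ≤ Y) (hr : 0 ≤ r) :
    (X + Y) ^ r ≤ 2 ^ r * (X ^ r + Y ^ r) := by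
  rcases le_total X Y with h | h
  · have h1 : (X + Y) ^ r ≤ (2 * Y) ^ r := by
      gcongr
      linarith
    rw [Real.mul_rpow (by norm_num) hY] at h1
    have : (0 : ℝ) ≤ 2 ^ r * X ^ r := by positivity
    linarith
  · have h1 : (X + Y) ^ r ≤ (2 * X) ^ r := by
      gcongr
      linarith
    rw [Real.mul_rpow (by norm_num) hX] at h1
    have : (0 : ℝ) ≤ 2 ^ r * Y ^ r := by positivity
    linarith

/-- Decay of a convolution. -/
theorem Decay.conv {a b r A B : ℝ} {x y z : ℤ → ℂ} (hx : Decay a A x) (hy : Decay b B y)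
    (hz : ∀ k, HasSum (fun l => x (k - l) * y l) (z k)) (hr : 0 ≤ r) (hra : r ≤ a) (hrb : r ≤ b)
    (hab : 1 < a + b - r) :
    Decay r (2 ^ r * 4 * weightSum (a + b - r) * (A * B)) z := fun k => by
  have hA := hx.nonneg
  have hB := hy.nonneg
  set t := a + b - r with ht
  have hS := (summable_weight hab).hasSum
  have hS' : HasSum (fun l : ℤ => (1 + |((k - l : ℤ) : ℝ)|) ^ (-t)) (weightSum t) :=
    (Equiv.subLeft k).hasSum_iff.2 hS
  have hsum := ((hS'.add hS).mul_left (2 ^ r * 2 * (A * B)))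
  have hle : ∀ l, (1 + |(k : ℝ)|) ^ r * ‖x (k - l) * y l‖ ≤ 2 ^ r * 2 * (A * B) *
      ((1 + |((k - l : ℤ) : ℝ)|) ^ (-t) + (1 + |(l : ℝ)|) ^ (-t)) := fun l => by
    set X := 1 + |((k - l : ℤ) : ℝ)| with hX
    set Y := 1 + |(l : ℝ)| with hY
    have hX1 : 1 ≤ X := by simp [hX]
    have hY1 : 1 ≤ Y := by simp [hY]
    have hX0 : 0 < X := by linarith
    have hY0 : 0 < Y := by linarith
    have h1 : (1 + |(k : ℝ)|) ^ r ≤ 2 ^ r * (X ^ r + Y ^ r) := by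
      refine le_trans (Real.rpow_le_rpow (by positivity) ?_ hr)
        (add_rpow_le_two_rpow_mul hX0.le hY0.le hr)
      have : |(k : ℝ)| ≤ |((k - l : ℤ) : ℝ)| + |(l : ℝ)| := by
        have := abs_add_le ((k - l : ℤ) : ℝ) (l : ℝ)
        push_cast at this ⊢
        simpa using this
      linarith
    have h2 : ‖x (k - l) * y l‖ ≤ (A * X ^ (-a)) * (B * Y ^ (-b)) := by
      rw [norm_mul]
      exact mul_le_mul (hx.norm_le _) (hy.norm_le _) (norm_nonneg _) (by positivity)
    have h3 : X ^ r * X ^ (-a) = X ^ (-(a - r)) := by rw [← Real.rpow_add hX0]; ring_nf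
    have h4 : Y ^ r * Y ^ (-b) = Y ^ (-(b - r)) := by rw [← Real.rpow_add hY0]; ring_nf
    have h5 := rpow_neg_mul_rpow_neg_le hX1 hY1 (p := a - r) (q := b) (by linarith) (by linarith)
    have h6 := rpow_neg_mul_rpow_neg_le hX1 hY1 (p := a) (q := b - r) (by linarith) (by linarith)
    rw [show a - r + b = t by rw [ht]; ring] at h5
    rw [show a + (b - r) = t by rw [ht]; ring] at h6
    calc (1 + |(k : ℝ)|) ^ r * ‖x (k - l) * y l‖
        ≤ (2 ^ r * (X ^ r + Y ^ r)) * ((A * X ^ (-a)) * (B * Y ^ (-b))) := by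
          gcongr
      _ = 2 ^ r * (A * B) * ((X ^ r * X ^ (-a)) * Y ^ (-b) + X ^ (-a) * (Y ^ r * Y ^ (-b))) := by
          ring
      _ ≤ 2 ^ r * (A * B) * ((X ^ (-t) + Y ^ (-t)) + (X ^ (-t) + Y ^ (-t))) := by
          rw [h3, h4]
          gcongr
      _ = _ := by ring
  have hsum2 : Summable fun l => ‖x (k - l) * y l‖ := by
    refine Summable.of_nonneg_of_le (fun _ => norm_nonneg _) (fun l => ?_) hsum.summable
    refine le_trans ?_ (hle l)
    refine le_mul_of_one_le_left (norm_nonneg _) (Real.one_le_rpow ?_ hr)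
    linarith [abs_nonneg (k : ℝ)]
  calc (1 + |(k : ℝ)|) ^ r * ‖z k‖
      ≤ (1 + |(k : ℝ)|) ^ r * ∑' l, ‖x (k - l) * y l‖ := by
        gcongr
        rw [← (hz k).tsum_eq]
        exact norm_tsum_le_tsum_norm hsum2
    _ ≤ 2 ^ r * 2 * (A * B) * (weightSum t + weightSum t) :=
        hasSum_le hle (hsum2.hasSum.mul_left _) hsum
    _ = _ := by ring

/-! ### Fourier multipliers -/

theorem norm_multiplier_le {A : RealL2 →L[ℝ] RealL2} {m : ℤ → ℂ} {C : ℝ}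
    (hA : ∀ v k, coeff (A v) k = m k * coeff v k) (hC : 0 ≤ C) (hm : ∀ k, ‖m k‖ ≤ C) :
    ‖A‖ ≤ C := by
  refine A.opNorm_le_bound hC fun v => norm_real_le_of_coeff_le hC fun k => ?_
  rw [hA, norm_mul]
  exact mul_le_mul_of_nonneg_right (hm k) (norm_nonneg _)

theorem exists_multiplier {m : ℤ → ℂ} (hs : ∀ k, m (-k) = starRingEnd ℂ (m k)) {C : ℝ}
    (hC : 0 ≤ C) (hm : ∀ k, ‖m k‖ ≤ C) :
    ∃ A : RealL2 →L[ℝ] RealL2, ∀ v k, coeff (A v) k = m k * coeff v k := by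
  have h1 : ∀ v : RealL2, ∃ w : RealL2, ∀ k, coeff w k = m k * coeff v k := fun v => by
    refine exists_realL2_of_coeff ?_ fun k => by rw [hs, coeff_neg_index, map_mul]
    refine Summable.of_nonneg_of_le (fun _ => by positivity) (fun k => ?_)
      ((hasSum_sq_coeff v).summable.mul_left (C ^ 2))
    rw [norm_mul, mul_pow]
    gcongr
    exact hm k
  choose A hA using h1
  let A' : RealL2 →ₗ[ℝ] RealL2 :=
    { toFun := A
      map_add' := fun v w => realL2_ext fun k => by
        rw [coeff_add, hA, hA, hA, coeff_add, mul_add]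
      map_smul' := fun c v => realL2_ext fun k => by
        rw [RingHom.id_apply, coeff_smul, hA, hA, coeff_smul]
        ring }
  refine ⟨A'.mkContinuous C fun v => norm_real_le_of_coeff_le hC fun k => ?_, hA⟩
  change ‖coeff (A v) k‖ ≤ _
  rw [hA, norm_mul]
  exact mul_le_mul_of_nonneg_right (hm k) (norm_nonneg _)

theorem mul_exp_neg_rpow_le {α y s : ℝ} (hα : 1 ≤ α) (hy : 0 ≤ y) (hs : 0 < s) :
    y * Real.exp (-(y ^ α * s)) ≤ s ^ (-(1 / α)) := by
  have hα0 : 0 < α := by linarith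
  set z := y * s ^ (1 / α) with hz
  have hz0 : 0 ≤ z := by positivity
  have h1 : z ^ α = y ^ α * s := by
    rw [hz, Real.mul_rpow hy (by positivity), ← Real.rpow_mul hs.le, one_div_mul_cancel hα0.ne',
      Real.rpow_one]
  have h2 : z ≤ Real.exp (z ^ α) := by
    have h3 := Real.add_one_le_exp (z ^ α)
    rcases le_total z 1 with h | h
    · have : 0 ≤ z ^ α := by positivity
      linarith
    · have := Real.rpow_le_rpow_of_exponent_le h hα
      rw [Real.rpow_one] at this
      linarith
  rw [← h1, Real.exp_neg, Real.rpow_neg hs.le, ← div_eq_mul_inv, div_le_iff₀ (Real.exp_pos _)]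
  rw [← div_eq_inv_mul, le_div_iff₀ (by positivity)]
  exact h2

theorem abs_exp_neg_sub_exp_neg_le {a b d : ℝ} (ha : d ≤ a) (hb : d ≤ b) :
    |Real.exp (-a) - Real.exp (-b)| ≤ Real.exp (-d) * |a - b| := by
  have key : ∀ a b : ℝ, d ≤ a → a ≤ b →
      |Real.exp (-a) - Real.exp (-b)| ≤ Real.exp (-d) * |a - b| := by
    intro a b ha hab
    have h1 : Real.exp (-b) = Real.exp (-a) * Real.exp (-(b - a)) := by
      rw [← Real.exp_add]
      ring_nf
    have h2 := Real.add_one_le_exp (-(b - a))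
    have h3 : Real.exp (-b) ≤ Real.exp (-a) := Real.exp_le_exp.2 (by linarith)
    have h4 : Real.exp (-a) ≤ Real.exp (-d) := Real.exp_le_exp.2 (by linarith)
    rw [abs_of_nonneg (by linarith), abs_of_nonpos (by linarith), h1]
    have h5 := Real.exp_pos (-a)
    have h6 : Real.exp (-a) * (b - a) ≤ Real.exp (-d) * (b - a) :=
      mul_le_mul_of_nonneg_right h4 (by linarith)
    nlinarith
  rcases le_total a b with h | h
  · exact key a b ha h
  · rw [abs_sub_comm, abs_sub_comm a b]
    exact key b a hb h

/-- The symbol of `∂ₓ S_L(t)`. -/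
def derivHeatSymbol (α t : ℝ) (k : ℤ) : ℂ :=
  2 * Real.pi * Complex.I * k * (Real.exp (-((2 * Real.pi * |(k : ℝ)|) ^ α * t)) : ℝ)

theorem norm_derivHeatSymbol (α t : ℝ) (k : ℤ) :
    ‖derivHeatSymbol α t k‖
      = 2 * Real.pi * |(k : ℝ)| * Real.exp (-((2 * Real.pi * |(k : ℝ)|) ^ α * t)) := by
  rw [derivHeatSymbol, norm_mul, norm_two_pi_I_mul, Complex.norm_real,
    Real.norm_of_nonneg (Real.exp_pos _).le]

theorem norm_derivHeatSymbol_le {α t : ℝ} (hα : 1 ≤ α) (ht : 0 < t) (k : ℤ) :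
    ‖derivHeatSymbol α t k‖ ≤ t ^ (-(1 / α)) := by
  rw [norm_derivHeatSymbol]
  exact mul_exp_neg_rpow_le hα (by positivity) ht

theorem derivHeatSymbol_neg (α t : ℝ) (k : ℤ) :
    derivHeatSymbol α t (-k) = starRingEnd ℂ (derivHeatSymbol α t k) := by
  rw [derivHeatSymbol, conj_two_pi_I_mul, derivHeatSymbol, map_mul _ (_ * _) ((Real.exp _ : ℝ) : ℂ),
    Complex.conj_ofReal]
  simp

theorem norm_derivHeatSymbol_sub_le {α δ r r' : ℝ} (hα : 1 ≤ α) (hδ : 0 < δ) (hr : 2 * δ ≤ r)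
    (hr' : 2 * δ ≤ r') (k : ℤ) :
    ‖derivHeatSymbol α r k - derivHeatSymbol α r' k‖ ≤ δ ^ (-(1 / α)) * δ⁻¹ * |r - r'| := by
  set y := 2 * Real.pi * |(k : ℝ)| with hy
  have hy0 : 0 ≤ y := by positivity
  have hl0 : 0 ≤ y ^ α := by positivity
  rw [derivHeatSymbol, derivHeatSymbol, ← mul_sub, norm_mul, norm_two_pi_I_mul,
    ← Complex.ofReal_sub, Complex.norm_real, Real.norm_eq_abs, ← hy]
  have h1 := abs_exp_neg_sub_exp_neg_le (a := y ^ α * r) (b := y ^ α * r') (d := y ^ α * (2 * δ))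
    (by gcongr) (by gcongr)
  have h2 : Real.exp (-(y ^ α * (2 * δ)))
      = Real.exp (-(y ^ α * δ)) * Real.exp (-(y ^ α * δ)) := by
    rw [← Real.exp_add]
    ring_nf
  have h3 : y ^ α * Real.exp (-(y ^ α * δ)) ≤ δ⁻¹ := by
    have := Real.add_one_le_exp (y ^ α * δ)
    rw [Real.exp_neg, ← div_eq_mul_inv, div_le_iff₀ (Real.exp_pos _), ← div_eq_inv_mul,
      le_div_iff₀ hδ]
    linarith
  have h4 := mul_exp_neg_rpow_le hα hy0 hδ
  rw [← mul_sub, abs_mul, abs_of_nonneg hl0, h2] at h1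
  calc y * |Real.exp (-(y ^ α * r)) - Real.exp (-(y ^ α * r'))|
      ≤ y * (Real.exp (-(y ^ α * δ)) * Real.exp (-(y ^ α * δ)) * (y ^ α * |r - r'|)) := by
        gcongr
    _ = (y * Real.exp (-(y ^ α * δ))) * (y ^ α * Real.exp (-(y ^ α * δ))) * |r - r'| := by ring
    _ ≤ _ := by gcongr

/-- The operators `∂ₓ S_L(ν r)`, `r > 0`. -/
theorem exists_derivHeat {α ν : ℝ} (hα : 1 ≤ α) (hν : 0 < ν) :
    ∃ K : ℝ → RealL2 →L[ℝ] RealL2,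
      (∀ r, 0 < r → ∀ v k, coeff (K r v) k = derivHeatSymbol α (ν * r) k * coeff v k) ∧
      ContinuousOn K (Ioi 0) ∧
      ∀ r, 0 < r → ‖K r‖ ≤ ν ^ (-(1 / α)) * r ^ (-(1 / α)) := by
  have h1 : ∀ r, ∃ A : RealL2 →L[ℝ] RealL2, 0 < r →
      ∀ v k, coeff (A v) k = derivHeatSymbol α (ν * r) k * coeff v k := fun r => by
    by_cases hr : 0 < r
    · obtain ⟨A, hA⟩ := exists_multiplier (m := derivHeatSymbol α (ν * r))
        (derivHeatSymbol_neg α (ν * r)) (C := (ν * r) ^ (-(1 / α))) (by positivity)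
        (norm_derivHeatSymbol_le hα (by positivity))
      exact ⟨A, fun _ => hA⟩
    · exact ⟨0, fun h => absurd h hr⟩
  choose K hK using h1
  refine ⟨K, hK, ?_, fun r hr => ?_⟩
  · intro r₀ hr₀
    have hr₀' : 0 < r₀ := hr₀
    refine ContinuousAt.continuousWithinAt ?_
    set δ := ν * r₀ / 4 with hδ
    have hδ0 : 0 < δ := by positivity
    set C := δ ^ (-(1 / α)) * δ⁻¹ with hC
    have hC0 : 0 ≤ C := by positivity
    have hb : ∀ᶠ r in 𝓝 r₀, ‖K r - K r₀‖ ≤ C * |ν * r - ν * r₀| := by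
      filter_upwards [Ioi_mem_nhds (show r₀ / 2 < r₀ by linarith)] with r hr
      have hr' : r₀ / 2 < r := hr
      refine norm_multiplier_le (m := fun k => derivHeatSymbol α (ν * r) k
        - derivHeatSymbol α (ν * r₀) k) (fun v k => ?_) (by positivity) fun k => ?_
      · rw [sub_apply, coeff_sub, hK r (by linarith), hK r₀ hr₀', sub_mul]
      · refine norm_derivHeatSymbol_sub_le hα hδ0 ?_ ?_ k
        · rw [hδ]
          nlinarith
        · rw [hδ]
          nlinarith
    rw [ContinuousAt, tendsto_iff_norm_sub_tendsto_zero]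
    refine squeeze_zero' (Eventually.of_forall fun _ => norm_nonneg _) hb ?_
    have : Continuous fun r => C * |ν * r - ν * r₀| := by fun_prop
    simpa using this.tendsto r₀
  · rw [← Real.mul_rpow hν.le hr.le]
    exact norm_multiplier_le (hK r hr) (by positivity)
      (norm_derivHeatSymbol_le hα (by positivity))

theorem exists_heatFlow (α : ℝ) {ν : ℝ} (hν : 0 ≤ ν) (u : RealL2) :
    ∃ S : ℝ → RealL2, Continuous S ∧ (∀ t, ‖S t‖ ≤ ‖u‖) ∧
      ∀ t k, coeff (S t) k
        = (Real.exp (-((2 * Real.pi * |(k : ℝ)|) ^ α * (ν * max t 0))) : ℝ) * coeff u k := by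
  have hexp : ∀ (t : ℝ) (k : ℤ),
      Real.exp (-((2 * Real.pi * |(k : ℝ)|) ^ α * (ν * max t 0))) ≤ 1 := fun t k => by
    rw [Real.exp_le_one_iff, neg_nonpos]
    have : 0 ≤ max t 0 := le_max_right _ _
    positivity
  have h1 : ∀ t, ∃ w : RealL2, ∀ k, coeff w k
      = (Real.exp (-((2 * Real.pi * |(k : ℝ)|) ^ α * (ν * max t 0))) : ℝ) * coeff u k :=
    fun t => by
    obtain ⟨A, hA⟩ := exists_multiplier (m := fun k : ℤ =>
      ((Real.exp (-((2 * Real.pi * |(k : ℝ)|) ^ α * (ν * max t 0))) : ℝ) : ℂ))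
      (fun k => by rw [Complex.conj_ofReal]; simp) (C := 1) zero_le_one fun k => by
        rw [Complex.norm_real, Real.norm_of_nonneg (Real.exp_pos _).le]
        exact hexp t k
    exact ⟨A u, hA u⟩
  choose S hS using h1
  refine ⟨S, ?_, fun t => ?_, hS⟩
  · rw [continuous_iff_continuousAt]
    intro t₀
    rw [ContinuousAt, tendsto_iff_norm_sub_tendsto_zero]
    have hsq : Tendsto (fun t => ‖S t - S t₀‖ ^ 2) (𝓝 t₀) (𝓝 0) := by
      have h2 : ∀ t, ‖S t - S t₀‖ ^ 2 = ∑' k, ‖coeff (S t) k - coeff (S t₀) k‖ ^ 2 := fun t => by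
        rw [← (hasSum_sq_coeff _).tsum_eq]
        simp only [coeff_sub]
      simp only [h2]
      have h3 : (0 : ℝ) = ∑' _ : ℤ, 0 := tsum_zero.symm
      rw [h3]
      refine tendsto_tsum_of_dominated_convergence
        (bound := fun k => 4 * ‖coeff u k‖ ^ 2) ((hasSum_sq_coeff u).summable.mul_left 4)
        (fun k => ?_) (Eventually.of_forall fun t k => ?_)
      · have hc : Continuous fun t => coeff (S t) k := by
          simp only [hS]
          fun_prop
        have hc2 : Continuous fun t => ‖coeff (S t) k - coeff (S t₀) k‖ ^ 2 := by fun_prop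
        simpa using hc2.tendsto t₀
      · have h4 : ∀ t, ‖coeff (S t) k‖ ≤ ‖coeff u k‖ := fun t => by
          rw [hS, norm_mul, Complex.norm_real, Real.norm_of_nonneg (Real.exp_pos _).le]
          exact mul_le_of_le_one_left (norm_nonneg _) (hexp t k)
        rw [Real.norm_of_nonneg (by positivity)]
        have h5 : ‖coeff (S t) k - coeff (S t₀) k‖ ≤ 2 * ‖coeff u k‖ := by
          have := norm_sub_le (coeff (S t) k) (coeff (S t₀) k)
          linarith [h4 t, h4 t₀]
        calc _ ≤ (2 * ‖coeff u k‖) ^ 2 := by gcongr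
          _ = _ := by ring
    have := hsq.sqrt
    simpa [Real.sqrt_sq (norm_nonneg _)] using this
  · rw [← one_mul ‖u‖]
    refine norm_real_le_of_coeff_le zero_le_one fun k => ?_
    rw [hS, norm_mul, Complex.norm_real, Real.norm_of_nonneg (Real.exp_pos _).le]
    exact mul_le_mul_of_nonneg_right (hexp t k) (norm_nonneg _)

theorem fourierCoeff_heat (α : ℝ) {t : ℝ} (ht : 0 ≤ t) (z : ComplexL2) (k : ℤ) :
    fourierCoeff (heat α t z) k
      = (Real.exp (-((2 * Real.pi * |(k : ℝ)|) ^ α * t)) : ℝ) * fourierCoeff z k := by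
  have hs : Summable fun k : ℤ =>
      ‖((Real.exp (-((2 * Real.pi * |(k : ℝ)|) ^ α * t)) : ℝ) : ℂ) * fourierCoeff z k‖ ^ 2 := by
    refine Summable.of_nonneg_of_le (fun _ => by positivity) (fun k => ?_)
      (hasSum_sq_fourierCoeff_norm z).summable
    gcongr
    rw [norm_mul, Complex.norm_real, Real.norm_of_nonneg (Real.exp_pos _).le]
    refine mul_le_of_le_one_left (norm_nonneg _) ?_
    rw [Real.exp_le_one_iff, neg_nonpos]
    positivity
  obtain ⟨w, hw⟩ := exists_complexL2_of_coeff hs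
  have h1 := (hasSum_fourier_series_L2 w).tsum_eq
  simp only [hw] at h1
  have h2 : heat α t z = w := h1
  rw [h2, hw]

/-! ### Truncated derivatives -/

theorem exists_truncDeriv : ∃ D : ℕ → RealL2 →L[ℝ] RealL2, ∀ n v k,
    coeff (D n v) k = (if |k| ≤ n then 2 * Real.pi * Complex.I * k else 0) * coeff v k := by
  have h1 : ∀ n : ℕ, ∃ A : RealL2 →L[ℝ] RealL2, ∀ v k,
      coeff (A v) k = (if |k| ≤ n then 2 * Real.pi * Complex.I * k else 0) * coeff v k :=
    fun n => by
    refine exists_multiplier (fun k => ?_) (C := 2 * Real.pi * n) (by positivity) fun k => ?_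
    · rw [abs_neg, conj_two_pi_I_mul]
      split_ifs <;> simp
    · split_ifs with h
      · rw [norm_two_pi_I_mul]
        gcongr
        exact_mod_cast h
      · simp only [norm_zero]
        positivity
  choose D hD using h1
  exact ⟨D, hD⟩

theorem IsWeakDeriv.norm_truncDeriv_le {D : ℕ → RealL2 →L[ℝ] RealL2} (hD : ∀ n v k,
    coeff (D n v) k = (if |k| ≤ n then 2 * Real.pi * Complex.I * k else 0) * coeff v k)
    {v w : RealL2} (h : IsWeakDeriv v w) (n : ℕ) : ‖D n v‖ ≤ ‖w‖ := by
  rw [← one_mul ‖w‖]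
  refine norm_real_le_of_coeff_le zero_le_one fun k => ?_
  rw [hD, one_mul]
  split_ifs
  · rw [h.2]
  · simp

theorem exists_isWeakDeriv_of_truncDeriv {D : ℕ → RealL2 →L[ℝ] RealL2} (hD : ∀ n v k,
    coeff (D n v) k = (if |k| ≤ n then 2 * Real.pi * Complex.I * k else 0) * coeff v k)
    {v : RealL2} {R : ℝ} (h : ∀ n, ‖D n v‖ ≤ R) :
    ∃ w : RealL2, IsWeakDeriv v w ∧ ‖w‖ ≤ R := by
  have hR : 0 ≤ R := (norm_nonneg _).trans (h 0)
  have hfin : ∀ s : Finset ℤ, ∑ k ∈ s, ‖2 * Real.pi * Complex.I * k * coeff v k‖ ^ 2 ≤ R ^ 2 := by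
    intro s
    have h1 : ∃ n : ℕ, ∀ k ∈ s, |k| ≤ n := by
      refine ⟨s.sup fun k => k.natAbs, fun k hk => ?_⟩
      have := Finset.le_sup (f := fun k : ℤ => k.natAbs) hk
      rw [Int.abs_eq_natAbs]
      exact_mod_cast this
    obtain ⟨n, hn⟩ := h1
    calc _ = ∑ k ∈ s, ‖coeff (D n v) k‖ ^ 2 := by
          refine Finset.sum_congr rfl fun k hk => ?_
          rw [hD, if_pos (hn k hk)]
      _ ≤ ‖D n v‖ ^ 2 := sum_le_hasSum s (fun _ _ => sq_nonneg _) (hasSum_sq_coeff _)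
      _ ≤ R ^ 2 := by
          gcongr
          exact h n
  have hs := summable_of_sum_le (fun _ => sq_nonneg _) hfin
  obtain ⟨w, hw⟩ := exists_realL2_of_coeff hs fun k => by
    rw [conj_two_pi_I_mul, coeff_neg_index, ← map_mul]
  refine ⟨w, (isWeakDeriv_iff v w).2 hw, ?_⟩
  refine le_of_sq_le_sq ?_ hR
  rw [← (hasSum_sq_coeff w).tsum_eq]
  simp only [hw]
  exact hs.tsum_le_of_sum_le hfin

/-! ### Volterra equations with a weakly singular kernel -/

theorem integrableOn_rpow_mul_exp {μ β : ℝ} (hμ : 0 < μ) (hβ : β < 1) :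
    IntegrableOn (fun r : ℝ => r ^ (-β) * Real.exp (-(μ * r))) (Ioi 0) ∧
      ∫ r in Ioi 0, r ^ (-β) * Real.exp (-(μ * r)) = (1 / μ) ^ (1 - β) * Real.Gamma (1 - β) := by
  have h := Real.integral_rpow_mul_exp_neg_mul_Ioi (a := 1 - β) (r := μ) (by linarith) hμ
  rw [show 1 - β - 1 = -β by ring] at h
  refine ⟨?_, h⟩
  by_contra hn
  rw [integral_undef hn] at h
  have : 0 < (1 / μ) ^ (1 - β) * Real.Gamma (1 - β) := by
    have := Real.Gamma_pos_of_pos (show 0 < 1 - β by linarith)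
    positivity
  linarith

theorem exists_weight {β : ℝ} (hβ : β < 1) (q : ℝ) :
    ∃ μ : ℝ, 0 < μ ∧ q * ∫ r in Ioi 0, r ^ (-β) * Real.exp (-(μ * r)) ≤ 1 / 2 := by
  have h1 : Tendsto (fun μ : ℝ => q * ((1 / μ) ^ (1 - β) * Real.Gamma (1 - β))) atTop
      (𝓝 0) := by
    have h2 : Tendsto (fun μ : ℝ => (1 / μ) ^ (1 - β)) atTop (𝓝 0) := by
      have h3 : Tendsto (fun μ : ℝ => 1 / μ) atTop (𝓝 0) := by
        simpa using tendsto_inv_atTop_zero (𝕜 := ℝ)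
      have h4 := h3.rpow_const (p := 1 - β) (Or.inr (by linarith))
      rwa [Real.zero_rpow (by linarith)] at h4
    simpa using (h2.mul_const (Real.Gamma (1 - β))).const_mul q
  obtain ⟨μ, hμ⟩ := ((h1.eventually (gt_mem_nhds (show (0 : ℝ) < 1 / 2 by norm_num))).and
    (eventually_gt_atTop 0)).exists
  refine ⟨μ, hμ.2, ?_⟩
  rw [(integrableOn_rpow_mul_exp hμ.2 hβ).2]
  exact hμ.1.le

section Convolution

variable {E : Type*} [NormedAddCommGroup E] [NormedSpace ℝ E]

/-- The convolution `∫₀ᵗ κ(r) h(t - r) dr`. -/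
def volterraConv (κ : ℝ → E →L[ℝ] E) (h : ℝ → E) (t : ℝ) : E :=
  ∫ r in Ioi (0 : ℝ), (Iio t).indicator (fun r => κ r (h (t - r))) r

variable {κ : ℝ → E →L[ℝ] E} {b : ℝ → ℝ} {h : ℝ → E}

theorem aestronglyMeasurable_volterra (hκ : ContinuousOn κ (Ioi 0)) (hh : Continuous h) (t : ℝ) :
    AEStronglyMeasurable ((Iio t).indicator (fun r => κ r (h (t - r))))
      (volume.restrict (Ioi 0)) := by
  have h1 : ContinuousOn (fun r => κ r (h (t - r))) (Ioi 0) :=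
    hκ.clm_apply (by fun_prop)
  exact (h1.aestronglyMeasurable measurableSet_Ioi).indicator measurableSet_Iio

theorem norm_indicator_volterra_le (hκb : ∀ r, 0 < r → ‖κ r‖ ≤ b r) {H t : ℝ}
    (hH : ∀ τ, 0 ≤ τ → ‖h τ‖ ≤ H) {r : ℝ} (hr : 0 < r) :
    ‖(Iio t).indicator (fun r => κ r (h (t - r))) r‖ ≤ b r * H := by
  have hH0 : 0 ≤ H := (norm_nonneg _).trans (hH 0 le_rfl)
  have hb0 : 0 ≤ b r := (norm_nonneg _).trans (hκb r hr)
  by_cases hrt : r < t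
  · rw [indicator_of_mem (show r ∈ Iio t from hrt)]
    refine ((κ r).le_opNorm _).trans ?_
    exact mul_le_mul (hκb r hr) (hH _ (by linarith)) (norm_nonneg _) hb0
  · rw [indicator_of_notMem (show r ∉ Iio t from hrt), norm_zero]
    positivity

theorem integrable_volterra (hκ : ContinuousOn κ (Ioi 0)) (hκb : ∀ r, 0 < r → ‖κ r‖ ≤ b r)
    (hb : IntegrableOn b (Ioi 0)) (hh : Continuous h) {H : ℝ}
    (hH : ∀ τ, 0 ≤ τ → ‖h τ‖ ≤ H) (t : ℝ) :
    IntegrableOn ((Iio t).indicator (fun r => κ r (h (t - r)))) (Ioi 0) := by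
  refine Integrable.mono' (hb.mul_const H) (aestronglyMeasurable_volterra hκ hh t) ?_
  filter_upwards [ae_restrict_mem measurableSet_Ioi] with r hr
  exact norm_indicator_volterra_le hκb hH hr

theorem norm_volterraConv_le (hκb : ∀ r, 0 < r → ‖κ r‖ ≤ b r)
    (hb : IntegrableOn b (Ioi 0)) {H : ℝ} (hH : ∀ τ, 0 ≤ τ → ‖h τ‖ ≤ H) (t : ℝ) :
    ‖volterraConv κ h t‖ ≤ (∫ r in Ioi 0, b r) * H := by
  rw [← integral_mul_const]
  refine norm_integral_le_of_norm_le (hb.mul_const H) ?_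
  filter_upwards [ae_restrict_mem measurableSet_Ioi] with r hr
  exact norm_indicator_volterra_le hκb hH hr

theorem continuous_volterraConv (hκ : ContinuousOn κ (Ioi 0)) (hκb : ∀ r, 0 < r → ‖κ r‖ ≤ b r)
    (hb : IntegrableOn b (Ioi 0)) (hh : Continuous h) {H : ℝ} (hH : ∀ τ, 0 ≤ τ → ‖h τ‖ ≤ H) :
    Continuous (volterraConv κ h) := by
  rw [continuous_iff_continuousAt]
  intro t₀
  refine continuousAt_of_dominated (bound := fun r => b r * H)
    (Eventually.of_forall fun t => aestronglyMeasurable_volterra hκ hh t)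
    (Eventually.of_forall fun t => ?_) (hb.mul_const H) ?_
  · filter_upwards [ae_restrict_mem measurableSet_Ioi] with r hr
    exact norm_indicator_volterra_le hκb hH hr
  · have hne : ∀ᵐ r ∂(volume.restrict (Ioi (0 : ℝ))), r ≠ t₀ :=
      ae_restrict_of_ae (by simp [ae_iff])
    filter_upwards [hne] with r hr
    rcases lt_or_gt_of_ne hr with h1 | h1
    · have h2 : (fun t => (Iio t).indicator (fun r => κ r (h (t - r))) r)
          =ᶠ[𝓝 t₀] fun t => κ r (h (t - r)) := by
        filter_upwards [Ioi_mem_nhds h1] with t ht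
        exact indicator_of_mem (show r ∈ Iio t from ht) _
      refine ContinuousAt.congr ?_ h2.symm
      have : Continuous fun t => κ r (h (t - r)) := by fun_prop
      exact this.continuousAt
    · have h2 : (fun t => (Iio t).indicator (fun r => κ r (h (t - r))) r)
          =ᶠ[𝓝 t₀] fun _ => 0 := by
        filter_upwards [Iio_mem_nhds h1] with t ht
        have hrt : r ∉ Iio t := notMem_Iio.2 (le_of_lt ht)
        exact indicator_of_notMem hrt _
      exact continuousAt_const.congr h2.symm

theorem volterraConv_sub (hκ : ContinuousOn κ (Ioi 0)) (hκb : ∀ r, 0 < r → ‖κ r‖ ≤ b r)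
    (hb : IntegrableOn b (Ioi 0)) (hh : Continuous h) {H : ℝ} (hH : ∀ τ, 0 ≤ τ → ‖h τ‖ ≤ H)
    {h' : ℝ → E} (hh' : Continuous h') {H' : ℝ} (hH' : ∀ τ, 0 ≤ τ → ‖h' τ‖ ≤ H') (t : ℝ) :
    volterraConv κ h t - volterraConv κ h' t = volterraConv κ (fun τ => h τ - h' τ) t := by
  unfold volterraConv
  rw [← integral_sub (integrable_volterra hκ hκb hb hh hH t)
    (integrable_volterra hκ hκb hb hh' hH' t)]
  refine integral_congr_ae (Eventually.of_forall fun r => ?_)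
  by_cases hr : r ∈ Iio t
  · simp only [indicator_of_mem hr, map_sub]
  · simp only [indicator_of_notMem hr, sub_self]

end Convolution

theorem exists_volterra {E : Type*} [NormedAddCommGroup E] [NormedSpace ℝ E] [CompleteSpace E]
    {K : ℝ → E →L[ℝ] E} (hK : ContinuousOn K (Ioi 0)) {C β : ℝ} (hβ : β < 1)
    (hKb : ∀ r, 0 < r → ‖K r‖ ≤ C * r ^ (-β)) {N : E → E} {L : ℝ} (hL : 0 ≤ L)
    (hN : ∀ x y, ‖N x - N y‖ ≤ L * ‖x - y‖) (hN0 : N 0 = 0) {a : ℝ → E} (ha : Continuous a)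
    {A : ℝ} (haA : ∀ t, ‖a t‖ ≤ A) {ι : Type*} (D : ι → E →L[ℝ] E)
    (hD : ∀ i r, 0 < r → ∀ x, D i (K r x) = K r (D i x))
    (hDN : ∀ x R, (∀ i, ‖D i x‖ ≤ R) → ∀ i, ‖D i (N x)‖ ≤ L * R) {A' : ℝ} (hA' : 0 ≤ A')
    (hDa : ∀ t i, ‖D i (a t)‖ ≤ A') :
    ∃ u : ℝ → E, Continuous u ∧
      (∀ t, 0 ≤ t → IntervalIntegrable (fun τ => K (t - τ) (N (u τ))) volume 0 t ∧
        u t = a t - ∫ τ in (0 : ℝ)..t, K (t - τ) (N (u τ))) ∧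
      ∃ μ R : ℝ, ∀ t, 0 ≤ t → ∀ i, ‖D i (u t)‖ ≤ R * Real.exp (μ * t) := by
  obtain ⟨μ, hμ, hq⟩ := exists_weight hβ (L * C)
  set κ : ℝ → E →L[ℝ] E := fun r => Real.exp (-(μ * r)) • K r with hκdef
  set b : ℝ → ℝ := fun r => C * (r ^ (-β) * Real.exp (-(μ * r))) with hbdef
  have hκ : ContinuousOn κ (Ioi 0) :=
    (by fun_prop : Continuous fun r : ℝ => Real.exp (-(μ * r))).continuousOn.smul hK
  have hκb : ∀ r, 0 < r → ‖κ r‖ ≤ b r := fun r hr => by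
    rw [hκdef, hbdef, norm_smul, Real.norm_of_nonneg (Real.exp_pos _).le]
    calc _ ≤ Real.exp (-(μ * r)) * (C * r ^ (-β)) := by
          gcongr
          exact hKb r hr
      _ = _ := by ring
  have hb : IntegrableOn b (Ioi 0) := (integrableOn_rpow_mul_exp hμ hβ).1.const_mul C
  have hb0 : 0 ≤ ∫ r in Ioi 0, b r :=
    setIntegral_nonneg measurableSet_Ioi fun r hr => (norm_nonneg _).trans (hκb r hr)
  have hbL : (∫ r in Ioi 0, b r) * L ≤ 1 / 2 := by
    rw [hbdef, integral_const_mul]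
    linarith
  have hNc : Continuous N := by
    refine (LipschitzWith.of_dist_le_mul (K := ⟨L, hL⟩) fun x y => ?_).continuous
    rw [dist_eq_norm, dist_eq_norm]
    exact hN x y
  set M : ℝ → E → E := fun τ x => Real.exp (-(μ * τ)) • N (Real.exp (μ * τ) • x) with hM
  have hMexp : ∀ τ, Real.exp (-(μ * τ)) * Real.exp (μ * τ) = 1 := fun τ => by
    rw [← Real.exp_add]
    simp
  have hMlip : ∀ τ x y, ‖M τ x - M τ y‖ ≤ L * ‖x - y‖ := fun τ x y => by
    rw [hM]
    simp only
    rw [← smul_sub, norm_smul, Real.norm_of_nonneg (Real.exp_pos _).le]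
    calc _ ≤ Real.exp (-(μ * τ)) * (L * ‖Real.exp (μ * τ) • x - Real.exp (μ * τ) • y‖) := by
          gcongr
          exact hN _ _
      _ = (Real.exp (-(μ * τ)) * Real.exp (μ * τ)) * (L * ‖x - y‖) := by
          rw [← smul_sub, norm_smul, Real.norm_of_nonneg (Real.exp_pos _).le]
          ring
      _ = _ := by rw [hMexp, one_mul]
  have hM0 : ∀ τ, M τ 0 = 0 := fun τ => by simp [hM, hN0]
  have hMb : ∀ τ x, ‖M τ x‖ ≤ L * ‖x‖ := fun τ x => by
    simpa [hM0] using hMlip τ x 0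
  have hMc : ∀ v : BoundedContinuousFunction ℝ E, Continuous fun τ => M τ (v τ) := fun v => by
    have := v.continuous
    simp only [hM]
    fun_prop
  have hMv : ∀ (v : BoundedContinuousFunction ℝ E) (τ : ℝ), 0 ≤ τ → ‖M τ (v τ)‖ ≤ L * ‖v‖ :=
    fun v τ _ => (hMb τ _).trans (mul_le_mul_of_nonneg_left (v.norm_coe_le_norm τ) hL)
  have hexp1 : ∀ t : ℝ, Real.exp (-(μ * max t 0)) ≤ 1 := fun t => by
    rw [Real.exp_le_one_iff, neg_nonpos]
    have : 0 ≤ max t 0 := le_max_right _ _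
    positivity
  set Φ : BoundedContinuousFunction ℝ E → BoundedContinuousFunction ℝ E := fun v =>
    BoundedContinuousFunction.ofNormedAddCommGroup
      (fun t => Real.exp (-(μ * max t 0)) • a t - volterraConv κ (fun τ => M τ (v τ)) t)
      (Continuous.sub (by fun_prop) (continuous_volterraConv hκ hκb hb (hMc v) (hMv v)))
      (A + (∫ r in Ioi 0, b r) * (L * ‖v‖)) (fun t => by
        refine (norm_sub_le _ _).trans (add_le_add ?_ (norm_volterraConv_le hκb hb (hMv v) t))
        rw [norm_smul, Real.norm_of_nonneg (Real.exp_pos _).le]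
        exact (mul_le_of_le_one_left (norm_nonneg _) (hexp1 t)).trans (haA t)) with hΦ
  have hΦapp : ∀ v t, Φ v t
      = Real.exp (-(μ * max t 0)) • a t - volterraConv κ (fun τ => M τ (v τ)) t :=
    fun v t => rfl
  have hcontr : ContractingWith (1 / 2) Φ := by
    refine ⟨by norm_num, LipschitzWith.of_dist_le_mul fun v w => ?_⟩
    rw [dist_eq_norm, dist_eq_norm]
    refine (BoundedContinuousFunction.norm_le (by positivity)).2 fun t => ?_
    rw [BoundedContinuousFunction.sub_apply, hΦapp, hΦapp, sub_sub_sub_cancel_left,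
      volterraConv_sub hκ hκb hb (hMc w) (hMv w) (hMc v) (hMv v)]
    refine (norm_volterraConv_le (H := L * ‖v - w‖) hκb hb (fun τ _ => ?_) t).trans ?_
    · refine (hMlip τ _ _).trans (mul_le_mul_of_nonneg_left ?_ hL)
      rw [norm_sub_rev]
      exact (v - w).norm_coe_le_norm τ
    · rw [← mul_assoc]
      refine (mul_le_mul_of_nonneg_right hbL (norm_nonneg _)).trans_eq ?_
      simp
  set v := ContractingWith.fixedPoint Φ hcontr with hv
  have hfix : Φ v = v := ContractingWith.fixedPoint_isFixedPt hcontr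
  have hinv : ∀ w : BoundedContinuousFunction ℝ E, (∀ t, 0 ≤ t → ∀ i, ‖D i (w t)‖ ≤ 2 * A') →
      ∀ t, 0 ≤ t → ∀ i, ‖D i (Φ w t)‖ ≤ 2 * A' := by
    intro w hw t ht i
    have h1 : D i (volterraConv κ (fun τ => M τ (w τ)) t)
        = volterraConv κ (fun τ => D i (M τ (w τ))) t := by
      unfold volterraConv
      rw [← ContinuousLinearMap.integral_comp_comm _
        (integrable_volterra hκ hκb hb (hMc w) (hMv w) t)]
      refine setIntegral_congr_fun measurableSet_Ioi fun r hr => ?_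
      by_cases hrt : r ∈ Iio t
      · simp only [indicator_of_mem hrt, hκdef, smul_apply, map_smul,
          hD i r hr]
      · simp only [indicator_of_notMem hrt, map_zero]
    rw [hΦapp, map_sub, map_smul, h1]
    have h2 : ‖volterraConv κ (fun τ => D i (M τ (w τ))) t‖
        ≤ (∫ r in Ioi 0, b r) * (L * (2 * A')) := by
      refine norm_volterraConv_le hκb hb (fun τ hτ => ?_) t
      rw [hM]
      simp only
      rw [map_smul, norm_smul, Real.norm_of_nonneg (Real.exp_pos _).le]
      have h3 := hDN (Real.exp (μ * τ) • w τ) (Real.exp (μ * τ) * (2 * A')) (fun i => by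
        rw [map_smul, norm_smul, Real.norm_of_nonneg (Real.exp_pos _).le]
        gcongr
        exact hw τ hτ i) i
      calc _ ≤ Real.exp (-(μ * τ)) * (L * (Real.exp (μ * τ) * (2 * A'))) := by gcongr
        _ = (Real.exp (-(μ * τ)) * Real.exp (μ * τ)) * (L * (2 * A')) := by ring
        _ = _ := by rw [hMexp, one_mul]
    have h3 : ‖Real.exp (-(μ * max t 0)) • D i (a t)‖ ≤ A' := by
      rw [norm_smul, Real.norm_of_nonneg (Real.exp_pos _).le]
      exact (mul_le_of_le_one_left (norm_nonneg _) (hexp1 t)).trans (hDa t i)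
    have h4 := norm_sub_le (Real.exp (-(μ * max t 0)) • D i (a t))
      (volterraConv κ (fun τ => D i (M τ (w τ))) t)
    nlinarith
  have hiter : ∀ n : ℕ, ∀ t, 0 ≤ t → ∀ i, ‖D i (Φ^[n] 0 t)‖ ≤ 2 * A' := by
    intro n
    induction n with
    | zero =>
      intro t _ i
      simp only [Function.iterate_zero, id_eq, BoundedContinuousFunction.coe_zero, Pi.zero_apply,
        map_zero, norm_zero]
      positivity
    | succ n ih =>
      rw [Function.iterate_succ_apply']
      exact hinv _ ih
  have hvD : ∀ t, 0 ≤ t → ∀ i, ‖D i (v t)‖ ≤ 2 * A' := fun t ht i => by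
    have h1 : Tendsto (fun n => Φ^[n] 0) atTop (𝓝 v) :=
      ContractingWith.tendsto_iterate_fixedPoint hcontr 0
    have h2 : Tendsto (fun n => ‖D i (Φ^[n] 0 t)‖) atTop (𝓝 ‖D i (v t)‖) := by
      have hc : Continuous fun w : BoundedContinuousFunction ℝ E => ‖D i (w t)‖ :=
        ((D i).continuous.comp (continuous_eval_const t)).norm
      exact (hc.tendsto v).comp h1
    exact le_of_tendsto h2 (Eventually.of_forall fun n => hiter n t ht i)
  refine ⟨fun t => Real.exp (μ * t) • v t, ?_, fun t ht => ?_, μ, 2 * A', fun t ht i => ?_⟩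
  · have := v.continuous
    fun_prop
  · have hcomp : ∀ r, Real.exp (μ * t) • (κ r (M (t - r) (v (t - r))))
        = K r (N (Real.exp (μ * (t - r)) • v (t - r))) := fun r => by
      simp only [hκdef, hM, smul_apply, map_smul, smul_smul]
      rw [← Real.exp_add, ← Real.exp_add]
      ring_nf
      simp
    have hint := integrable_volterra hκ hκb hb (hMc v) (hMv v) t
    have hint2 : IntegrableOn (fun r => K r (N (Real.exp (μ * (t - r)) • v (t - r))))
        (Ioo 0 t) := by
      have h1 : IntegrableOn (fun r => κ r (M (t - r) (v (t - r)))) (Ioi 0 ∩ Iio t) := by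
        rw [IntegrableOn, integrable_indicator_iff measurableSet_Iio, IntegrableOn,
          Measure.restrict_restrict measurableSet_Iio, inter_comm] at hint
        exact hint
      have h2 := Integrable.smul (Real.exp (μ * t)) h1
      rw [Ioi_inter_Iio] at h2
      exact h2.congr (Eventually.of_forall hcomp)
    have hint3 : IntervalIntegrable (fun r => K r (N (Real.exp (μ * (t - r)) • v (t - r))))
        volume 0 t := by
      rw [intervalIntegrable_iff_integrableOn_Ioo_of_le ht]
      exact hint2
    have hint4 := (hint3.comp_sub_left t).symm
    simp only [sub_sub_cancel, sub_zero, sub_self] at hint4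
    refine ⟨hint4, ?_⟩
    have h1 : v t = Real.exp (-(μ * max t 0)) • a t
        - volterraConv κ (fun τ => M τ (v τ)) t := by
      rw [← hΦapp, hfix]
    have h2 : (∫ τ in (0 : ℝ)..t, K (t - τ) (N (Real.exp (μ * τ) • v τ)))
        = ∫ r in (0 : ℝ)..t, K r (N (Real.exp (μ * (t - r)) • v (t - r))) := by
      have := intervalIntegral.integral_comp_sub_left (a := 0) (b := t)
        (fun r => K r (N (Real.exp (μ * (t - r)) • v (t - r)))) t
      simpa only [sub_sub_cancel, sub_zero, sub_self] using this
    have h3 : Real.exp (μ * t) • volterraConv κ (fun τ => M τ (v τ)) t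
        = ∫ r in (0 : ℝ)..t, K r (N (Real.exp (μ * (t - r)) • v (t - r))) := by
      rw [volterraConv, setIntegral_indicator measurableSet_Iio, Ioi_inter_Iio,
        intervalIntegral.integral_of_le ht, ← integral_Ioc_eq_integral_Ioo, ← integral_smul]
      simp only [hcomp]
    simp only
    rw [h2, ← h3]
    conv_lhs => rw [h1]
    rw [smul_sub, smul_smul, max_eq_left ht, mul_comm, hMexp, one_smul]
  · rw [map_smul, norm_smul, Real.norm_of_nonneg (Real.exp_pos _).le, mul_comm]
    exact mul_le_mul_of_nonneg_right (hvD t ht i) (Real.exp_pos _).le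

theorem eq_zero_of_le_volterra {δ : ℝ → ℝ} {T C β : ℝ} (hβ : β < 1) (hC : 0 ≤ C)
    (hδ : ContinuousOn δ (Icc 0 T)) (hδ0 : ∀ t ∈ Icc 0 T, 0 ≤ δ t)
    (h : ∀ t ∈ Icc 0 T, δ t ≤ ∫ τ in (0 : ℝ)..t, C * (t - τ) ^ (-β) * δ τ) :
    ∀ t ∈ Icc 0 T, δ t = 0 := by
  intro t₁ ht₁
  obtain ⟨μ, hμ, hq⟩ := exists_weight hβ C
  have hg : ContinuousOn (fun t => Real.exp (-(μ * t)) * δ t) (Icc 0 T) :=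
    ContinuousOn.mul (Continuous.continuousOn (by fun_prop)) hδ
  obtain ⟨s, hs, hmax⟩ := isCompact_Icc.exists_isMaxOn ⟨t₁, ht₁⟩ hg
  set m := Real.exp (-(μ * s)) * δ s with hm
  have hm0 : 0 ≤ m := mul_nonneg (Real.exp_pos _).le (hδ0 s hs)
  have hle : ∀ t ∈ Icc 0 T, δ t ≤ Real.exp (μ * t) * m := fun t ht => by
    have h1 : Real.exp (-(μ * t)) * δ t ≤ m := hmax ht
    rw [Real.exp_neg, ← div_eq_inv_mul, div_le_iff₀ (Real.exp_pos _)] at h1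
    linarith
  have hI := integrableOn_rpow_mul_exp hμ hβ
  have hint : IntervalIntegrable (fun r : ℝ => r ^ (-β) * Real.exp (-(μ * r))) volume 0 s := by
    rw [intervalIntegrable_iff_integrableOn_Ioc_of_le hs.1]
    exact hI.1.mono_set Ioc_subset_Ioi_self
  have hint2 : IntervalIntegrable (fun τ : ℝ => C * ((s - τ) ^ (-β) * Real.exp (-(μ * (s - τ))))
      * (Real.exp (μ * s) * m)) volume 0 s := by
    have := (hint.comp_sub_left s).symm
    simp only [sub_zero, sub_self] at this
    exact (this.const_mul C).mul_const _
  have hbound : δ s ≤ ∫ τ in (0 : ℝ)..s, C * ((s - τ) ^ (-β) * Real.exp (-(μ * (s - τ))))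
      * (Real.exp (μ * s) * m) := by
    refine (h s hs).trans ?_
    rw [intervalIntegral.integral_of_le hs.1, intervalIntegral.integral_of_le hs.1]
    refine integral_mono_of_nonneg ?_ ?_ ?_
    · filter_upwards [ae_restrict_mem measurableSet_Ioc] with τ hτ
      have h1 : 0 ≤ s - τ := by linarith [hτ.2]
      have h2 := hδ0 τ ⟨hτ.1.le, hτ.2.trans hs.2⟩
      simp only [Pi.zero_apply]
      positivity
    · exact (intervalIntegrable_iff_integrableOn_Ioc_of_le hs.1).1 hint2
    · filter_upwards [ae_restrict_mem measurableSet_Ioc] with τ hτ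
      have h1 : 0 ≤ s - τ := by linarith [hτ.2]
      have h2 := hle τ ⟨hτ.1.le, hτ.2.trans hs.2⟩
      calc C * (s - τ) ^ (-β) * δ τ ≤ C * (s - τ) ^ (-β) * (Real.exp (μ * τ) * m) := by gcongr
        _ = _ := by
          have : Real.exp (μ * τ) = Real.exp (-(μ * (s - τ))) * Real.exp (μ * s) := by
            rw [← Real.exp_add]
            ring_nf
          rw [this]
          ring
  have hval : (∫ τ in (0 : ℝ)..s, C * ((s - τ) ^ (-β) * Real.exp (-(μ * (s - τ))))
      * (Real.exp (μ * s) * m)) ≤ 1 / 2 * (Real.exp (μ * s) * m) := by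
    rw [intervalIntegral.integral_mul_const, intervalIntegral.integral_const_mul]
    have h1 := intervalIntegral.integral_comp_sub_left (a := 0) (b := s)
      (fun r : ℝ => r ^ (-β) * Real.exp (-(μ * r))) s
    rw [sub_zero, sub_self] at h1
    rw [h1]
    have h2 : (∫ r in (0 : ℝ)..s, r ^ (-β) * Real.exp (-(μ * r)))
        ≤ ∫ r in Ioi 0, r ^ (-β) * Real.exp (-(μ * r)) := by
      rw [intervalIntegral.integral_of_le hs.1]
      refine setIntegral_mono_set hI.1 ?_ (Eventually.of_forall Ioc_subset_Ioi_self)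
      filter_upwards [ae_restrict_mem measurableSet_Ioi] with r hr
      have : (0 : ℝ) < r := hr
      simp only [Pi.zero_apply]
      positivity
    refine mul_le_mul_of_nonneg_right ?_ (by positivity)
    exact (mul_le_mul_of_nonneg_left h2 hC).trans hq
  have hfin : m ≤ 1 / 2 * m := by
    have h1 := hbound.trans hval
    have h2 : Real.exp (-(μ * s)) * Real.exp (μ * s) = 1 := by
      rw [← Real.exp_add]
      simp
    calc m ≤ Real.exp (-(μ * s)) * (1 / 2 * (Real.exp (μ * s) * m)) := by
          rw [hm] at h1 ⊢
          gcongr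
      _ = (Real.exp (-(μ * s)) * Real.exp (μ * s)) * (1 / 2 * m) := by ring
      _ = _ := by rw [h2, one_mul]
  have hmz : m = 0 := by linarith
  have h1 := hle t₁ ht₁
  rw [hmz, mul_zero] at h1
  exact le_antisymm h1 (hδ0 t₁ ht₁)

/-! ### Gain of regularity in the Duhamel formula -/

theorem one_add_abs_le_two_pi_mul {k : ℤ} (hk : k ≠ 0) :
    1 + |(k : ℝ)| ≤ 2 * Real.pi * |(k : ℝ)| := by
  have h1 : (1 : ℝ) ≤ |(k : ℝ)| := by exact_mod_cast Int.one_le_abs hk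
  nlinarith [Real.pi_gt_three]

theorem Decay.of_deriv {s C S : ℝ} {c : ℤ → ℂ}
    (h : Decay s C fun k => 2 * Real.pi * Complex.I * k * c k) (h0 : ‖c 0‖ ≤ S) :
    Decay (s + 1) (max C S) c := fun k => by
  by_cases hk : k = 0
  · subst hk
    simpa using h0.trans (le_max_right C S)
  · have hp : (0 : ℝ) < 1 + |(k : ℝ)| := by positivity
    have h1 := h k
    rw [norm_mul, norm_two_pi_I_mul] at h1
    refine le_trans ?_ (h1.trans (le_max_left C S))
    rw [Real.rpow_add hp, Real.rpow_one, mul_assoc]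
    gcongr
    exact one_add_abs_le_two_pi_mul hk

theorem integral_exp_neg_mul_le {c t : ℝ} (hc : 0 < c) :
    ∫ τ in (0 : ℝ)..t, Real.exp (-(c * (t - τ))) ≤ 1 / c := by
  have h1 : ∀ τ ∈ uIcc 0 t, HasDerivAt (fun τ => Real.exp (-(c * (t - τ))) / c)
      (Real.exp (-(c * (t - τ)))) τ := fun τ _ => by
    have h2 : HasDerivAt (fun τ => -(c * (t - τ))) c τ := by
      refine ((((hasDerivAt_id τ).const_sub t).const_mul c).neg).congr_deriv ?_
      simp
    have := h2.exp.div_const c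
    rwa [mul_div_assoc, div_self hc.ne', mul_one] at this
  rw [intervalIntegral.integral_eq_sub_of_hasDerivAt h1
    (Continuous.intervalIntegrable (by fun_prop) _ _)]
  have : 0 ≤ Real.exp (-(c * (t - 0))) / c := by positivity
  simp only [sub_self, mul_zero, neg_zero, Real.exp_zero] at this ⊢
  linarith

/-- The Duhamel formula for a Fourier coefficient. -/
def DuhamelAt (α ν : ℝ) (c₀ : ℤ → ℂ) (g : ℝ → ℤ → ℂ) (t : ℝ) (c : ℤ → ℂ) : Prop :=
  ∀ k : ℤ, c k = (Real.exp (-((2 * Real.pi * |(k : ℝ)|) ^ α * (ν * t))) : ℝ) * c₀ k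
    - ∫ τ in (0 : ℝ)..t, derivHeatSymbol α (ν * (t - τ)) k * g τ k

theorem DuhamelAt.decay {α ν : ℝ} (hν : 0 < ν) {c₀ c : ℤ → ℂ} {g : ℝ → ℤ → ℂ} {t : ℝ}
    (h : DuhamelAt α ν c₀ g t c) (ht : 0 ≤ t) {a γ C₀ C : ℝ} (hγ : 0 ≤ γ) (hγα : γ ≤ α - 1)
    (h₀ : Decay (a + γ) C₀ c₀) (hg : ∀ τ ∈ Icc 0 t, Decay a C (g τ)) :
    Decay (a + γ) (C₀ + C / ν) c := fun k => by
  have hC : 0 ≤ C := (hg 0 ⟨le_rfl, ht⟩).nonneg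
  have hp : (0 : ℝ) < 1 + |(k : ℝ)| := by positivity
  set y := 2 * Real.pi * |(k : ℝ)| with hy
  have hy0 : 0 ≤ y := by positivity
  have h1 : ‖((Real.exp (-(y ^ α * (ν * t))) : ℝ) : ℂ) * c₀ k‖ ≤ ‖c₀ k‖ := by
    rw [norm_mul, Complex.norm_real, Real.norm_of_nonneg (Real.exp_pos _).le]
    refine mul_le_of_le_one_left (norm_nonneg _) ?_
    rw [Real.exp_le_one_iff, neg_nonpos]
    positivity
  have h2 : (1 + |(k : ℝ)|) ^ (a + γ)
      * ‖∫ τ in (0 : ℝ)..t, derivHeatSymbol α (ν * (t - τ)) k * g τ k‖ ≤ C / ν := by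
    by_cases hk : k = 0
    · subst hk
      simp only [derivHeatSymbol, Int.cast_zero, mul_zero, zero_mul]
      simp only [intervalIntegral.integral_zero, norm_zero, mul_zero]
      positivity
    · have hyk : 1 + |(k : ℝ)| ≤ y := one_add_abs_le_two_pi_mul hk
      have hy1 : 1 ≤ y := by linarith [abs_nonneg (k : ℝ)]
      have hy0' : 0 < y := by linarith
      have hl : 0 < y ^ α * ν := by positivity
      have h3 : ‖∫ τ in (0 : ℝ)..t, derivHeatSymbol α (ν * (t - τ)) k * g τ k‖
          ≤ ∫ τ in (0 : ℝ)..t, (y * (C * (1 + |(k : ℝ)|) ^ (-a)))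
            * Real.exp (-(y ^ α * ν * (t - τ))) := by
        refine intervalIntegral.norm_integral_le_of_norm_le ht ?_
          (Continuous.intervalIntegrable (by fun_prop) _ _)
        refine Eventually.of_forall fun τ hτ => ?_
        rw [norm_mul, norm_derivHeatSymbol, ← hy, ← mul_assoc (y ^ α)]
        have h4 := (hg τ ⟨hτ.1.le, hτ.2⟩).norm_le k
        calc _ ≤ y * Real.exp (-(y ^ α * ν * (t - τ))) * (C * (1 + |(k : ℝ)|) ^ (-a)) := by
              gcongr
          _ = _ := by ring
      rw [intervalIntegral.integral_const_mul] at h3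
      have h4 := integral_exp_neg_mul_le (t := t) hl
      have h5 : y * (1 / (y ^ α * ν)) ≤ (1 + |(k : ℝ)|) ^ (-γ) / ν := by
        have h6 : y * (1 / (y ^ α * ν)) = y ^ (1 - α) / ν := by
          rw [Real.rpow_sub hy0', Real.rpow_one]
          field_simp
        rw [h6]
        gcongr
        calc y ^ (1 - α) ≤ y ^ (-γ) := Real.rpow_le_rpow_of_exponent_le hy1 (by linarith)
          _ ≤ _ := Real.rpow_le_rpow_of_nonpos hp hyk (by linarith)
      calc _ ≤ (1 + |(k : ℝ)|) ^ (a + γ) * ((y * (C * (1 + |(k : ℝ)|) ^ (-a)))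
            * (1 / (y ^ α * ν))) := by
            gcongr
            exact h3.trans (mul_le_mul_of_nonneg_left h4 (by positivity))
        _ = (1 + |(k : ℝ)|) ^ (a + γ) * (1 + |(k : ℝ)|) ^ (-a) * C
            * (y * (1 / (y ^ α * ν))) := by ring
        _ ≤ (1 + |(k : ℝ)|) ^ (a + γ) * (1 + |(k : ℝ)|) ^ (-a) * C
            * ((1 + |(k : ℝ)|) ^ (-γ) / ν) := by gcongr
        _ = ((1 + |(k : ℝ)|) ^ (a + γ) * (1 + |(k : ℝ)|) ^ (-a) * (1 + |(k : ℝ)|) ^ (-γ))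
            * (C / ν) := by ring
        _ = C / ν := by
            rw [← Real.rpow_add hp, ← Real.rpow_add hp]
            ring_nf
            simp
  rw [h k]
  calc _ ≤ (1 + |(k : ℝ)|) ^ (a + γ) * (‖c₀ k‖
        + ‖∫ τ in (0 : ℝ)..t, derivHeatSymbol α (ν * (t - τ)) k * g τ k‖) := by
        gcongr
        exact (norm_sub_le _ _).trans (add_le_add h1 le_rfl)
    _ ≤ _ := by
        rw [mul_add]
        exact add_le_add (h₀ k) h2

/-! ### Regularity of compositions -/

theorem IsWeakDeriv.decay_comp {v w : RealL2} (h : IsWeakDeriv v w) {F F' : C(ℝ, ℝ)}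
    (hF : ∀ y, HasDerivAt F (F' y) y) {a γ A B S : ℝ} (ha : 1 ≤ a) (hγ : 0 < γ) (hγ1 : γ ≤ 1)
    (hA : Decay a A (coeff fun x => F' (v x))) (hB : Decay (a + γ) B (coeff v))
    (hS : ‖coeff (fun x => F (v x)) 0‖ ≤ S) :
    Decay (a + γ / 2) (max (2 ^ (a - 1 + γ / 2) * 4 * weightSum (a + γ / 2)
      * (A * (2 * Real.pi * B))) S) (coeff fun x => F (v x)) := by
  have hw : Decay (a + γ - 1) (2 * Real.pi * B) (coeff w) := fun k => by
    have hp : (0 : ℝ) < 1 + |(k : ℝ)| := by positivity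
    have h1 := hB k
    rw [h.2 k, norm_mul, norm_two_pi_I_mul]
    calc (1 + |(k : ℝ)|) ^ (a + γ - 1) * (2 * Real.pi * |(k : ℝ)| * ‖coeff v k‖)
        ≤ (1 + |(k : ℝ)|) ^ (a + γ - 1) * (2 * Real.pi * (1 + |(k : ℝ)|) * ‖coeff v k‖) := by
          gcongr
          linarith
      _ = 2 * Real.pi * ((1 + |(k : ℝ)|) ^ (a + γ - 1) * (1 + |(k : ℝ)|) ^ (1 : ℝ)
            * ‖coeff v k‖) := by
          rw [Real.rpow_one]
          ring
      _ ≤ 2 * Real.pi * B := by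
          rw [← Real.rpow_add hp, sub_add_cancel]
          gcongr
  have hA' : Decay a A (coeff (contL2 (F'.comp (contRep v)))) := fun k => by
    rw [coeff_congr (h.comp_ae F')]
    exact hA k
  have h1 := Decay.conv hA' hw (z := fun k => 2 * Real.pi * Complex.I * k
    * coeff (fun x => F (v x)) k) (r := a - 1 + γ / 2) (fun k => by
      have := hasSum_coeff_mul (contL2 (F'.comp (contRep v))) w k
      rwa [h.comp hF, coeff_congr (h.comp_ae F)] at this)
    (by linarith) (by linarith) (by linarith) (by linarith)
  have h2 := Decay.of_deriv h1 hS
  rw [show a - 1 + γ / 2 + 1 = a + γ / 2 by ring,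
    show a + (a + γ - 1) - (a - 1 + γ / 2) = a + γ / 2 by ring] at h2
  exact h2

/-- `Y` is bounded in `H¹` on `[0, t₁]`. -/
def BddH1 (t₁ : ℝ) (Y : ℝ → RealL2) : Prop :=
  ∃ R : ℝ, ∀ τ ∈ Icc 0 t₁, ‖Y τ‖ ≤ R ∧ ∃ w : RealL2, IsWeakDeriv (Y τ) w ∧ ‖w‖ ≤ R

theorem exists_bound_on_ball (F : C(ℝ, ℝ)) (M : ℝ) : ∃ S : ℝ, ∀ y, |y| ≤ M → |F y| ≤ S := by
  obtain ⟨S, hS⟩ := (isCompact_Icc (a := -M) (b := M)).exists_bound_of_continuousOn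
    F.continuous.continuousOn
  exact ⟨S, fun y hy => hS y (abs_le.1 hy)⟩

theorem BddH1.exists_abs_contRep_le {t₁ : ℝ} {Y : ℝ → RealL2} (h : BddH1 t₁ Y) :
    ∃ M : ℝ, ∀ τ ∈ Icc 0 t₁, ∀ x, |contRep (Y τ) x| ≤ M := by
  obtain ⟨R, hR⟩ := h
  refine ⟨weightSum 2 + (2 * R ^ 2 + 2 * R ^ 2), fun τ hτ x => ?_⟩
  obtain ⟨h1, w, hw, h2⟩ := hR τ hτ
  refine (abs_contRep_le _ hw.summable_coeff.1 x).trans (hw.summable_coeff.2.trans ?_)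
  gcongr

theorem norm_coeff_comp_le {v w : RealL2} (h : IsWeakDeriv v w) {F : C(ℝ, ℝ)} {S : ℝ}
    (hS : ∀ x, |F (contRep v x)| ≤ S) (k : ℤ) : ‖coeff (fun x => F (v x)) k‖ ≤ S := by
  refine norm_fourierCoeff_le ?_ k
  filter_upwards [coe_ae_eq_contRep v h.summable_coeff.1] with x hx
  rw [Complex.norm_real, hx]
  exact hS x

/-- Smooth functions of `Y` have coefficients decaying at rate `a`, uniformly on `[0, t₁]`. -/
def UniformDecay (a t₁ : ℝ) (Y : ℝ → RealL2) : Prop :=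
  ∀ F : ℝ → ℝ, ContDiff ℝ ∞ F → ∃ C : ℝ, ∀ τ ∈ Icc 0 t₁, Decay a C (coeff fun x => F (Y τ x))

theorem exists_continuousMap_deriv {F : ℝ → ℝ} (hF : ContDiff ℝ ∞ F) :
    ∃ G G' : C(ℝ, ℝ), F = G ∧ (∀ y, HasDerivAt G (G' y) y) ∧ ContDiff ℝ ∞ G' := by
  have h1 := contDiff_infty_iff_deriv.1 hF
  exact ⟨⟨F, hF.continuous⟩, ⟨deriv F, h1.2.continuous⟩, rfl, fun y => (h1.1 y).hasDerivAt, h1.2⟩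

theorem BddH1.uniformDecay_one {t₁ : ℝ} {Y : ℝ → RealL2} (h : BddH1 t₁ Y) :
    UniformDecay 1 t₁ Y := by
  intro F hF
  obtain ⟨G, G', rfl, hG, -⟩ := exists_continuousMap_deriv hF
  obtain ⟨M, hM⟩ := h.exists_abs_contRep_le
  obtain ⟨S, hS⟩ := exists_bound_on_ball G M
  obtain ⟨L, hL⟩ := exists_bound_on_ball G' M
  obtain ⟨R, hR⟩ := h
  refine ⟨max (|L| * R) S, fun τ hτ => ?_⟩
  obtain ⟨-, w, hw, h2⟩ := hR τ hτ
  obtain ⟨z, hz, hzL⟩ := hw.exists_comp hG (L := |L|) fun x =>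
    (hL _ (hM τ hτ x)).trans (le_abs_self L)
  have h3 : Decay 0 (|L| * R) (coeff z) := fun k => by
    rw [Real.rpow_zero, one_mul]
    refine (norm_coeff_le z k).trans (hzL.trans ?_)
    gcongr
  have h4 : coeff z = fun k => 2 * Real.pi * Complex.I * k * coeff (fun x => G (Y τ x)) k :=
    funext hz.2
  rw [h4] at h3
  have := Decay.of_deriv h3 (norm_coeff_comp_le hw (F := G) (fun x => hS _ (hM τ hτ x)) 0)
  rwa [zero_add] at this

theorem UniformDecay.step {α ν : ℝ} (hν : 0 < ν) {t₁ a γ : ℝ} (ha : 1 ≤ a) (hγ : 0 < γ)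
    (hγ1 : γ ≤ 1) (hγα : γ ≤ α - 1) {f : ℝ → ℝ} (hf : ContDiff ℝ ∞ f) {Y : ℝ → RealL2}
    {c₀ : ℤ → ℂ} {C₀ : ℝ} (hc₀ : Decay (a + γ) C₀ c₀) (hb : BddH1 t₁ Y)
    (hY : ∀ t ∈ Icc 0 t₁, DuhamelAt α ν c₀ (fun τ => coeff fun x => f (Y τ x)) t (coeff (Y t)))
    (h : UniformDecay a t₁ Y) : UniformDecay (a + γ / 2) t₁ Y := by
  intro F hF
  obtain ⟨G, G', rfl, hG, hG'⟩ := exists_continuousMap_deriv hF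
  obtain ⟨M, hM⟩ := hb.exists_abs_contRep_le
  obtain ⟨S, hS⟩ := exists_bound_on_ball G M
  obtain ⟨Cf, hCf⟩ := h f hf
  obtain ⟨A, hA⟩ := h G' hG'
  obtain ⟨R, hR⟩ := hb
  refine ⟨max (2 ^ (a - 1 + γ / 2) * 4 * weightSum (a + γ / 2)
    * (A * (2 * Real.pi * (C₀ + Cf / ν)))) S, fun τ hτ => ?_⟩
  obtain ⟨-, w, hw, -⟩ := hR τ hτ
  have hB := (hY τ hτ).decay hν hτ.1 hγ.le hγα hc₀ fun s hs => hCf s ⟨hs.1, hs.2.trans hτ.2⟩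
  exact hw.decay_comp hG ha hγ hγ1 (hA τ hτ) hB
    (norm_coeff_comp_le hw (F := G) (fun x => hS _ (hM τ hτ x)) 0)

theorem UniformDecay.all {α ν : ℝ} (hα : 1 < α) (hν : 0 < ν) {t₁ : ℝ}
    {f : ℝ → ℝ} (hf : ContDiff ℝ ∞ f) {Y : ℝ → RealL2}
    {c₀ : ℤ → ℂ} (hc₀ : ∀ s, ∃ C₀, Decay s C₀ c₀) (hb : BddH1 t₁ Y)
    (hY : ∀ t ∈ Icc 0 t₁, DuhamelAt α ν c₀ (fun τ => coeff fun x => f (Y τ x)) t (coeff (Y t)))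
    (s : ℝ) : UniformDecay s t₁ Y := by
  set γ := min (α - 1) 1 with hγ
  have hγ0 : 0 < γ := lt_min (by linarith) one_pos
  have h1 : ∀ n : ℕ, UniformDecay (1 + n * (γ / 2)) t₁ Y := by
    intro n
    induction n with
    | zero => simpa using hb.uniformDecay_one
    | succ n ih =>
      obtain ⟨C₀, hC₀⟩ := hc₀ (1 + n * (γ / 2) + γ)
      have := ih.step hν (le_add_of_nonneg_right (by positivity)) hγ0 (min_le_right _ _)
        (min_le_left _ _) hf hC₀ hb hY
      convert this using 1
      push_cast
      ring
  obtain ⟨n, hn⟩ := exists_nat_ge ((s - 1) / (γ / 2))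
  rw [div_le_iff₀ (by positivity)] at hn
  intro F hF
  obtain ⟨C, hC⟩ := h1 n F hF
  exact ⟨C, fun τ hτ => (hC τ hτ).mono (by linarith) le_rfl⟩

theorem UniformDecay.self {s t₁ : ℝ} {Y : ℝ → RealL2} (h : UniformDecay s t₁ Y) :
    ∃ C : ℝ, ∀ τ ∈ Icc 0 t₁, Decay s C (coeff (Y τ)) :=
  h (fun y => y) contDiff_id

/-! ### Smooth functions on the circle -/

theorem exists_decay_of_contDiff (n : ℕ) : ∀ g : UnitAddCircle → ℝ,
    ContDiff ℝ ∞ (fun x : ℝ => g (x : UnitAddCircle)) → ∃ C, Decay n C (coeff g) := by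
  have hcont : ∀ g : UnitAddCircle → ℝ, Continuous (fun x : ℝ => g (x : UnitAddCircle)) →
      Continuous g := fun g hg =>
    (QuotientAddGroup.isQuotientMap_mk (N := AddSubgroup.zmultiples (1 : ℝ))).continuous_iff.2 hg
  have hbound : ∀ g : UnitAddCircle → ℝ, Continuous g → ∃ S : ℝ, ∀ k, ‖coeff g k‖ ≤ S := by
    intro g hg
    obtain ⟨S, hS⟩ := isCompact_univ.exists_bound_of_continuousOn hg.continuousOn
    refine ⟨S, norm_fourierCoeff_le (Eventually.of_forall fun x => ?_)⟩
    rw [Complex.norm_real]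
    exact hS x (mem_univ x)
  induction n with
  | zero =>
    intro g hg
    obtain ⟨S, hS⟩ := hbound g (hcont g hg.continuous)
    exact ⟨S, fun k => by simpa using hS k⟩
  | succ n ih =>
    intro g hg
    have h1 := contDiff_infty_iff_deriv.1 hg
    have hper : Function.Periodic (deriv fun x : ℝ => g (x : UnitAddCircle)) 1 := by
      have h2 : Function.Periodic (fun x : ℝ => g (x : UnitAddCircle)) 1 := fun x => by
        simp only [AddCircle.coe_add_period]
      intro x
      have h3 : (fun y : ℝ => g ((y + 1 : ℝ) : UnitAddCircle))
          = fun y : ℝ => g (y : UnitAddCircle) := funext h2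
      rw [← deriv_comp_add_const (fun x : ℝ => g (x : UnitAddCircle)), h3]
    have hg'c : ContDiff ℝ ∞ fun x : ℝ => hper.lift (x : UnitAddCircle) := h1.2
    obtain ⟨C, hC⟩ := ih hper.lift hg'c
    obtain ⟨S, hS⟩ := hbound g (hcont g hg.continuous)
    have h4 : coeff hper.lift = fun k => 2 * Real.pi * Complex.I * k * coeff g k := by
      funext k
      refine fourierCoeff_of_hasDerivAt
        (Complex.continuous_ofReal.comp (hcont _ hg'c.continuous)) (fun x => ?_) k
      exact (h1.1 x).hasDerivAt.ofReal_comp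
    rw [h4] at hC
    refine ⟨max C S, ?_⟩
    have := Decay.of_deriv hC (hS 0)
    push_cast
    exact this

theorem IsSmooth.decay {v : RealL2} (h : IsSmooth v) (s : ℝ) : ∃ C, Decay s C (coeff v) := by
  obtain ⟨g, hg, hvg⟩ := h
  obtain ⟨n, hn⟩ := exists_nat_ge s
  obtain ⟨C, hC⟩ := exists_decay_of_contDiff n g hg
  refine ⟨C, fun k => ?_⟩
  rw [coeff_congr hvg]
  exact hC.mono hn le_rfl k

theorem iteratedDeriv_fourier (n : ℕ) (k : ℤ) (c : ℂ) :
    iteratedDeriv n (fun x : ℝ => c * fourier k (x : UnitAddCircle))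
      = fun x : ℝ => (2 * Real.pi * Complex.I * k) ^ n * c * fourier k (x : UnitAddCircle) := by
  induction n with
  | zero => simp
  | succ n ih =>
    rw [iteratedDeriv_succ, ih]
    funext x
    rw [((hasDerivAt_fourier 1 k x).const_mul _).deriv]
    push_cast
    ring

theorem contDiff_fourier (k : ℤ) : ContDiff ℝ ∞ fun x : ℝ => fourier k (x : UnitAddCircle) := by
  simp only [fourier_coe_apply]
  have h1 : ContDiff ℝ ∞ fun x : ℝ => (x : ℂ) := Complex.ofRealCLM.contDiff
  exact Complex.contDiff_exp.comp ((contDiff_const.mul h1).div_const _)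

theorem contDiff_fourierSum {c : ℤ → ℂ} (hc : ∀ s, ∃ C, Decay s C c) :
    ContDiff ℝ ∞ fun x : ℝ => fourierSum c (x : UnitAddCircle) := by
  choose C hC using hc
  have h1 : (fun x : ℝ => fourierSum c (x : UnitAddCircle))
      = fun x : ℝ => ∑' k, c k * fourier k (x : UnitAddCircle) := by
    funext x
    exact (hasSum_fourierSum_apply ((hC 2).summable one_lt_two) _).tsum_eq.symm
  rw [h1]
  refine contDiff_tsum (v := fun n (k : ℤ) => (2 * Real.pi * |(k : ℝ)|) ^ n * ‖c k‖)
    (fun k => contDiff_const.mul (contDiff_fourier k)) (fun n _ => ?_) fun n k x _ => ?_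
  · refine Summable.of_nonneg_of_le (fun k => by positivity) (fun k => ?_)
      ((summable_weight one_lt_two).mul_left ((2 * Real.pi) ^ n * C (n + 2)))
    have hp : (0 : ℝ) < 1 + |(k : ℝ)| := by positivity
    have h2 := hC (n + 2) k
    rw [Real.rpow_add hp, Real.rpow_natCast] at h2
    rw [mul_pow, Real.rpow_neg hp.le, ← div_eq_mul_inv, le_div_iff₀ (by positivity)]
    calc _ = (2 * Real.pi) ^ n * (|(k : ℝ)| ^ n * (1 + |(k : ℝ)|) ^ (2 : ℝ) * ‖c k‖) := by ring
      _ ≤ (2 * Real.pi) ^ n * ((1 + |(k : ℝ)|) ^ n * (1 + |(k : ℝ)|) ^ (2 : ℝ) * ‖c k‖) := by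
          gcongr
          linarith
      _ ≤ _ := by gcongr
  · rw [norm_iteratedFDeriv_eq_norm_iteratedDeriv, iteratedDeriv_fourier, norm_mul, norm_mul,
      norm_pow, norm_two_pi_I_mul, fourier_apply, Circle.norm_coe, mul_one]

theorem isSmooth_of_decay {v : RealL2} (h : ∀ s, ∃ C, Decay s C (coeff v)) : IsSmooth v := by
  obtain ⟨C, hC⟩ := h 2
  refine ⟨contRep v, ?_, coe_ae_eq_contRep v (hC.summable one_lt_two)⟩
  simp only [contRep_apply]
  exact Complex.reCLM.contDiff.comp (contDiff_fourierSum h)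

/-! ### Continuity in Sobolev spaces -/

theorem Decay.weighted_le {s C : ℝ} {c : ℤ → ℂ} (h : Decay (s + 1) C c) (hs : 0 ≤ s) (k : ℤ) :
    |(k : ℝ)| ^ (2 * s) * ‖c k‖ ^ 2 ≤ C ^ 2 * (1 + |(k : ℝ)|) ^ (-(2 : ℝ)) := by
  have hp : (0 : ℝ) < 1 + |(k : ℝ)| := by positivity
  have h1 := h k
  rw [Real.rpow_neg hp.le, ← div_eq_mul_inv, le_div_iff₀ (by positivity)]
  calc |(k : ℝ)| ^ (2 * s) * ‖c k‖ ^ 2 * (1 + |(k : ℝ)|) ^ (2 : ℝ)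
      ≤ (1 + |(k : ℝ)|) ^ (2 * s) * ‖c k‖ ^ 2 * (1 + |(k : ℝ)|) ^ (2 : ℝ) := by
        gcongr
        linarith
    _ = ((1 + |(k : ℝ)|) ^ (s + 1) * ‖c k‖) ^ 2 := by
        rw [mul_pow, ← Real.rpow_natCast (_ ^ (s + 1)), ← Real.rpow_mul hp.le, mul_right_comm,
          ← Real.rpow_add hp]
        push_cast
        ring_nf
    _ ≤ C ^ 2 := by gcongr

theorem Decay.memH {s C : ℝ} {v : RealL2} (h : Decay (s + 1) C (coeff v)) (hs : 0 ≤ s) :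
    MemH s v :=
  Summable.of_nonneg_of_le (fun _ => by positivity) (h.weighted_le hs)
    ((summable_weight one_lt_two).mul_left _)

theorem tendsto_weighted_sum {s : ℝ} (hs : 0 ≤ s) {l : Filter ℝ} {Y : ℝ → RealL2} {y : RealL2}
    {C : ℝ} (hd : ∀ᶠ t in l, Decay (s + 1) C (coeff (Y t))) (hy : Decay (s + 1) C (coeff y))
    (hc : ∀ k, Tendsto (fun t => coeff (Y t) k) l (𝓝 (coeff y k))) :
    Tendsto (fun t => ∑' k : ℤ, |(k : ℝ)| ^ (2 * s) * ‖coeff (Y t - y : RealL2) k‖ ^ 2) l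
      (𝓝 0) := by
  have h3 : (0 : ℝ) = ∑' _ : ℤ, 0 := tsum_zero.symm
  rw [h3]
  refine tendsto_tsum_of_dominated_convergence
    (bound := fun k : ℤ => (C + C) ^ 2 * (1 + |(k : ℝ)|) ^ (-(2 : ℝ)))
    ((summable_weight one_lt_two).mul_left _) (fun k => ?_) ?_
  · have h1 := (((hc k).sub_const (coeff y k)).norm.pow 2).const_mul (|(k : ℝ)| ^ (2 * s))
    simp only [coeff_sub]
    simpa using h1
  · filter_upwards [hd] with t ht k
    have h1 : Decay (s + 1) (C + C) (coeff (Y t - y : RealL2)) := fun k => by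
      rw [coeff_sub]
      calc _ ≤ (1 + |(k : ℝ)|) ^ (s + 1) * (‖coeff (Y t) k‖ + ‖coeff y k‖) := by
            gcongr
            exact norm_sub_le _ _
        _ ≤ _ := by
            rw [mul_add]
            exact add_le_add (ht k) (hy k)
    rw [Real.norm_of_nonneg (by positivity)]
    exact h1.weighted_le hs k

theorem contH_of_decay {s : ℝ} (hs : 0 ≤ s) {I : Set ℝ} {Y : ℝ → RealL2}
    (hd : ∀ t₀ ∈ I, ∃ C, ∀ᶠ t in 𝓝[I] t₀, Decay (s + 1) C (coeff (Y t)))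
    (hc : ∀ k, ContinuousOn (fun t => coeff (Y t) k) I) : ContH s I Y := by
  refine ⟨fun t ht => ?_, fun t₀ ht₀ => ?_⟩
  · obtain ⟨C, hC⟩ := hd t ht
    exact (hC.self_of_nhdsWithin ht).memH hs
  · obtain ⟨C, hC⟩ := hd t₀ ht₀
    have hy := hC.self_of_nhdsWithin ht₀
    have hc' : ∀ k, Tendsto (fun t => coeff (Y t) k) (𝓝[I] t₀) (𝓝 (coeff (Y t₀) k)) :=
      fun k => hc k t₀ ht₀
    have h1 := (tendsto_weighted_sum hs hC hy hc').sqrt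
    have h2 := (tendsto_weighted_sum le_rfl (hC.mono fun t ht => ht.mono (by linarith) le_rfl)
      (hy.mono (s' := 0 + 1) (by linarith) le_rfl) hc').sqrt
    have h3 : ∀ t, Real.sqrt (∑' k : ℤ, |(k : ℝ)| ^ (2 * (0 : ℝ))
        * ‖coeff (Y t - Y t₀ : RealL2) k‖ ^ 2) = ‖Y t - Y t₀‖ := fun t => by
      simp only [mul_zero, Real.rpow_zero, one_mul]
      rw [(hasSum_sq_coeff _).tsum_eq, Real.sqrt_sq (norm_nonneg _)]
    simp only [h3] at h2
    have h4 := h2.add (h1.const_mul ((2 * Real.pi) ^ s))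
    simpa [normH] using h4

/-! ### Mild solutions -/

theorem Icc_subset_timeInterval {T : EReal} {t : ℝ} (ht : t ∈ timeInterval T) :
    Icc 0 t ⊆ timeInterval T := fun _ hτ =>
  ⟨hτ.1, lt_of_le_of_lt (EReal.coe_le_coe_iff.2 hτ.2) ht.2⟩

theorem exists_gt_mem_timeInterval {T : EReal} {t : ℝ} (ht : t ∈ timeInterval T) :
    ∃ t₁ ∈ timeInterval T, t < t₁ := by
  obtain ⟨t₁, h1, h2⟩ := EReal.lt_iff_exists_real_btwn.1 ht.2
  have h3 : t < t₁ := EReal.coe_lt_coe_iff.1 h1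
  exact ⟨t₁, ⟨ht.1.trans h3.le, h2⟩, h3⟩

theorem duhamelAt_of_heat {α ν : ℝ} (hν : 0 ≤ ν) {f : ℝ → ℝ} {u₀ : RealL2} {Y G : ℝ → RealL2}
    {t : ℝ} (ht : 0 ≤ t) (hG : ∀ τ ∈ Icc 0 t, IsWeakDeriv (fun x => f (Y τ x)) (G τ))
    (hint : IntervalIntegrable (fun τ => heat α (ν * (t - τ)) (toComplex (G τ))) volume 0 t)
    (heq : toComplex (Y t) = heat α (ν * t) (toComplex u₀) -
      ∫ τ in (0 : ℝ)..t, heat α (ν * (t - τ)) (toComplex (G τ))) :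
    DuhamelAt α ν (coeff u₀) (fun τ => coeff fun x => f (Y τ x)) t (coeff (Y t)) := fun k => by
  rw [← fourierCoeff_toComplex (Y t), ← coeffL_apply, heq, map_sub, coeffL_apply,
    fourierCoeff_heat α (by positivity), fourierCoeff_toComplex]
  congr 1
  have h1 := (coeffL k).intervalIntegral_comp_comm hint
  rw [← h1]
  refine intervalIntegral.integral_congr fun τ hτ => ?_
  rw [uIcc_of_le ht] at hτ
  have h2 : 0 ≤ ν * (t - τ) := mul_nonneg hν (by linarith [hτ.2])
  simp only
  rw [coeffL_apply, fourierCoeff_heat α h2, fourierCoeff_toComplex, (hG τ hτ).2, derivHeatSymbol]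
  ring

theorem IsMildSolution.duhamelAt {α ν : ℝ} (hν : 0 ≤ ν) {f : ℝ → ℝ} {u₀ : RealL2} {T : EReal}
    {Y : ℝ → RealL2} (h : IsMildSolution α ν f u₀ T Y) {t : ℝ} (ht : t ∈ timeInterval T) :
    DuhamelAt α ν (coeff u₀) (fun τ => coeff fun x => f (Y τ x)) t (coeff (Y t)) := by
  obtain ⟨-, G, hG, hY⟩ := h
  exact duhamelAt_of_heat hν ht.1 (fun τ hτ => hG τ (Icc_subset_timeInterval ht hτ))
    (hY t ht).1 (hY t ht).2

theorem IsWeakDeriv.normH_eq {v w : RealL2} (h : IsWeakDeriv v w) : normH 1 v = ‖v‖ + ‖w‖ := by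
  have h1 := h.hasSum.tsum_eq
  rw [tsum_mul_left] at h1
  rw [normH, Real.rpow_one]
  congr 1
  rw [← Real.sqrt_sq (show 0 ≤ 2 * Real.pi by positivity), ← Real.sqrt_mul (by positivity), h1,
    Real.sqrt_sq (norm_nonneg _)]

theorem IsWeakDeriv.sub {v w v' w' : RealL2} (h : IsWeakDeriv v w) (h' : IsWeakDeriv v' w') :
    IsWeakDeriv (v - v' : RealL2) (w - w') := by
  refine (isWeakDeriv_iff _ _).2 fun k => ?_
  rw [coeff_sub, coeff_sub, h.2, h'.2]
  ring

theorem norm_le_normH (s : ℝ) (v : RealL2) : ‖v‖ ≤ normH s v :=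
  le_add_of_nonneg_right (by positivity)

theorem ContH.continuousOn {s : ℝ} {I : Set ℝ} {Y : ℝ → RealL2} (h : ContH s I Y) :
    ContinuousOn Y I := fun t ht => by
  rw [ContinuousWithinAt, tendsto_iff_norm_sub_tendsto_zero]
  exact squeeze_zero (fun _ => norm_nonneg _) (fun _ => norm_le_normH s _) (h.2 t ht)

theorem ContH.bddH1 {I : Set ℝ} {Y : ℝ → RealL2} (h : ContH 1 I Y) {t₁ : ℝ}
    (ht₁ : Icc 0 t₁ ⊆ I) : BddH1 t₁ Y := by
  refine isCompact_Icc.induction_on (p := fun s => ∃ R : ℝ, ∀ τ ∈ s, ‖Y τ‖ ≤ R ∧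
    ∃ w : RealL2, IsWeakDeriv (Y τ) w ∧ ‖w‖ ≤ R) ⟨0, fun _ h => h.elim⟩
    (fun s t hst ⟨R, hR⟩ => ⟨R, fun τ hτ => hR τ (hst hτ)⟩) ?_ ?_
  · rintro s t ⟨R, hR⟩ ⟨R', hR'⟩
    refine ⟨max R R', fun τ hτ => ?_⟩
    rcases hτ with hτ | hτ
    · obtain ⟨h1, w, h2, h3⟩ := hR τ hτ
      exact ⟨h1.trans (le_max_left _ _), w, h2, h3.trans (le_max_left _ _)⟩
    · obtain ⟨h1, w, h2, h3⟩ := hR' τ hτ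
      exact ⟨h1.trans (le_max_right _ _), w, h2, h3.trans (le_max_right _ _)⟩
  · intro t₀ ht₀
    obtain ⟨w₀, hw₀⟩ := (h.1 t₀ (ht₁ ht₀)).exists_isWeakDeriv
    have h1 := ((h.2 t₀ (ht₁ ht₀)).mono_left (nhdsWithin_mono _ ht₁)).eventually
      (gt_mem_nhds one_pos)
    refine ⟨_, inter_mem h1 self_mem_nhdsWithin, ‖Y t₀‖ + ‖w₀‖ + 1, fun τ hτ => ?_⟩
    obtain ⟨w, hw⟩ := (h.1 τ (ht₁ hτ.2)).exists_isWeakDeriv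
    have h2 : normH 1 (Y τ - Y t₀) < 1 := hτ.1
    rw [(hw.sub hw₀).normH_eq] at h2
    have h3 := norm_le_norm_add_norm_sub' (Y τ) (Y t₀)
    have h4 := norm_le_norm_add_norm_sub' w w₀
    have := norm_nonneg (Y τ - Y t₀)
    have := norm_nonneg (w - w₀)
    have := norm_nonneg (Y t₀)
    have := norm_nonneg w₀
    exact ⟨by linarith, w, hw, by linarith⟩

theorem exists_decay_of_duhamel {α ν : ℝ} (hα : 1 < α) (hν : 0 < ν) {f : ℝ → ℝ}
    (hf : ContDiff ℝ ∞ f) {u₀ : RealL2} (hu₀ : IsSmooth u₀) {Y : ℝ → RealL2} {t₁ : ℝ}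
    (hb : BddH1 t₁ Y) (hY : ∀ t ∈ Icc 0 t₁,
      DuhamelAt α ν (coeff u₀) (fun τ => coeff fun x => f (Y τ x)) t (coeff (Y t))) (s : ℝ) :
    ∃ C, ∀ τ ∈ Icc 0 t₁, Decay s C (coeff (Y τ)) :=
  (UniformDecay.all hα hν hf hu₀.decay hb hY s).self

theorem contH_of_decay_Icc {T : EReal} {Y : ℝ → RealL2} (hY : ContinuousOn Y (timeInterval T))
    (hd : ∀ t₁ ∈ timeInterval T, ∀ s, ∃ C, ∀ τ ∈ Icc 0 t₁, Decay s C (coeff (Y τ))) {s : ℝ}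
    (hs : 0 ≤ s) : ContH s (timeInterval T) Y := by
  refine contH_of_decay hs (fun t₀ ht₀ => ?_) fun k => (continuous_coeff k).comp_continuousOn hY
  obtain ⟨t₁, ht₁, hlt⟩ := exists_gt_mem_timeInterval ht₀
  obtain ⟨C, hC⟩ := hd t₁ ht₁ (s + 1)
  refine ⟨C, ?_⟩
  filter_upwards [self_mem_nhdsWithin, mem_nhdsWithin_of_mem_nhds (Iio_mem_nhds hlt)] with t h1 h2
  exact hC t ⟨h1.1, le_of_lt h2⟩

theorem IsMildSolution.exists_decay {α ν : ℝ} (hα : 1 < α) (hν : 0 < ν) {f : ℝ → ℝ}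
    (hf : ContDiff ℝ ∞ f) {u₀ : RealL2} (hu₀ : IsSmooth u₀) {T : EReal} {Y : ℝ → RealL2}
    (h : IsMildSolution α ν f u₀ T Y) {t₁ : ℝ} (ht₁ : t₁ ∈ timeInterval T) (s : ℝ) :
    ∃ C, ∀ τ ∈ Icc 0 t₁, Decay s C (coeff (Y τ)) :=
  exists_decay_of_duhamel hα hν hf hu₀ (h.1.bddH1 (Icc_subset_timeInterval ht₁))
    (fun _ ht => h.duhamelAt hν.le (Icc_subset_timeInterval ht₁ ht)) s

theorem IsMildSolution.contH {α ν : ℝ} (hα : 1 < α) (hν : 0 < ν) {f : ℝ → ℝ}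
    (hf : ContDiff ℝ ∞ f) {u₀ : RealL2} (hu₀ : IsSmooth u₀) {T : EReal} {Y : ℝ → RealL2}
    (h : IsMildSolution α ν f u₀ T Y) {s : ℝ} (hs : 0 ≤ s) : ContH s (timeInterval T) Y :=
  contH_of_decay_Icc h.1.continuousOn (fun _ ht₁ => h.exists_decay hα hν hf hu₀ ht₁) hs

theorem IsMildSolution.isSmooth {α ν : ℝ} (hα : 1 < α) (hν : 0 < ν) {f : ℝ → ℝ}
    (hf : ContDiff ℝ ∞ f) {u₀ : RealL2} (hu₀ : IsSmooth u₀) {T : EReal} {Y : ℝ → RealL2}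
    (h : IsMildSolution α ν f u₀ T Y) {t : ℝ} (ht : t ∈ timeInterval T) : IsSmooth (Y t) :=
  isSmooth_of_decay fun s => by
    obtain ⟨C, hC⟩ := h.exists_decay hα hν hf hu₀ ht s
    exact ⟨C, hC t ⟨ht.1, le_rfl⟩⟩

/-! ### Uniqueness -/

theorem exists_lipschitz_on_ball {F : ℝ → ℝ} (hF : ContDiff ℝ ∞ F) (M : ℝ) :
    ∃ L : ℝ, 0 ≤ L ∧ ∀ x y, |x| ≤ M → |y| ≤ M → |F x - F y| ≤ L * |x - y| := by
  obtain ⟨G, G', rfl, hG, -⟩ := exists_continuousMap_deriv hF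
  obtain ⟨L, hL⟩ := exists_bound_on_ball G' M
  refine ⟨|L|, abs_nonneg L, fun x y hx hy => ?_⟩
  have := (convex_Icc (-M) M).norm_image_sub_le_of_norm_hasDerivWithin_le (f := G) (f' := G')
    (C := |L|) (x := y) (y := x) (fun z _ => (hG z).hasDerivWithinAt)
    (fun z hz => (hL z (abs_le.2 hz)).trans (le_abs_self L)) (abs_le.1 hy) (abs_le.1 hx)
  exact this

theorem norm_heat_sub_heat_le {α ν : ℝ} (hα : 1 ≤ α) (hν : 0 < ν) {f : ℝ → ℝ}
    (hf : ContDiff ℝ ∞ f) {r : ℝ} (hr : 0 < r) {v v' w w' g g' : RealL2} (hv : IsWeakDeriv v w)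
    (hv' : IsWeakDeriv v' w') {L : ℝ}
    (hL : ∀ x, |f (contRep v x) - f (contRep v' x)| ≤ L * |contRep v x - contRep v' x|)
    (hg : IsWeakDeriv (fun x => f (v x)) g) (hg' : IsWeakDeriv (fun x => f (v' x)) g') :
    ‖heat α (ν * r) (toComplex g) - heat α (ν * r) (toComplex g')‖
      ≤ ν ^ (-(1 / α)) * L * r ^ (-(1 / α)) * ‖v - v'‖ := by
  obtain ⟨F, F', rfl, hF, -⟩ := exists_continuousMap_deriv hf
  set a := contL2 (F.comp (contRep v)) - contL2 (F.comp (contRep v')) with ha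
  have h1 : ‖a‖ ≤ L * ‖v - v'‖ := by
    refine Lp.norm_le_mul_norm_of_ae_le_mul ?_
    filter_upwards [Lp.coeFn_sub (contL2 (F.comp (contRep v))) (contL2 (F.comp (contRep v'))),
      hv.comp_ae F, hv'.comp_ae F, Lp.coeFn_sub v v', coe_ae_eq_contRep v hv.summable_coeff.1,
      coe_ae_eq_contRep v' hv'.summable_coeff.1] with x h1 h2 h3 h4 h5 h6
    rw [ha, h1, h4, Pi.sub_apply, Pi.sub_apply, h2, h3, h5, h6]
    exact hL x
  have h0 : 0 ≤ ν * r := by positivity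
  have h2 : ‖heat α (ν * r) (toComplex g) - heat α (ν * r) (toComplex g')‖
      ≤ (ν * r) ^ (-(1 / α)) * ‖a‖ := by
    refine norm_le_of_coeff_le (by positivity) fun k => ?_
    have h3 : fourierCoeff (heat α (ν * r) (toComplex g) - heat α (ν * r) (toComplex g') :
        ComplexL2) k = derivHeatSymbol α (ν * r) k * coeff a k := by
      rw [← coeffL_apply, map_sub, coeffL_apply, coeffL_apply, fourierCoeff_heat α h0,
        fourierCoeff_heat α h0, fourierCoeff_toComplex, fourierCoeff_toComplex, hg.2, hg'.2, ha,
        coeff_sub, coeff_congr (hv.comp_ae F), coeff_congr (hv'.comp_ae F), derivHeatSymbol]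
      ring
    rw [h3, norm_mul]
    exact mul_le_mul_of_nonneg_right (norm_derivHeatSymbol_le hα (by positivity) k)
      (norm_nonneg _)
  calc _ ≤ (ν * r) ^ (-(1 / α)) * (L * ‖v - v'‖) := h2.trans (by gcongr)
    _ = _ := by
      rw [Real.mul_rpow hν.le hr.le]
      ring

theorem IsMildSolution.unique {α ν : ℝ} (hα : 1 < α) (hν : 0 < ν) {f : ℝ → ℝ}
    (hf : ContDiff ℝ ∞ f) {u₀ : RealL2} {T : EReal} {Y Z : ℝ → RealL2}
    (hY : IsMildSolution α ν f u₀ T Y) (hZ : IsMildSolution α ν f u₀ T Z) {t : ℝ}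
    (ht : t ∈ timeInterval T) : Y t = Z t := by
  have hsub := Icc_subset_timeInterval ht
  obtain ⟨M, hM⟩ := (hY.1.bddH1 hsub).exists_abs_contRep_le
  obtain ⟨M', hM'⟩ := (hZ.1.bddH1 hsub).exists_abs_contRep_le
  obtain ⟨L, hL0, hL⟩ := exists_lipschitz_on_ball hf (max M M')
  obtain ⟨hYc, G, hG, hYe⟩ := hY
  obtain ⟨hZc, G', hG', hZe⟩ := hZ
  have hβ : 1 / α < 1 := by
    rw [div_lt_one (by linarith)]
    exact hα
  have hδ : ContinuousOn (fun τ => ‖Y τ - Z τ‖) (Icc 0 t) :=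
    ((hYc.continuousOn.mono hsub).sub (hZc.continuousOn.mono hsub)).norm
  have key := eq_zero_of_le_volterra (δ := fun τ => ‖Y τ - Z τ‖) (T := t)
    (C := ν ^ (-(1 / α)) * L) hβ (by positivity) hδ (fun _ _ => norm_nonneg _) ?_ t ⟨ht.1, le_rfl⟩
  · exact sub_eq_zero.1 (norm_eq_zero.1 key)
  · intro s hs
    have hsT := hsub hs
    have h1 : toComplex (Y s - Z s) = -∫ τ in (0 : ℝ)..s,
        (heat α (ν * (s - τ)) (toComplex (G τ)) - heat α (ν * (s - τ)) (toComplex (G' τ))) := by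
      rw [map_sub, (hYe s hsT).2, (hZe s hsT).2,
        intervalIntegral.integral_sub (hYe s hsT).1 (hZe s hsT).1]
      abel
    rw [← norm_toComplex, h1, norm_neg]
    refine intervalIntegral.norm_integral_le_of_norm_le hs.1 ?_ ?_
    · have hne : ∀ᵐ τ ∂(volume : Measure ℝ), τ ≠ s := by simp [ae_iff]
      filter_upwards [hne] with τ hτs hτ
      have hτ' : τ ∈ Icc 0 t := ⟨hτ.1.le, hτ.2.trans hs.2⟩
      obtain ⟨w, hw⟩ := (hYc.1 τ (hsub hτ')).exists_isWeakDeriv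
      obtain ⟨w', hw'⟩ := (hZc.1 τ (hsub hτ')).exists_isWeakDeriv
      refine norm_heat_sub_heat_le hα.le hν hf (sub_pos.2 (lt_of_le_of_ne hτ.2 hτs)) hw hw'
        (fun x => hL _ _ ?_ ?_) (hG τ (hsub hτ')) (hG' τ (hsub hτ'))
      · exact (hM τ hτ' x).trans (le_max_left _ _)
      · exact (hM' τ hτ' x).trans (le_max_right _ _)
    · have h2 : IntervalIntegrable (fun r : ℝ => r ^ (-(1 / α))) volume 0 s :=
        intervalIntegral.intervalIntegrable_rpow' (by linarith)
      have h3 := (h2.comp_sub_left s).symm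
      simp only [sub_zero, sub_self] at h3
      refine (h3.const_mul _).mul_continuousOn ?_
      rw [uIcc_of_le hs.1]
      exact hδ.mono (Icc_subset_Icc_right hs.2)

theorem IsMildSolution.mono {α ν : ℝ} {f : ℝ → ℝ} {u₀ : RealL2} {T T' : EReal} {Y : ℝ → RealL2}
    (h : IsMildSolution α ν f u₀ T Y) (hT : T' ≤ T) : IsMildSolution α ν f u₀ T' Y := by
  have hsub : timeInterval T' ⊆ timeInterval T := fun t ht => ⟨ht.1, ht.2.trans_le hT⟩
  obtain ⟨hc, G, hG, hY⟩ := h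
  exact ⟨⟨fun t ht => hc.1 t (hsub ht), fun t ht =>
    (hc.2 t (hsub ht)).mono_left (nhdsWithin_mono _ hsub)⟩,
    G, fun t ht => hG t (hsub ht), fun t ht => hY t (hsub ht)⟩

/-! ### Global solutions for Lipschitz fluxes -/

theorem exists_global_of_lipschitz {α ν : ℝ} (hα : 1 < α) (hν : 0 < ν) {f : ℝ → ℝ}
    (hf : ContDiff ℝ ∞ f) (hf0 : f 0 = 0) {L : ℝ} (hL : ∀ y, |deriv f y| ≤ L) {u₀ : RealL2}
    (hu₀ : IsSmooth u₀) :
    ∃ Y : ℝ → RealL2, Continuous Y ∧ IsMildSolution α ν f u₀ ⊤ Y := by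
  have hL0 : 0 ≤ L := (abs_nonneg _).trans (hL 0)
  have hβ : 1 / α < 1 := by
    rw [div_lt_one (by linarith)]
    exact hα
  have hlip : LipschitzWith ⟨L, hL0⟩ f :=
    lipschitzWith_of_nnnorm_deriv_le (contDiff_infty_iff_deriv.1 hf).1 hL
  obtain ⟨F, F', rfl, hF, -⟩ := exists_continuousMap_deriv hf
  have hF' : ∀ y, |F' y| ≤ L := fun y => by
    rw [← (hF y).deriv]
    exact hL y
  have hchain : ∀ v w : RealL2, IsWeakDeriv v w →
      ∃ z : RealL2, IsWeakDeriv (fun x => F (v x)) z ∧ ‖z‖ ≤ L * ‖w‖ := fun v w h =>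
    h.exists_comp hF fun x => hF' _
  obtain ⟨K, hK, hKc, hKb⟩ := exists_derivHeat hα.le hν
  obtain ⟨S, hSc, hSb, hS⟩ := exists_heatFlow α hν.le u₀
  obtain ⟨D, hD⟩ := exists_truncDeriv
  obtain ⟨w₀, hw₀⟩ : ∃ w₀ : RealL2, IsWeakDeriv u₀ w₀ := by
    obtain ⟨C, hC⟩ := hu₀.decay (1 + 1)
    exact (hC.memH zero_le_one).exists_isWeakDeriv
  have hNcoeff : ∀ (v : RealL2) k, coeff (hlip.compLp hf0 v) k = coeff (fun x => F (v x)) k :=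
    fun v k => coeff_congr (hlip.coeFn_compLp hf0 v) k
  obtain ⟨Y, hYc, hY, μ, R, hYR⟩ := exists_volterra hKc hβ hKb
    (N := fun v => hlip.compLp hf0 v) hL0 (fun v w => hlip.norm_compLp_sub_le hf0 v w)
    (hlip.compLp_zero hf0) hSc hSb D (fun n r hr v => realL2_ext fun k => by
      rw [hD, hK r hr, hK r hr, hD]
      ring) (fun v R hR n => by
      obtain ⟨w, hw, hwR⟩ := exists_isWeakDeriv_of_truncDeriv hD hR
      obtain ⟨z, hz, hzL⟩ := hchain v w hw
      have hz' : IsWeakDeriv (hlip.compLp hf0 v) z :=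
        (isWeakDeriv_iff _ _).2 fun k => by rw [hz.2, hNcoeff]
      refine (hz'.norm_truncDeriv_le hD n).trans (hzL.trans ?_)
      gcongr) (norm_nonneg w₀) (fun t n => by
      rw [← one_mul ‖w₀‖]
      refine norm_real_le_of_coeff_le zero_le_one fun k => ?_
      have h1 := norm_coeff_le (D n u₀) k
      have hexp : Real.exp (-((2 * Real.pi * |(k : ℝ)|) ^ α * (ν * max t 0))) ≤ 1 := by
        rw [Real.exp_le_one_iff, neg_nonpos]
        have : 0 ≤ max t 0 := le_max_right _ _
        positivity
      rw [hD, hS, mul_left_comm, norm_mul, Complex.norm_real,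
        Real.norm_of_nonneg (Real.exp_pos _).le]
      refine mul_le_mul hexp ?_ (norm_nonneg _) zero_le_one
      split_ifs
      · rw [hw₀.2]
      · simp)
  have hder : ∀ τ, ∃ w : RealL2, 0 ≤ τ → IsWeakDeriv (Y τ) w ∧ ‖w‖ ≤ R * Real.exp (μ * τ) :=
    fun τ => by
    by_cases hτ : 0 ≤ τ
    · obtain ⟨w, hw⟩ := exists_isWeakDeriv_of_truncDeriv hD (hYR τ hτ)
      exact ⟨w, fun _ => hw⟩
    · exact ⟨0, fun h => absurd h hτ⟩
  have hG : ∀ τ, ∃ z : RealL2, 0 ≤ τ → IsWeakDeriv (fun x => F (Y τ x)) z := fun τ => by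
    obtain ⟨w, hw⟩ := hder τ
    by_cases hτ : 0 ≤ τ
    · obtain ⟨z, hz, -⟩ := hchain _ w (hw hτ).1
      exact ⟨z, fun _ => hz⟩
    · exact ⟨0, fun h => absurd h hτ⟩
  choose G hG using hG
  have hb : ∀ t₁, BddH1 t₁ Y := fun t₁ => by
    obtain ⟨B, hB⟩ := (isCompact_Icc (a := 0) (b := t₁)).exists_bound_of_continuousOn
      hYc.continuousOn
    obtain ⟨B', hB'⟩ := (isCompact_Icc (a := 0) (b := t₁)).exists_bound_of_continuousOn
      (f := fun t => R * Real.exp (μ * t)) (Continuous.continuousOn (by fun_prop))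
    refine ⟨max B B', fun τ hτ => ⟨(hB τ hτ).trans (le_max_left _ _), ?_⟩⟩
    obtain ⟨w, hw⟩ := hder τ
    exact ⟨w, (hw hτ.1).1, (hw hτ.1).2.trans
      ((le_abs_self _).trans ((hB' τ hτ).trans (le_max_right _ _)))⟩
  have hKG : ∀ t r, 0 < r → r ≤ t → toComplex (K r (hlip.compLp hf0 (Y (t - r))))
      = heat α (ν * r) (toComplex (G (t - r))) := fun t r hr hrt => by
    refine complexL2_ext fun k => ?_
    rw [fourierCoeff_toComplex, hK r hr, hNcoeff, fourierCoeff_heat α (by positivity),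
      fourierCoeff_toComplex, (hG (t - r) (by linarith)).2, derivHeatSymbol]
    ring
  have hmild : ∀ t, 0 ≤ t →
      IntervalIntegrable (fun τ => heat α (ν * (t - τ)) (toComplex (G τ))) volume 0 t ∧
      toComplex (Y t) = heat α (ν * t) (toComplex u₀) -
        ∫ τ in (0 : ℝ)..t, heat α (ν * (t - τ)) (toComplex (G τ)) := fun t ht => by
    obtain ⟨h1, h2⟩ := hY t ht
    have hcongr : ∀ᵐ τ ∂(volume : Measure ℝ), τ ∈ uIoc 0 t →
        toComplex (K (t - τ) (hlip.compLp hf0 (Y τ)))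
          = heat α (ν * (t - τ)) (toComplex (G τ)) := by
      have hne : ∀ᵐ τ ∂(volume : Measure ℝ), τ ≠ t := by simp [ae_iff]
      filter_upwards [hne] with τ hτt hτ
      rw [uIoc_of_le ht] at hτ
      have := hKG t (t - τ) (sub_pos.2 (lt_of_le_of_ne hτ.2 hτt)) (by linarith [hτ.1])
      rwa [sub_sub_cancel] at this
    have h3 : IntervalIntegrable (fun τ => toComplex (K (t - τ) (hlip.compLp hf0 (Y τ))))
        volume 0 t :=
      ⟨toComplex.integrable_comp h1.1, toComplex.integrable_comp h1.2⟩
    refine ⟨h3.congr_ae ((ae_restrict_iff' measurableSet_uIoc).2 hcongr), ?_⟩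
    have h4 := toComplex.intervalIntegral_comp_comm h1
    rw [intervalIntegral.integral_congr_ae hcongr] at h4
    rw [h2, map_sub, h4]
    congr 1
    refine complexL2_ext fun k => ?_
    rw [fourierCoeff_toComplex, hS, fourierCoeff_heat α (by positivity), fourierCoeff_toComplex,
      max_eq_left ht]
  refine ⟨Y, hYc, contH_of_decay_Icc hYc.continuousOn (fun t₁ _ s => ?_) zero_le_one, G,
    fun τ hτ => hG τ hτ.1, fun t ht => hmild t ht.1⟩
  refine exists_decay_of_duhamel hα hν hf hu₀ (hb t₁) (fun t ht => ?_) s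
  exact duhamelAt_of_heat hν.le ht.1 (fun τ hτ => hG τ hτ.1) (hmild t ht.1).1 (hmild t ht.1).2

/-! ### Truncation of the flux -/

theorem exists_truncation {f : ℝ → ℝ} (hf : ContDiff ℝ ∞ f) (M : ℝ) :
    ∃ g : ℝ → ℝ, ContDiff ℝ ∞ g ∧ g 0 = 0 ∧ (∃ L : ℝ, ∀ y, |deriv g y| ≤ L) ∧
      ∀ y, |y| ≤ M → f y = g y + f 0 := by
  let χ : ContDiffBump (0 : ℝ) := ⟨|M| + 1, |M| + 2, by positivity, by linarith⟩
  have hg : ContDiff ℝ ∞ fun y => χ y * (f y - f 0) := χ.contDiff.mul (hf.sub contDiff_const)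
  have hs : HasCompactSupport fun y => χ y * (f y - f 0) := χ.hasCompactSupport.mul_right
  refine ⟨_, hg, by simp, ?_, fun y hy => ?_⟩
  · exact (contDiff_infty_iff_deriv.1 hg).2.continuous.bounded_above_of_compact_support hs.deriv
  · have : χ y = 1 := χ.one_of_mem_closedBall (by
      rw [Metric.mem_closedBall, dist_zero_right, Real.norm_eq_abs]
      exact hy.trans ((le_abs_self M).trans (le_add_of_nonneg_right zero_le_one)))
    simp only [this, one_mul, sub_add_cancel]

theorem mul_coeff_const (c : ℝ) (k : ℤ) :
    2 * Real.pi * Complex.I * k * coeff (fun _ => c) k = 0 := by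
  have h := fourierCoeff_of_hasDerivAt (g := fun _ => (c : ℂ)) (g' := fun _ => 0)
    continuous_const (fun x => hasDerivAt_const x (c : ℂ)) k
  unfold coeff
  rw [← h]
  simp [fourierCoeff]

/-- A mild solution for `g` is one for `f` as long as `f - g` is constant on its range. -/
theorem IsMildSolution.congr_flux {α ν : ℝ} {f g : ℝ → ℝ} {u₀ : RealL2} {T : EReal}
    {Y : ℝ → RealL2} (h : IsMildSolution α ν g u₀ T Y) {c : ℝ}
    (hfg : ∀ t ∈ timeInterval T, ∀ᵐ x ∂haarAddCircle, f (Y t x) = g (Y t x) + c) :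
    IsMildSolution α ν f u₀ T Y := by
  obtain ⟨hc, G, hG, hY⟩ := h
  refine ⟨hc, G, fun t ht => ?_, hY⟩
  have h1 := (hG t ht).1.add (integrable_const c)
  refine ⟨h1.congr ((hfg t ht).mono fun x hx => hx.symm), fun k => ?_⟩
  have h2 : coeff (fun x => f (Y t x)) k
      = coeff (fun x => g (Y t x)) k + coeff (fun _ => c) k := by
    rw [coeff_congr (hfg t ht)]
    unfold coeff
    rw [← Pi.add_apply, ← fourierCoeff.add (hG t ht).1.ofReal (integrable_const _)]
    congr 1
    ext x
    simp
  rw [h2, mul_add, mul_coeff_const, add_zero]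
  exact (hG t ht).2 k

theorem exists_abs_contRep_le {v : RealL2} (hv : IsSmooth v) :
    ∃ M : ℝ, ∀ x, |contRep v x| ≤ M := by
  obtain ⟨C, hC⟩ := hv.decay 2
  exact ⟨_, abs_contRep_le _ (hC.summable one_lt_two)⟩

theorem dist_contRep_le {v w : RealL2} {C : ℝ} (hv : Decay 2 C (coeff v))
    (hw : Decay 2 C (coeff w)) :
    ∀ x, |contRep v x - contRep w x| ≤ ∑' k, ‖coeff v k - coeff w k‖ := by
  intro x
  have h1 := hv.summable one_lt_two
  have h2 := hw.summable one_lt_two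
  have h3 := (hasSum_fourierSum_apply h1 x).sub (hasSum_fourierSum_apply h2 x)
  have h4 : Summable fun k => ‖coeff v k - coeff w k‖ :=
    Summable.of_nonneg_of_le (fun _ => norm_nonneg _) (fun k => norm_sub_le _ _) (h1.add h2)
  rw [contRep_apply, contRep_apply, ← Complex.sub_re, ← h3.tsum_eq]
  have hn : ∀ k, ‖coeff v k * fourier k x - coeff w k * fourier k x‖
      = ‖coeff v k - coeff w k‖ := fun k => by
    rw [← sub_mul, norm_mul, fourier_apply, Circle.norm_coe, mul_one]
  refine (Complex.abs_re_le_norm _).trans ((norm_tsum_le_tsum_norm ?_).trans_eq ?_)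
  · simpa only [hn] using h4
  · simp only [hn]

theorem tendsto_tsum_coeff_sub {l : Filter ℝ} {Y : ℝ → RealL2} {y : RealL2} {C : ℝ}
    (hd : ∀ᶠ t in l, Decay 2 C (coeff (Y t))) (hy : Decay 2 C (coeff y))
    (hc : ∀ k, Tendsto (fun t => coeff (Y t) k) l (𝓝 (coeff y k))) :
    Tendsto (fun t => ∑' k, ‖coeff (Y t) k - coeff y k‖) l (𝓝 0) := by
  have h3 : (0 : ℝ) = ∑' _ : ℤ, 0 := tsum_zero.symm
  rw [h3]
  refine tendsto_tsum_of_dominated_convergence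
    (bound := fun k : ℤ => C * (1 + |(k : ℝ)|) ^ (-(2 : ℝ)) + C * (1 + |(k : ℝ)|) ^ (-(2 : ℝ)))
    (((summable_weight one_lt_two).mul_left _).add ((summable_weight one_lt_two).mul_left _))
    (fun k => ?_) ?_
  · simpa using ((hc k).sub_const (coeff y k)).norm
  · filter_upwards [hd] with t ht k
    rw [norm_norm]
    exact (norm_sub_le _ _).trans (add_le_add (ht.norm_le k) (hy.norm_le k))

theorem exists_local_solution {α ν : ℝ} (hα : 1 < α) (hν : 0 < ν) {f : ℝ → ℝ}
    (hf : ContDiff ℝ ∞ f) {u₀ : RealL2} (hu₀ : IsSmooth u₀) :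
    ∃ (T : ℝ) (Y : ℝ → RealL2), 0 < T ∧ IsMildSolution α ν f u₀ T Y := by
  obtain ⟨M, hM⟩ := exists_abs_contRep_le hu₀
  obtain ⟨g, hg, hg0, ⟨L, hL⟩, hfg⟩ := exists_truncation hf (M + 1)
  obtain ⟨Y, hYc, hY⟩ := exists_global_of_lipschitz hα hν hg hg0 hL hu₀
  have hmem : ∀ t : ℝ, 0 ≤ t → t ∈ timeInterval ⊤ := fun t ht => ⟨ht, EReal.coe_lt_top t⟩
  have hY0 : Y 0 = u₀ := by
    refine realL2_ext fun k => ?_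
    rw [hY.duhamelAt hν.le (hmem 0 le_rfl) k]
    simp
  obtain ⟨C, hC⟩ := hY.exists_decay hα hν hg hu₀ (hmem 1 zero_le_one) 2
  have hC0 : Decay 2 C (coeff (Y 0)) := hC 0 ⟨le_rfl, zero_le_one⟩
  have hlim : Tendsto (fun t => ∑' k, ‖coeff (Y t) k - coeff (Y 0) k‖) (𝓝[≥] 0) (𝓝 0) := by
    refine tendsto_tsum_coeff_sub (C := C) ?_ hC0 fun k =>
      (((continuous_coeff k).comp hYc).tendsto 0).mono_left nhdsWithin_le_nhds
    filter_upwards [self_mem_nhdsWithin, mem_nhdsWithin_of_mem_nhds (Iio_mem_nhds one_pos)]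
      with t h1 h2
    exact hC t ⟨h1, le_of_lt h2⟩
  have hev := hlim.eventually (gt_mem_nhds one_pos)
  rw [eventually_nhdsWithin_iff, Metric.eventually_nhds_iff] at hev
  obtain ⟨ε, hε, hev⟩ := hev
  refine ⟨min ε 1, Y, lt_min hε one_pos, (hY.mono le_top).congr_flux (c := f 0) fun t ht => ?_⟩
  have ht1 : t < min ε 1 := EReal.coe_lt_coe_iff.1 ht.2
  have hCt : Decay 2 C (coeff (Y t)) := hC t ⟨ht.1, (ht1.trans_le (min_le_right _ _)).le⟩
  have hsum := hev (y := t) (by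
    rw [dist_zero_right, Real.norm_of_nonneg ht.1]
    exact ht1.trans_le (min_le_left _ _)) ht.1
  filter_upwards [coe_ae_eq_contRep (Y t) (hCt.summable one_lt_two)] with x hx
  rw [hx]
  refine hfg _ ?_
  have h1 := dist_contRep_le hCt hC0 x
  have h2 := hM x
  rw [← hY0] at h2
  have h3 := abs_sub_abs_le_abs_sub (contRep (Y t) x) (contRep (Y 0) x)
  linarith

/-! ### The fractional Laplacian at a maximum -/

theorem integrableOn_one_sub_cos {α : ℝ} (hα : 1 < α) (hα2 : α < 2) :
    IntegrableOn (fun y : ℝ => (1 - Real.cos y) * y ^ (-1 - α)) (Ioi 0) := by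
  have hm : AEStronglyMeasurable (fun y : ℝ => (1 - Real.cos y) * y ^ (-1 - α)) volume := by
    refine Measurable.aestronglyMeasurable ?_
    fun_prop
  rw [← Ioc_union_Ioi_eq_Ioi zero_le_one]
  refine IntegrableOn.union ?_ ?_
  · have h1 : IntegrableOn (fun y : ℝ => y ^ (1 - α)) (Ioc 0 1) := by
      rw [← intervalIntegrable_iff_integrableOn_Ioc_of_le zero_le_one]
      exact intervalIntegral.intervalIntegrable_rpow' (by linarith)
    refine Integrable.mono' h1 hm.restrict ?_
    filter_upwards [ae_restrict_mem measurableSet_Ioc] with y hy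
    have hy0 : 0 < y := hy.1
    have h2 := Real.one_sub_sq_div_two_le_cos (x := y)
    have h3 := Real.cos_le_one y
    rw [Real.norm_of_nonneg (mul_nonneg (by linarith) (by positivity))]
    calc _ ≤ y ^ (2 : ℝ) * y ^ (-1 - α) := by
          gcongr
          rw [Real.rpow_two]
          nlinarith [sq_nonneg y]
      _ = y ^ (1 - α) := by
          rw [← Real.rpow_add hy0]
          ring_nf
  · have h1 : IntegrableOn (fun y : ℝ => 2 * y ^ (-1 - α)) (Ioi 1) :=
      (integrableOn_Ioi_rpow_of_lt (by linarith) one_pos).const_mul 2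
    refine Integrable.mono' h1 hm.restrict ?_
    filter_upwards [ae_restrict_mem measurableSet_Ioi] with y hy
    have hy0 : 0 < y := one_pos.trans hy
    have h2 := Real.neg_one_le_cos y
    have h3 := Real.cos_le_one y
    rw [Real.norm_of_nonneg (mul_nonneg (by linarith) (by positivity))]
    gcongr
    linarith

/-- The constant in the singular integral formula for `Λ^α`. -/
def laplaceConst (α : ℝ) : ℝ := ∫ y in Ioi (0 : ℝ), (1 - Real.cos y) * y ^ (-1 - α)

theorem laplaceConst_pos {α : ℝ} (hα : 1 < α) (hα2 : α < 2) : 0 < laplaceConst α := by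
  have hint := integrableOn_one_sub_cos hα hα2
  have hnn : ∀ y : ℝ, y ∈ Ioi (0 : ℝ) → 0 ≤ (1 - Real.cos y) * y ^ (-1 - α) := fun y hy => by
    have hy0 : 0 < y := hy
    have h3 := Real.cos_le_one y
    exact mul_nonneg (by linarith) (by positivity)
  rw [laplaceConst, setIntegral_pos_iff_support_of_nonneg_ae
    ((ae_restrict_iff' measurableSet_Ioi).2 (Eventually.of_forall hnn)) hint]
  have hsub : Ioo (1 : ℝ) 2 ⊆
      Function.support (fun y : ℝ => (1 - Real.cos y) * y ^ (-1 - α)) ∩ Ioi 0 := by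
    intro y hy
    have hy0 : 0 < y := one_pos.trans hy.1
    refine ⟨?_, hy0⟩
    have h1 : Real.cos y < Real.cos 0 := Real.cos_lt_cos_of_nonneg_of_le_pi le_rfl
      (by linarith [hy.2, Real.pi_gt_three]) hy0
    rw [Real.cos_zero] at h1
    exact (mul_pos (by linarith) (by positivity)).ne'
  refine lt_of_lt_of_le ?_ (measure_mono hsub)
  simp

theorem integral_one_sub_cos_mul {α : ℝ} (hα : 1 < α) (hα2 : α < 2) {a : ℝ} (ha : 0 ≤ a) :
    IntegrableOn (fun y : ℝ => (1 - Real.cos (a * y)) * y ^ (-1 - α)) (Ioi 0) ∧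
      ∫ y in Ioi (0 : ℝ), (1 - Real.cos (a * y)) * y ^ (-1 - α) = laplaceConst α * a ^ α := by
  rcases ha.eq_or_lt with rfl | ha0
  · simp [Real.zero_rpow (by linarith : α ≠ 0)]
  · have h1 : ∀ y ∈ Ioi (0 : ℝ), a ^ (1 + α) * ((1 - Real.cos (a * y)) * (a * y) ^ (-1 - α))
        = (1 - Real.cos (a * y)) * y ^ (-1 - α) := fun y hy => by
      have hy0 : 0 < y := hy
      rw [Real.mul_rpow ha hy0.le, mul_left_comm, ← mul_assoc (a ^ (1 + α)), ← Real.rpow_add ha0]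
      ring_nf
      simp
    have h2 := (integrableOn_Ioi_comp_mul_left_iff
      (fun y : ℝ => (1 - Real.cos y) * y ^ (-1 - α)) 0 ha0).2
      (by simpa using integrableOn_one_sub_cos hα hα2)
    have h3 := integral_comp_mul_left_Ioi
      (fun y : ℝ => (1 - Real.cos y) * y ^ (-1 - α)) 0 ha0
    rw [mul_zero] at h3
    refine ⟨IntegrableOn.congr_fun (h2.const_mul (a ^ (1 + α))) h1 measurableSet_Ioi, ?_⟩
    rw [← setIntegral_congr_fun measurableSet_Ioi h1, integral_const_mul, h3, smul_eq_mul,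
      ← mul_assoc, laplaceConst, mul_comm]
    congr 1
    rw [← Real.rpow_neg_one, ← Real.rpow_add ha0]
    ring_nf

theorem two_pi_mul_rpow_le {α : ℝ} (hα0 : 0 ≤ α) (hα2 : α ≤ 2) (k : ℤ) :
    (2 * Real.pi * |(k : ℝ)|) ^ α ≤ (2 * Real.pi) ^ 2 * (1 + |(k : ℝ)|) ^ (2 : ℝ) := by
  have h1 : 1 ≤ 2 * Real.pi * (1 + |(k : ℝ)|) := by
    nlinarith [Real.pi_gt_three, abs_nonneg (k : ℝ)]
  calc (2 * Real.pi * |(k : ℝ)|) ^ α ≤ (2 * Real.pi * (1 + |(k : ℝ)|)) ^ α := by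
        gcongr
        linarith
    _ ≤ (2 * Real.pi * (1 + |(k : ℝ)|)) ^ (2 : ℝ) := Real.rpow_le_rpow_of_exponent_le h1 hα2
    _ = _ := by
        rw [Real.rpow_two, Real.rpow_two]
        ring

theorem Decay.fracLaplacian {α : ℝ} (hα0 : 0 ≤ α) (hα2 : α ≤ 2) {C : ℝ} {c : ℤ → ℂ}
    (h : Decay 4 C c) :
    Decay 2 ((2 * Real.pi) ^ 2 * C)
      (fun k => (((2 * Real.pi * |(k : ℝ)|) ^ α : ℝ) : ℂ) * c k) := fun k => by
  have hp : (0 : ℝ) < 1 + |(k : ℝ)| := by positivity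
  rw [norm_mul, Complex.norm_real, Real.norm_of_nonneg (by positivity)]
  calc _ ≤ (1 + |(k : ℝ)|) ^ (2 : ℝ)
        * (((2 * Real.pi) ^ 2 * (1 + |(k : ℝ)|) ^ (2 : ℝ)) * ‖c k‖) := by
        gcongr
        exact two_pi_mul_rpow_le hα0 hα2 k
    _ = (2 * Real.pi) ^ 2 * (((1 + |(k : ℝ)|) ^ (2 : ℝ) * (1 + |(k : ℝ)|) ^ (2 : ℝ)) * ‖c k‖) := by
        ring
    _ ≤ _ := by
        rw [← Real.rpow_add hp]
        norm_num only
        gcongr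
        exact h k

theorem Decay.derivative {C : ℝ} {c : ℤ → ℂ} (h : Decay 4 C c) :
    Decay 2 (2 * Real.pi * C) (fun k => 2 * Real.pi * Complex.I * k * c k) := fun k => by
  have hp : (0 : ℝ) < 1 + |(k : ℝ)| := by positivity
  have h1 := h.mono (s' := 3) (by norm_num) le_rfl k
  rw [norm_mul, norm_two_pi_I_mul]
  calc _ ≤ (1 + |(k : ℝ)|) ^ (2 : ℝ) * (2 * Real.pi * (1 + |(k : ℝ)|) ^ (1 : ℝ) * ‖c k‖) := by
        rw [Real.rpow_one]
        gcongr
        linarith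
    _ = 2 * Real.pi * (((1 + |(k : ℝ)|) ^ (2 : ℝ) * (1 + |(k : ℝ)|) ^ (1 : ℝ)) * ‖c k‖) := by
        ring
    _ ≤ _ := by
        rw [← Real.rpow_add hp]
        norm_num only
        gcongr

theorem fourier_add_point (k : ℤ) (x y : UnitAddCircle) :
    fourier k (x + y) = fourier k x * fourier k y := by
  simp [fourier_apply, smul_add, AddCircle.toCircle_add]

theorem fourier_coe_add_fourier_neg (k : ℤ) (y : ℝ) :
    fourier k (y : UnitAddCircle) + fourier k (-(y : UnitAddCircle))
      = 2 * ((Real.cos (2 * Real.pi * |(k : ℝ)| * y) : ℝ) : ℂ) := by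
  have h1 : Real.cos (2 * Real.pi * |(k : ℝ)| * y) = Real.cos (2 * Real.pi * k * y) := by
    rcases abs_cases (k : ℝ) with ⟨h, -⟩ | ⟨h, -⟩
    · rw [h]
    · rw [h, ← Real.cos_neg]
      ring_nf
  rw [h1, ← AddCircle.coe_neg, fourier_coe_apply, fourier_coe_apply]
  push_cast
  rw [Complex.two_cos]
  congr 1 <;> congr 1 <;> ring

theorem fourierSum_second_difference {C : ℝ} {c : ℤ → ℂ} (hc : Decay 4 C c) (x : UnitAddCircle)
    (y : ℝ) :
    HasSum (fun k => (c k * fourier k x).re * (1 - Real.cos (2 * Real.pi * |(k : ℝ)| * y)))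
      ((fourierSum c x).re - ((fourierSum c (x + (y : UnitAddCircle))).re
        + (fourierSum c (x + -(y : UnitAddCircle))).re) / 2) := by
  have hs := hc.summable (by norm_num)
  have h := fun z => Complex.hasSum_re (hasSum_fourierSum_apply hs z)
  refine ((h x).sub (((h (x + (y : UnitAddCircle))).add
    (h (x + -(y : UnitAddCircle)))).div_const 2)).congr_fun fun k => ?_
  have h1 := fourier_coe_add_fourier_neg k y
  have h2 : c k * fourier k (x + (y : UnitAddCircle)) + c k * fourier k (x + -(y : UnitAddCircle))
      = ((2 * Real.cos (2 * Real.pi * |(k : ℝ)| * y) : ℝ) : ℂ) * (c k * fourier k x) := by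
    rw [fourier_add_point, fourier_add_point]
    push_cast at h1 ⊢
    linear_combination c k * fourier k x * h1
  have h3 := congrArg Complex.re h2
  rw [Complex.add_re, Complex.re_ofReal_mul] at h3
  rw [h3]
  ring

theorem fracLaplacian_nonneg_at_max {α : ℝ} (hα : 1 < α) (hα2 : α < 2) {C : ℝ} {c : ℤ → ℂ}
    (hc : Decay 4 C c) {σ : ℝ} {x₀ : UnitAddCircle}
    (hmax : ∀ x, σ * (fourierSum c x).re ≤ σ * (fourierSum c x₀).re) :
    0 ≤ σ * (fourierSum (fun k => (((2 * Real.pi * |(k : ℝ)|) ^ α : ℝ) : ℂ) * c k) x₀).re := by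
  have hd := hc.fracLaplacian (by linarith : 0 ≤ α) hα2.le
  have hκ := laplaceConst_pos hα hα2
  set F : ℤ → ℝ → ℝ := fun k y => σ * (c k * fourier k x₀).re *
    ((1 - Real.cos (2 * Real.pi * |(k : ℝ)| * y)) * y ^ (-1 - α)) with hF
  have hI := fun k : ℤ => integral_one_sub_cos_mul hα hα2
    (show 0 ≤ 2 * Real.pi * |(k : ℝ)| by positivity)
  have hFi : ∀ k, Integrable (F k) (volume.restrict (Ioi 0)) := fun k => (hI k).1.const_mul _
  have hval : ∀ k, ∫ y in Ioi (0 : ℝ), F k y = laplaceConst α *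
      (σ * ((((2 * Real.pi * |(k : ℝ)|) ^ α : ℝ) : ℂ) * c k * fourier k x₀).re) := fun k => by
    rw [hF]
    simp only
    rw [integral_const_mul, (hI k).2, mul_assoc _ (c k), Complex.re_ofReal_mul]
    ring
  have hnorm : ∀ k, ∫ y in Ioi (0 : ℝ), ‖F k y‖ ≤ laplaceConst α * |σ| *
      ‖(((2 * Real.pi * |(k : ℝ)|) ^ α : ℝ) : ℂ) * c k‖ := fun k => by
    have h1 : ∀ y ∈ Ioi (0 : ℝ), ‖F k y‖ = |σ * (c k * fourier k x₀).re| *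
        ((1 - Real.cos (2 * Real.pi * |(k : ℝ)| * y)) * y ^ (-1 - α)) := fun y hy => by
      have hy0 : 0 < y := hy
      have h3 := Real.cos_le_one (2 * Real.pi * |(k : ℝ)| * y)
      rw [hF]
      simp only
      rw [norm_mul, Real.norm_eq_abs,
        Real.norm_of_nonneg (mul_nonneg (by linarith) (by positivity))]
    rw [setIntegral_congr_fun measurableSet_Ioi h1, integral_const_mul, (hI k).2, norm_mul,
      Complex.norm_real, Real.norm_of_nonneg (by positivity), abs_mul]
    have h2 : |(c k * fourier k x₀).re| ≤ ‖c k‖ := by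
      refine (Complex.abs_re_le_norm _).trans_eq ?_
      rw [norm_mul, fourier_apply, Circle.norm_coe, mul_one]
    calc _ ≤ |σ| * ‖c k‖ * (laplaceConst α * (2 * Real.pi * |(k : ℝ)|) ^ α) := by gcongr
      _ = _ := by ring
  have hsum : Summable fun k => ∫ y in Ioi (0 : ℝ), ‖F k y‖ :=
    Summable.of_nonneg_of_le (fun k => integral_nonneg fun _ => norm_nonneg _) hnorm
      ((hd.summable one_lt_two).mul_left _)
  have h1 := hasSum_integral_of_summable_integral_norm hFi hsum
  have h2 : 0 ≤ ∫ y in Ioi (0 : ℝ), ∑' k, F k y := by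
    refine setIntegral_nonneg measurableSet_Ioi fun y hy => ?_
    have hy0 : 0 < y := hy
    have h3 := ((fourierSum_second_difference hc x₀ y).mul_left σ).mul_right (y ^ (-1 - α))
    have h4 : (fun k => F k y) = fun k => σ * ((c k * fourier k x₀).re *
        (1 - Real.cos (2 * Real.pi * |(k : ℝ)| * y))) * y ^ (-1 - α) := by
      funext k
      rw [hF]
      ring
    rw [h4, h3.tsum_eq]
    refine mul_nonneg ?_ (by positivity)
    have h5 := hmax (x₀ + (y : UnitAddCircle))
    have h6 := hmax (x₀ + -(y : UnitAddCircle))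
    linarith
  have h3 := Complex.hasSum_re (hasSum_fourierSum_apply (hd.summable one_lt_two) x₀)
  have h4 := (h3.mul_left σ).mul_left (laplaceConst α)
  simp only [hval] at h1
  rw [h1.unique h4] at h2
  exact nonneg_of_mul_nonneg_right h2 hκ

/-! ### The maximum principle -/

theorem hasDerivAt_fourierSum {C : ℝ} {c : ℤ → ℂ} (hc : Decay 4 C c) (x : ℝ) :
    HasDerivAt (fun y : ℝ => fourierSum c (y : UnitAddCircle))
      (fourierSum (fun k => 2 * Real.pi * Complex.I * k * c k) (x : UnitAddCircle)) x := by
  have hs := hc.summable (by norm_num)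
  have hd := hc.derivative.summable one_lt_two
  have h1 : (fun y : ℝ => fourierSum c (y : UnitAddCircle))
      = fun y : ℝ => ∑' k, c k * fourier k (y : UnitAddCircle) :=
    funext fun y => (hasSum_fourierSum_apply hs _).tsum_eq.symm
  rw [h1, ← (hasSum_fourierSum_apply hd _).tsum_eq]
  refine hasDerivAt_tsum (g := fun k (y : ℝ) => c k * fourier k (y : UnitAddCircle))
    (g' := fun k (y : ℝ) => 2 * Real.pi * Complex.I * k * c k * fourier k (y : UnitAddCircle))
    (y₀ := (0 : ℝ)) hd (fun k y => ?_) (fun k y => ?_)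
    (hasSum_fourierSum_apply hs ((0 : ℝ) : UnitAddCircle)).summable x
  · refine ((hasDerivAt_fourier 1 k y).const_mul (c k)).congr_deriv ?_
    push_cast
    ring
  · rw [norm_mul, fourier_apply, Circle.norm_coe, mul_one]

theorem fourierSum_comp {C C' : ℝ} {v : RealL2} (hv : Decay 2 C (coeff v)) {F : C(ℝ, ℝ)}
    (hF : Decay 2 C' (coeff fun x => F (v x))) (x : UnitAddCircle) :
    fourierSum (coeff fun x => F (v x)) x = F (contRep v x) := by
  let g : C(UnitAddCircle, ℂ) :=
    (⟨fun y : ℝ => (y : ℂ), Complex.continuous_ofReal⟩ : C(ℝ, ℂ)).comp (F.comp (contRep v))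
  have h1 : fourierCoeff g = coeff fun x => F (v x) := by
    refine fourierCoeff_congr_ae ?_
    filter_upwards [coe_ae_eq_contRep v (hv.summable one_lt_two)] with x hx
    rw [hx]
    rfl
  have h2 := fourierSum_eq_of_continuous g (by
    rw [h1]
    exact hF.summable one_lt_two)
  rw [h1] at h2
  rw [h2]
  rfl

theorem deriv_comp_eq_zero_at_max {C C' : ℝ} {v : RealL2} (hv : Decay 4 C (coeff v))
    {F F' : C(ℝ, ℝ)} (hFd : ∀ y, HasDerivAt F (F' y) y)
    (hF : Decay 4 C' (coeff fun x => F (v x))) {σ : ℝ} (hσ : σ ≠ 0) {x₀ : UnitAddCircle}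
    (hmax : ∀ x, σ * contRep v x ≤ σ * contRep v x₀) :
    (fourierSum (fun k => 2 * Real.pi * Complex.I * k * coeff (fun x => F (v x)) k) x₀).re
      = 0 := by
  obtain ⟨x, rfl⟩ := QuotientAddGroup.mk_surjective x₀
  have h1 : HasDerivAt (fun y : ℝ => contRep v (y : UnitAddCircle)) _ x :=
    Complex.reCLM.hasFDerivAt.comp_hasDerivAt x (hasDerivAt_fourierSum hv x)
  have h2 : IsLocalMax (fun y : ℝ => σ * contRep v (y : UnitAddCircle)) x :=
    Eventually.of_forall fun y => hmax y
  have h3 := h2.hasDerivAt_eq_zero (h1.const_mul σ)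
  rw [mul_eq_zero, or_iff_right hσ] at h3
  rw [h3] at h1
  have h4 : HasDerivAt (fun y : ℝ => (fourierSum (coeff fun x => F (v x))
      (y : UnitAddCircle)).re) _ x :=
    Complex.reCLM.hasFDerivAt.comp_hasDerivAt x (hasDerivAt_fourierSum hF x)
  have h5 : (fun y : ℝ => (fourierSum (coeff fun x => F (v x)) (y : UnitAddCircle)).re)
      = fun y : ℝ => F (contRep v (y : UnitAddCircle)) := by
    funext y
    rw [fourierSum_comp (hv.mono (by norm_num) le_rfl) (hF.mono (by norm_num) le_rfl),
      Complex.ofReal_re]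
  rw [h5] at h4
  have h6 := (hFd (contRep v (x : UnitAddCircle))).comp x h1
  rw [mul_zero] at h6
  exact h4.unique h6

theorem hasDerivAt_of_duhamel {a : ℝ} {c₀ : ℂ} {c h : ℝ → ℂ} (hh : Continuous h)
    (hc : ∀ t, 0 ≤ t → c t = (Real.exp (-(a * t)) : ℝ) * c₀
      - ∫ τ in (0 : ℝ)..t, (Real.exp (-(a * (t - τ))) : ℝ) * h τ) {t : ℝ} (ht : 0 < t) :
    HasDerivAt c (-(a * c t) - h t) t := by
  have hcont : Continuous fun τ => ((Real.exp (a * τ) : ℝ) : ℂ) * h τ := by fun_prop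
  have h1 : ∀ t, 0 ≤ t → c t = (Real.exp (-(a * t)) : ℝ) *
      (c₀ - ∫ τ in (0 : ℝ)..t, (Real.exp (a * τ) : ℝ) * h τ) := fun t ht => by
    rw [hc t ht, mul_sub, ← intervalIntegral.integral_const_mul]
    congr 1
    refine intervalIntegral.integral_congr fun τ _ => ?_
    rw [← mul_assoc, ← Complex.ofReal_mul, ← Real.exp_add]
    ring_nf
  have h2 : HasDerivAt (fun t => ∫ τ in (0 : ℝ)..t, ((Real.exp (a * τ) : ℝ) : ℂ) * h τ)
      ((Real.exp (a * t) : ℝ) * h t) t :=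
    intervalIntegral.integral_hasDerivAt_right (hcont.intervalIntegrable _ _)
      (hcont.stronglyMeasurableAtFilter _ _) hcont.continuousAt
  have h3 : HasDerivAt (fun t => ((Real.exp (-(a * t)) : ℝ) : ℂ))
      ((Real.exp (-(a * t)) * -a : ℝ) : ℂ) t := by
    have h4 : HasDerivAt (fun t => -(a * t)) (-a) t := by
      refine (((hasDerivAt_id t).const_mul a).neg).congr_deriv ?_
      simp
    exact h4.exp.ofReal_comp
  have h5 := h3.mul (h2.const_sub c₀)
  have h6 : c =ᶠ[𝓝 t] fun t => (Real.exp (-(a * t)) : ℝ) *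
      (c₀ - ∫ τ in (0 : ℝ)..t, (Real.exp (a * τ) : ℝ) * h τ) := by
    filter_upwards [Ioi_mem_nhds ht] with s hs
    exact h1 s (le_of_lt hs)
  refine (HasDerivAt.congr_of_eventuallyEq h5 h6).congr_deriv ?_
  have h7 : ((Real.exp (-(a * t)) : ℝ) : ℂ) * ((Real.exp (a * t) : ℝ) : ℂ) = 1 := by
    rw [← Complex.ofReal_mul, ← Real.exp_add]
    simp
  rw [h1 t ht.le]
  rw [Complex.ofReal_mul, Complex.ofReal_neg]
  linear_combination (-(h t)) * h7

theorem DuhamelAt.hasDerivAt {α ν : ℝ} {c₀ : ℤ → ℂ} {g c : ℝ → ℤ → ℂ} {k : ℤ}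
    (h : ∀ t, 0 ≤ t → DuhamelAt α ν c₀ g t (c t)) (hg : Continuous fun t => g t k) {t : ℝ}
    (ht : 0 < t) :
    HasDerivAt (fun t => c t k) (-(ν * ((((2 * Real.pi * |(k : ℝ)|) ^ α : ℝ) : ℂ) * c t k))
      - 2 * Real.pi * Complex.I * k * g t k) t := by
  refine (hasDerivAt_of_duhamel (a := (2 * Real.pi * |(k : ℝ)|) ^ α * ν) (c₀ := c₀ k)
    (h := fun τ => 2 * Real.pi * Complex.I * k * g τ k) (by fun_prop) (fun s hs => ?_)
    ht).congr_deriv ?_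
  · rw [h s hs k, mul_assoc (_ ^ α) ν s]
    congr 1
    refine intervalIntegral.integral_congr fun τ _ => ?_
    simp only [derivHeatSymbol]
    rw [mul_assoc _ ν]
    ring
  · push_cast
    ring

theorem hasDerivAt_fourierSum_time {α ν : ℝ} (hα0 : 0 ≤ α) (hα2 : α ≤ 2) (hν : 0 ≤ ν)
    {c₀ : ℤ → ℂ} {g c : ℝ → ℤ → ℂ} {T C C' : ℝ}
    (h : ∀ t, 0 ≤ t → DuhamelAt α ν c₀ g t (c t)) (hg : ∀ k, Continuous fun t => g t k)
    (hcd : ∀ t ∈ Icc 0 T, Decay 4 C (c t)) (hgd : ∀ t ∈ Icc 0 T, Decay 4 C' (g t)) {t : ℝ}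
    (ht : t ∈ Ioo 0 T) (x : UnitAddCircle) :
    HasDerivAt (fun t => fourierSum (c t) x)
      (-(ν * fourierSum (fun k => (((2 * Real.pi * |(k : ℝ)|) ^ α : ℝ) : ℂ) * c t k) x)
        - fourierSum (fun k => 2 * Real.pi * Complex.I * k * g t k) x) t := by
  have hIcc : ∀ s ∈ Ioo 0 T, s ∈ Icc 0 T := fun s hs => Ioo_subset_Icc_self hs
  have hd1 := fun s hs => (hcd s (hIcc s hs)).fracLaplacian hα0 hα2
  have hd2 := fun s hs => (hgd s (hIcc s hs)).derivative
  have hu : Summable fun k : ℤ => (ν * ((2 * Real.pi) ^ 2 * C) + 2 * Real.pi * C')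
      * (1 + |(k : ℝ)|) ^ (-(2 : ℝ)) := (summable_weight one_lt_two).mul_left _
  have h1 : HasDerivAt (fun s => ∑' k, c s k * fourier k x)
      (∑' k : ℤ, (-(ν * ((((2 * Real.pi * |(k : ℝ)|) ^ α : ℝ) : ℂ) * c t k))
        - 2 * Real.pi * Complex.I * k * g t k) * fourier k x) t := by
    refine hasDerivAt_tsum_of_isPreconnected (g := fun k s => c s k * fourier k x)
      (g' := fun (k : ℤ) s => (-(ν * ((((2 * Real.pi * |(k : ℝ)|) ^ α : ℝ) : ℂ) * c s k))
        - 2 * Real.pi * Complex.I * k * g s k) * fourier k x) hu isOpen_Ioo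
      isPreconnected_Ioo (fun k s hs => ?_) (fun k s hs => ?_) ht
      (hasSum_fourierSum_apply ((hcd t (hIcc t ht)).summable (by norm_num)) x).summable ht
    · exact (DuhamelAt.hasDerivAt h (hg k) hs.1).mul_const _
    · rw [norm_mul, fourier_apply, Circle.norm_coe, mul_one, add_mul, mul_assoc ν]
      refine (norm_sub_le _ _).trans (add_le_add ?_ ((hd2 s hs).norm_le k))
      rw [norm_neg, norm_mul, Complex.norm_real, Real.norm_of_nonneg hν]
      exact mul_le_mul_of_nonneg_left ((hd1 s hs).norm_le k) hν
  have h2 : (fun s => fourierSum (c s) x) =ᶠ[𝓝 t] fun s => ∑' k, c s k * fourier k x := by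
    filter_upwards [Ioo_mem_nhds ht.1 ht.2] with s hs
    exact (hasSum_fourierSum_apply ((hcd s (hIcc s hs)).summable (by norm_num)) x).tsum_eq.symm
  refine (h1.congr_of_eventuallyEq h2).congr_deriv ?_
  have h3 := hasSum_fourierSum_apply ((hd1 t ht).summable one_lt_two) x
  have h4 := hasSum_fourierSum_apply ((hd2 t ht).summable one_lt_two) x
  refine HasSum.tsum_eq (((h3.mul_left (ν : ℂ)).neg.sub h4).congr_fun fun k => ?_)
  ring

theorem continuousOn_fourierSum_time {c : ℝ → ℤ → ℂ} {T C : ℝ}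
    (hc : ∀ k, Continuous fun t => c t k) (hcd : ∀ t ∈ Icc 0 T, Decay 2 C (c t)) :
    ContinuousOn (fun p : ℝ × UnitAddCircle => fourierSum (c p.1) p.2) (Icc 0 T ×ˢ univ) := by
  have h1 : ContinuousOn (fun p : ℝ × UnitAddCircle => ∑' k, c p.1 k * fourier k p.2)
      (Icc 0 T ×ˢ univ) := by
    refine continuousOn_tsum (fun k => ?_) ((summable_weight one_lt_two).mul_left C)
      fun k p hp => ?_
    · exact (((hc k).comp continuous_fst).mul
        ((fourier k).continuous.comp continuous_snd)).continuousOn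
    · rw [norm_mul, fourier_apply, Circle.norm_coe, mul_one]
      exact (hcd p.1 hp.1).norm_le k
  refine h1.congr fun p hp => ?_
  exact (hasSum_fourierSum_apply ((hcd p.1 hp.1).summable one_lt_two) p.2).tsum_eq.symm

theorem le_of_hasDerivAt_of_isMaxOn_left {φ : ℝ → ℝ} {φ' ε t₀ : ℝ} (h : HasDerivAt φ φ' t₀)
    (ht₀ : 0 < t₀) (hmax : ∀ t ∈ Icc 0 t₀, φ t - ε * t ≤ φ t₀ - ε * t₀) : ε ≤ φ' := by
  have h1 := h.tendsto_slope.mono_left (nhdsWithin_mono t₀ (s := Iio t₀) fun t ht => ne_of_lt ht)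
  refine ge_of_tendsto h1 ?_
  filter_upwards [self_mem_nhdsWithin, mem_nhdsWithin_of_mem_nhds (Ioi_mem_nhds ht₀)] with t h2 h3
  have h4 : t < t₀ := h2
  have h5 := hmax t ⟨le_of_lt h3, h4.le⟩
  rw [slope_comm, slope_def_field, le_div_iff₀ (by linarith)]
  linarith

theorem maximum_principle {α ν : ℝ} (hα : 1 < α) (hα2 : α < 2) (hν : 0 < ν) {f : ℝ → ℝ}
    (hf : ContDiff ℝ ∞ f) (hf0 : f 0 = 0) {L : ℝ} (hL : ∀ y, |deriv f y| ≤ L) {u₀ : RealL2}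
    (hu₀ : IsSmooth u₀) {Y : ℝ → RealL2} (hYc : Continuous Y) (hY : IsMildSolution α ν f u₀ ⊤ Y)
    {σ M : ℝ} (hσ : σ ≠ 0) (hM : ∀ x, σ * contRep u₀ x ≤ M) {t : ℝ} (ht : 0 ≤ t)
    (x : UnitAddCircle) : σ * contRep (Y t) x ≤ M := by
  have hL0 : 0 ≤ L := (abs_nonneg _).trans (hL 0)
  have hlip : LipschitzWith ⟨L, hL0⟩ f :=
    lipschitzWith_of_nnnorm_deriv_le (contDiff_infty_iff_deriv.1 hf).1 hL
  have hmem : ∀ t : ℝ, 0 ≤ t → t ∈ timeInterval ⊤ := fun t ht => ⟨ht, EReal.coe_lt_top t⟩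
  have hduh := fun t ht => hY.duhamelAt hν.le (hmem t ht)
  have hY0 : Y 0 = u₀ := by
    refine realL2_ext fun k => ?_
    rw [hduh 0 le_rfl k]
    simp
  have hg : ∀ k, Continuous fun τ => coeff (fun x => f (Y τ x)) k := fun k => by
    have h1 : (fun τ => coeff (fun x => f (Y τ x)) k)
        = fun τ => coeff (hlip.compLp hf0 (Y τ)) k :=
      funext fun τ => (coeff_congr (hlip.coeFn_compLp hf0 (Y τ)) k).symm
    rw [h1]
    exact (continuous_coeff k).comp ((hlip.continuous_compLp hf0).comp hYc)
  have hU : UniformDecay 4 (t + 1) Y := UniformDecay.all hα hν hf hu₀.decay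
    (hY.1.bddH1 (Icc_subset_timeInterval (hmem _ (by linarith)))) (fun s hs => hduh s hs.1) 4
  obtain ⟨C, hC⟩ := hU.self
  obtain ⟨C', hC'⟩ := hU f hf
  obtain ⟨F, F', rfl, hF, -⟩ := exists_continuousMap_deriv hf
  have hcontU : ContinuousOn (fun p : ℝ × UnitAddCircle => σ * contRep (Y p.1) p.2)
      (Icc 0 (t + 1) ×ˢ univ) :=
    (Complex.continuous_re.comp_continuousOn (continuousOn_fourierSum_time
      (fun k => (continuous_coeff k).comp hYc)
      fun s hs => (hC s hs).mono (by norm_num) le_rfl)).const_smul σ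
  have key : ∀ ε : ℝ, 0 < ε → σ * contRep (Y t) x ≤ M + ε * t := by
    intro ε hε
    have hcont : ContinuousOn (fun p : ℝ × UnitAddCircle => σ * contRep (Y p.1) p.2 - ε * p.1)
        (Icc 0 t ×ˢ univ) :=
      (hcontU.mono (prod_mono (Icc_subset_Icc_right (by linarith)) subset_rfl)).sub
        (Continuous.continuousOn (by fun_prop))
    obtain ⟨⟨t₀, x₀⟩, ⟨ht₀, -⟩, hmax⟩ := (isCompact_Icc.prod isCompact_univ).exists_isMaxOn
      ⟨(t, x), ⟨⟨ht, le_rfl⟩, mem_univ _⟩⟩ hcont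
    have hmax' : ∀ s ∈ Icc 0 t, ∀ y,
        σ * contRep (Y s) y - ε * s ≤ σ * contRep (Y t₀) x₀ - ε * t₀ := fun s hs y =>
      isMaxOn_iff.1 hmax (s, y) ⟨hs, mem_univ y⟩
    simp only at ht₀
    rcases ht₀.1.eq_or_lt with h0 | h0
    · have h1 := hmax' t ⟨ht, le_rfl⟩ x
      rw [← h0, hY0] at h1
      have h2 := hM x₀
      linarith
    · exfalso
      have ht₀' : t₀ ∈ Ioo 0 (t + 1) := ⟨h0, by linarith [ht₀.2]⟩
      have hCt := hC t₀ (Ioo_subset_Icc_self ht₀')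
      have hCt' := hC' t₀ (Ioo_subset_Icc_self ht₀')
      have hxmax : ∀ y, σ * contRep (Y t₀) y ≤ σ * contRep (Y t₀) x₀ := fun y => by
        linarith [hmax' t₀ ht₀ y]
      have hd := hasDerivAt_fourierSum_time (by linarith) hα2.le hν.le hduh hg hC hC' ht₀' x₀
      have hd2 : HasDerivAt (fun s => σ * contRep (Y s) x₀) _ t₀ :=
        (Complex.reCLM.hasFDerivAt.comp_hasDerivAt t₀ hd).const_mul σ
      have hle := le_of_hasDerivAt_of_isMaxOn_left hd2 h0 fun s hs =>
        hmax' s ⟨hs.1, hs.2.trans ht₀.2⟩ x₀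
      have h3 := fracLaplacian_nonneg_at_max hα hα2 hCt hxmax
      have h4 := deriv_comp_eq_zero_at_max hCt hF hCt' hσ hxmax
      rw [Complex.reCLM_apply, Complex.sub_re, h4, Complex.neg_re, Complex.re_ofReal_mul] at hle
      nlinarith
  have hlim : Tendsto (fun ε : ℝ => M + ε * t) (𝓝[>] 0) (𝓝 M) := by
    have h1 : Continuous fun ε : ℝ => M + ε * t := by fun_prop
    have h2 := h1.tendsto 0
    rw [zero_mul, add_zero] at h2
    exact h2.mono_left nhdsWithin_le_nhds
  refine ge_of_tendsto hlim ?_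
  filter_upwards [self_mem_nhdsWithin] with ε hε
  exact key ε hε

theorem exists_global_solution {α ν : ℝ} (hα : 1 < α) (hα2 : α < 2) (hν : 0 < ν) {f : ℝ → ℝ}
    (hf : ContDiff ℝ ∞ f) {u₀ : RealL2} (hu₀ : IsSmooth u₀) :
    ∃ Y : ℝ → RealL2, IsMildSolution α ν f u₀ ⊤ Y := by
  obtain ⟨M, hM⟩ := exists_abs_contRep_le hu₀
  obtain ⟨g, hg, hg0, ⟨L, hL⟩, hfg⟩ := exists_truncation hf M
  obtain ⟨Y, hYc, hY⟩ := exists_global_of_lipschitz hα hν hg hg0 hL hu₀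
  refine ⟨Y, hY.congr_flux (c := f 0) fun t ht => ?_⟩
  obtain ⟨C, hC⟩ := hY.exists_decay hα hν hg hu₀ ht 2
  filter_upwards [coe_ae_eq_contRep (Y t) ((hC t ⟨ht.1, le_rfl⟩).summable one_lt_two)] with x hx
  rw [hx]
  refine hfg _ (abs_le.2 ⟨?_, ?_⟩)
  · have h1 := maximum_principle hα hα2 hν hg hg0 hL hu₀ hYc hY (σ := -1) (M := M) (by norm_num)
      (fun x => by linarith [(abs_le.1 (hM x)).1]) ht.1 x
    linarith
  · have h1 := maximum_principle hα hα2 hν hg hg0 hL hu₀ hYc hY (σ := 1) (M := M) (by norm_num)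
      (fun x => by linarith [(abs_le.1 (hM x)).2]) ht.1 x
    linarith

end FracBurgers

end

theorem mainTheorem5
    (α ν : ℝ) (hα : 1 < α) (hν : 0 < ν)
    (f : ℝ → ℝ) (hf : ContDiff ℝ ∞ f)
    (u₀ : FracBurgers.RealL2) (hu₀ : FracBurgers.IsSmooth u₀) :
    -- the gain of regularity
    (∀ (T : EReal) (Y : ℝ → FracBurgers.RealL2), 0 < T →
      FracBurgers.IsMildSolution α ν f u₀ T Y →
      ∀ s : ℝ, 1 ≤ s →
        FracBurgers.ContH s (FracBurgers.timeInterval T) Y →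
        FracBurgers.ContH (s + (α - 1) / 2) (FracBurgers.timeInterval T) Y) ∧
    -- local existence
    (∃ (T : ℝ) (Y : ℝ → FracBurgers.RealL2), 0 < T ∧
      FracBurgers.IsMildSolution α ν f u₀ T Y) ∧
    -- uniqueness
    (∀ (T : EReal) (Y Z : ℝ → FracBurgers.RealL2), 0 < T →
      FracBurgers.IsMildSolution α ν f u₀ T Y →
      FracBurgers.IsMildSolution α ν f u₀ T Z →
      ∀ t ∈ FracBurgers.timeInterval T, Y t = Z t) ∧
    -- smoothness in space
    (∀ (T : EReal) (Y : ℝ → FracBurgers.RealL2), 0 < T →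
      FracBurgers.IsMildSolution α ν f u₀ T Y →
      (∀ m : ℕ, FracBurgers.ContH m (FracBurgers.timeInterval T) Y) ∧
        ∀ t ∈ FracBurgers.timeInterval T, FracBurgers.IsSmooth (Y t)) ∧
    -- global solvability, in the subcritical range and for strongly convex `f`
    (α < 2 → (∃ σ : ℝ, 0 < σ ∧ ∀ y : ℝ, σ ≤ iteratedDeriv 2 f y) →
      ∃ Y : ℝ → FracBurgers.RealL2, FracBurgers.IsMildSolution α ν f u₀ ⊤ Y ∧
        ∀ (T : EReal) (Z : ℝ → FracBurgers.RealL2), 0 < T →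
          FracBurgers.IsMildSolution α ν f u₀ T Z →
          ∀ t ∈ FracBurgers.timeInterval T, Z t = Y t) := by
  refine ⟨fun T Y _ hY s hs _ => hY.contH hα hν hf hu₀ (by linarith),
    FracBurgers.exists_local_solution hα hν hf hu₀,
    fun T Y Z _ hY hZ t ht => hY.unique hα hν hf hZ ht,
    fun T Y _ hY => ⟨fun m => hY.contH hα hν hf hu₀ m.cast_nonneg,
      fun t ht => hY.isSmooth hα hν hf hu₀ ht⟩, fun hα2 _ => ?_⟩
  obtain ⟨Y, hY⟩ := FracBurgers.exists_global_solution hα hα2 hν hf hu₀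
  exact ⟨Y, hY, fun T Z _ hZ t ht => hZ.unique hα hν hf (hY.mono le_top) ht⟩
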